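/- **Setting.** Let $M=\mathbb T^2=\mathbb R/\mathbb Z\times\mathbb R/\mathbb Z$ with coordinates $(\theta,r)$, normalized area $\mu$ and flat metric $\omega_0$, and let $R_t(\theta,r)=(\theta+t,r)$. Identify $\mathbb P TM$ with $\mathbb T^2\times\mathbb R/\mathbb Z$, where $t\in\mathbb R/\mathbb Z$ stands for the line of angle $\pi t$, with the flat product distance; $(h,\mathrm dh)$ denotes the projectivized derivative extension of a diffeomorphism $h$, $\lambda$ is Lebesgue measure on $\mathbb R/\mathbb Z$, $\pi_r$ is the projection to the $r$-circle, and $\pi_M:\mathbb PTM\to M$ is the projection. $d_1$ is the $C^1$ distance between diffeomorphisms (comparing also the inverses). For $n\ge1$ let $\alpha_n=p_n/q_n$ ($p_n\in\mathbb Z$, $q_n\ge1$), $h_n=g_n\circ\phi_n$ with $g_n,\phi_n$ smooth area-preserving diffeomorphisms of $\mathbb T^2$ commuting with $R_{\alpha_n}$, $H_n=h_1\circ\dots\circ h_n$ ($H_0=\mathrm{id}$), and $f_n=H_n\circ R_{\alpha_{n+1}}\circ H_n^{-1}$. Let $k_n\in\mathbb N$, $\tfrac14<\sigma<\tfrac12$,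 and put $a_n=k_n^5$, $b_n=[nq_n^\sigma]$, $\epsilon_n=\frac1{2n^5k_n^{10}}$. Assume for all $n\ge1$: * $k_n\ge n^5$, and $\operatorname{diam}(\hat S)<\frac3{k_n}$ implies $\operatorname{diam}\big((H_{n-1},\mathrm dH_{n-1})(\hat S)\big)\le\frac1{n^2}$ for every $\hat S\subset\mathbb PTM$; $\sum_{u\ge n}k_u^{-5}\le\frac1{4k_n^4}$; $q_n^{1/4}>2k_n$; and $\frac{b_n}{a_n}\le\frac1{nk_n^2}$ for $n>4$. * $g_n$ commutes with $R_{1/q_n}$, and for $0\le j<a_n$ it acts on $\mathbb T^1\times[\frac{j+2\epsilon_n}{a_n},\frac{j+1-2\epsilon_n}{a_n}]$ as the translation by $b_n\frac j{a_n}$ in the $\theta$-direction. Let $\mathcal G_n$ be the union of these strips. Let $f$ be a smooth diffeomorphism of $\mathbb T^2$ with $d_1(f_n,f)\to0$ (so $(f_n,\mathrm df_n)\to(f,\mathrm df)$), and let $m_n\in\mathbb N$ with $d_1(f_n^{m_n},f^{m_n})<2^{-n}$ for all $n\ge1$. **Partitions.** For $n\ge1$ let $\tilde\eta_n$ be a family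 of pairwise disjoint sets $\tilde I_n=\bigcup_{l=0}^{k_n-1}\tilde I_{n,l}$, with disjoint measurable pieces $\tilde I_{n,l}$, such that * (D1) on each $\tilde I_n\in\tilde\eta_n$ the map $h_n$ acts by translations and rotations (its differential at each point is a rotation); * (D2) each $\tilde I_{n,l}\subset\mathcal G_n$ is a union of squares of side less than $\frac1{2k_n^5q_n}$; * (D3) the pieces of each $\tilde I_n$ have equal measure, at least $\frac1{2k_n^6q_n}(1-\frac{16}{k_n^5})$, and $\mu(\bigcup\tilde\eta_n)\ge1-\frac{25}{k_n^5}$; * (D4) each piece $\tilde I_{n,l}$ differs from the union of those sets $h_n(\tilde I'_{n,s})$, $\tilde I'_n\in\tilde\eta_n$, that meet it by measure at most $\frac{41}{k_n^5}\mu(\tilde I_{n,l})$ (symmetric difference); * (D5) each piece $\tilde I_{n,l}$ differs from the union of those pieces $\tilde I_{n+1,l'}$ of elements of $\tilde\eta_{n+1}$ that meet it by measure at most $\frac{25}{k_{n+1}^5}\mu(\tilde I_{n,l})$. With $T_j=[\frac j{k_n},\frac{j+1}{k_n}]$ let $\hat\eta_n=\{\tilde I_n\times T_j:\tilde I_n\in\tilde\eta_n,\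 0\le j<k_n\}$ and $\hat\nu_n=\{(H_{n-1},\mathrm dH_{n-1})\circ(g_n,\mathrm dg_n)(\hat I):\hat I\in\hat\eta_n\}$. **The measure.** Let $\omega_\infty=\lim_n(H_n^{-1})^*\omega_0$ (pointwise limit), and let $\bar\mu$ be the measure on $\mathbb PTM$ with base measure $\mu$ and, on the fiber over $x$, the normalized arc length of $\omega_\infty|_x$. Assume $\hat\eta_n\to\epsilon$ and $\hat\nu_n\to\epsilon$, i.e. for every measurable $A\subset\mathbb PTM$ there are measurable unions $A_n$ of elements of the $n$th family with $\bar\mu(A\triangle A_n)\to0$. **Distribution.** A map $(\Phi,\mathrm d\Phi)$ is $(\gamma,\delta,\varepsilon_1,\varepsilon_2)$-distributing $\tilde I_n\times T_j$ if there are measurable $J_l\subseteq\pi_r(\Phi(\tilde I_{n,l}))$, $0\le l<k_n$, with $1-\delta\le\lambda(J_l)\le1$ such that: $\Phi(\tilde I_{n,l})\subseteq[c_l,c_l+\gamma]\times\mathbb T^1$ for some $c_l\in\mathbb T^1$; for all $l$ and all measurable $\tilde J\subseteq J_l$, $$\Big|\tfrac{\mu(\tilde I_{n,l}\cap\Phi^{-1}(\mathbb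 T\times\tilde J))}{\mu(\tilde I_{n,l})}-\tfrac{\lambda(\tilde J)}{\lambda(J_l)}\Big|\le\varepsilon_1\tfrac{\lambda(\tilde J)}{\lambda(J_l)};$$ and for every $k\in\{0,\dots,k_n-1\}$ there is a unique $l\in\{0,\dots,k_n-1\}$ with $k\equiv l+j\bmod k_n$ such that, for all measurable $\tilde J\subseteq J_l$, $$\Big|\tfrac{\mu(\pi_M((\tilde I_{n,l}\times T_j)\cap(\Phi,\mathrm d\Phi)^{-1}(\mathbb T\times\tilde J\times T_k)))}{\mu(\tilde I_{n,l})}-\tfrac{\lambda(\tilde J)}{\lambda(J_l)}\Big|\le\varepsilon_2\tfrac{\lambda(\tilde J)}{\lambda(J_l)}.$$ **Proposition.** Suppose that for every $n\ge1$ the map $(\Phi_n,\mathrm d\Phi_n)$, $\Phi_n=\phi_n\circ R_{\alpha_{n+1}}^{m_n}\circ\phi_n^{-1}$, is $(\gamma_n,\delta_n,\varepsilon_{1,n},\varepsilon_{2,n})$-distributing every element of $\hat\eta_n$, with $\gamma_n<\frac1{k_n^3q_n}$, $\delta_n<\frac{50}{k_n^2}$, $\varepsilon_{1,n},\varepsilon_{2,n}<\frac1n$.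 Then the limit $\omega_\infty$ exists and is positive definite $\mu$-almost everywhere, $\bar\mu$ is a probability measure invariant under $(f,\mathrm df)$, and $(f,\mathrm df)$ is weakly mixing on $\mathbb PTM$ with respect to $\bar\mu$ (no nonconstant $L^2$ eigenfunction). -/

import Mathlib

open MeasureTheory Filter Set
open scoped Topology ContDiff ENNReal

noncomputable section

namespace AbC

/-! ### The torus, its diffeomorphisms and their derivatives -/

/-- The two-torus `ℝ/ℤ × ℝ/ℤ` with coordinates `(θ, r)`; `volume` is the normalized area `μ`. -/
abbrev Torus := UnitAddCircle × UnitAddCircle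

/-- The projectivized tangent bundle of the torus. As the tangent bundle is trivial, a point is a
base point together with a line of the plane; the third coordinate `t ∈ ℝ/ℤ` stands for the line
with angle `π t`. -/
abbrev ProjTM := Torus × UnitAddCircle

/-- The covering map of the torus by the plane. -/
def toTorus (x : ℝ × ℝ) : Torus := ((x.1 : UnitAddCircle), (x.2 : UnitAddCircle))

/-- A smooth self-map of the torus: it has a smooth lift to the plane. -/
def IsSmoothMap (h : Torus → Torus) : Prop :=
  ∃ F : ℝ × ℝ → ℝ × ℝ, ContDiff ℝ ∞ F ∧ ∀ x, h (toTorus x) = toTorus (F x)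

/-- Smooth diffeomorphisms of the torus. -/
def IsSmoothDiffeo (h : Equiv.Perm Torus) : Prop :=
  IsSmoothMap h ∧ IsSmoothMap h.symm

/-- Smooth area-preserving diffeomorphisms of the torus. -/
def IsAreaPreservingDiffeo (h : Equiv.Perm Torus) : Prop :=
  IsSmoothDiffeo h ∧ MeasurePreserving h (volume : Measure Torus) volume

/-- The representative in `[-1/2, 1/2)` of a point of the circle. -/
def smallRep (t : UnitAddCircle) : ℝ := (AddCircle.equivIco 1 (-1 / 2) t : ℝ)

/-- The map `h` in translation charts around `p` and `h p`. -/
def localMap (h : Torus → Torus) (p : Torus) (v : ℝ × ℝ) : ℝ × ℝ :=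
  (smallRep (h (p + toTorus v) - h p).1, smallRep (h (p + toTorus v) - h p).2)

/-- The derivative of `h` at `p`, as a matrix in the coordinates `(θ, r)`. -/
def jacobian (h : Torus → Torus) (p : Torus) : Matrix (Fin 2) (Fin 2) ℝ :=
  !![(fderiv ℝ (localMap h p) 0 (1, 0)).1, (fderiv ℝ (localMap h p) 0 (0, 1)).1;
     (fderiv ℝ (localMap h p) 0 (1, 0)).2, (fderiv ℝ (localMap h p) 0 (0, 1)).2]

/-- The unit vector `(cos π t, sin π t)`, for the representative of `t` in `[0, 1)`. -/
def lineVec (t : UnitAddCircle) : Fin 2 → ℝ :=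
  ![Real.cos (Real.pi * (AddCircle.equivIco 1 0 t : ℝ)),
    Real.sin (Real.pi * (AddCircle.equivIco 1 0 t : ℝ))]

/-- The coordinate in `ℝ/ℤ` of the line spanned by a nonzero vector: its angle divided by `π`. -/
def lineCoord (w : Fin 2 → ℝ) : UnitAddCircle :=
  ((Complex.arg ⟨w 0, w 1⟩ / Real.pi : ℝ) : UnitAddCircle)

/-- The action of an invertible matrix on lines. -/
def projAct (A : Matrix (Fin 2) (Fin 2) ℝ) (t : UnitAddCircle) : UnitAddCircle :=
  lineCoord (A.mulVec (lineVec t))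

/-- The projectivized derivative extension `(h, dh)`. -/
def projExt (h : Torus → Torus) (x : ProjTM) : ProjTM :=
  (h x.1, projAct (jacobian h x.1) x.2)

/-- The one-sided `C¹` distance: coordinates are compared on the circle, and first partial
derivatives entry by entry. -/
def dTilde1 (F G : Equiv.Perm Torus) : ℝ≥0∞ :=
  max (⨆ x, edist (F x) (G x))
    (⨆ x, ⨆ i, ⨆ j, edist (jacobian F x i j) (jacobian G x i j))

/-- The `C¹` distance `d₁` between diffeomorphisms, which also compares the inverses. -/
def d1 (F G : Equiv.Perm Torus) : ℝ≥0∞ :=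
  max (dTilde1 F G) (dTilde1 F⁻¹ G⁻¹)

/-- The flat product distance on the projectivized tangent bundle. -/
def ptDist (x y : ProjTM) : ℝ :=
  Real.sqrt (‖x.1.1 - y.1.1‖ ^ 2 + ‖x.1.2 - y.1.2‖ ^ 2 + ‖x.2 - y.2‖ ^ 2)

/-- The diameter with respect to `ptDist`. -/
def ptDiam (S : Set ProjTM) : ℝ≥0∞ :=
  ⨆ x ∈ S, ⨆ y ∈ S, ENNReal.ofReal (ptDist x y)

/-! ### Approximation by conjugation -/

/-- The circle action `R_t (θ, r) = (θ + t, r)`. -/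
def rot (t : UnitAddCircle) : Equiv.Perm Torus :=
  (Equiv.addRight t).prodCongr (Equiv.refl UnitAddCircle)

/-- The rational `p n / q n` modulo one. -/
def alpha (p : ℕ → ℤ) (q : ℕ → ℕ) (n : ℕ) : UnitAddCircle :=
  ((p n / q n : ℝ) : UnitAddCircle)

/-- `h n = g n ∘ φ n`. -/
def stepConj (g φ : ℕ → Equiv.Perm Torus) (n : ℕ) : Equiv.Perm Torus := g n * φ n

/-- `H n = h 1 ∘ ⋯ ∘ h n`, with `H 0` the identity. -/
def bigConj (g φ : ℕ → Equiv.Perm Torus) : ℕ → Equiv.Perm Torus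
  | 0 => 1
  | n + 1 => bigConj g φ n * stepConj g φ (n + 1)

/-- `f n = H n ∘ R_{α (n+1)} ∘ (H n)⁻¹`. -/
def approxMap (p : ℕ → ℤ) (q : ℕ → ℕ) (g φ : ℕ → Equiv.Perm Torus) (n : ℕ) : Equiv.Perm Torus :=
  bigConj g φ n * rot (alpha p q (n + 1)) * (bigConj g φ n)⁻¹

/-- `Φ n = φ n ∘ R_{α (n+1)} ^ (m n) ∘ (φ n)⁻¹`. -/
def bigPhi (p : ℕ → ℤ) (q : ℕ → ℕ) (φ : ℕ → Equiv.Perm Torus) (m : ℕ → ℕ) (n : ℕ) :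
    Equiv.Perm Torus :=
  φ n * rot (alpha p q (n + 1)) ^ m n * (φ n)⁻¹

/-- The conjugation maps of the scheme: for `n ≥ 1` the maps `g n` and `φ n` are smooth
area-preserving diffeomorphisms commuting with `R_{α n}`. -/
structure IsScheme (p : ℕ → ℤ) (q : ℕ → ℕ) (g φ : ℕ → Equiv.Perm Torus) : Prop where
  q_pos : ∀ n ≥ 1, 0 < q n
  diffeo_g : ∀ n ≥ 1, IsAreaPreservingDiffeo (g n)
  diffeo_φ : ∀ n ≥ 1, IsAreaPreservingDiffeo (φ n)
  comm_g : ∀ n ≥ 1, g n * rot (alpha p q n) = rot (alpha p q n) * g n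
  comm_φ : ∀ n ≥ 1, φ n * rot (alpha p q n) = rot (alpha p q n) * φ n

/-- `a n = k n ^ 5`, the number of horizontal strips. -/
def stripCount (k : ℕ → ℕ) (n : ℕ) : ℕ := k n ^ 5

/-- `b n = [n q_n ^ σ]`, the amount of shear. -/
def shearAmount (q : ℕ → ℕ) (σ : ℝ) (n : ℕ) : ℕ := ⌊(n : ℝ) * (q n : ℝ) ^ σ⌋₊

/-- `ε n = 1 / (2 n⁵ k_n¹⁰)`, the relative margin of the strips. -/
def stripMargin (k : ℕ → ℕ) (n : ℕ) : ℝ := 1 / (2 * (n : ℝ) ^ 5 * (k n : ℝ) ^ 10)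

/-- The strip `𝕋 × [(j + 2ε)/a, (j + 1 - 2ε)/a]`. -/
def strip (a : ℕ) (ε : ℝ) (j : ℕ) : Set Torus :=
  {x | ∃ r ∈ Icc ((j + 2 * ε) / a : ℝ) ((j + 1 - 2 * ε) / a : ℝ), x.2 = (r : UnitAddCircle)}

/-- The good domain of the shear: the union of the strips. -/
def goodDomain (a : ℕ) (ε : ℝ) : Set Torus := ⋃ j ∈ Finset.range a, strip a ε j

/-- The map `g` commutes with `R_{1/q}` and translates each strip number `j` in the
`θ`-direction by `b j / a`. -/
structure IsStepShear (a b q : ℕ) (ε : ℝ) (g : Equiv.Perm Torus) : Prop where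
  comm : g * rot ((1 / q : ℝ) : UnitAddCircle) = rot ((1 / q : ℝ) : UnitAddCircle) * g
  translates : ∀ j < a, ∀ x ∈ strip a ε j, g x = (x.1 + ((b * j / a : ℝ) : UnitAddCircle), x.2)

/-- The conditions on the parameters `k n`, `q n` relative to the maps `H n`. -/
structure ParameterConditions (k q : ℕ → ℕ) (σ : ℝ) (H : ℕ → Equiv.Perm Torus) : Prop where
  k_large : ∀ n ≥ 1, n ^ 5 ≤ k n
  diam_image : ∀ n ≥ 1, ∀ S : Set ProjTM, ptDiam S < ENNReal.ofReal (3 / k n) →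
    ptDiam (projExt (H (n - 1)) '' S) ≤ ENNReal.ofReal (1 / (n : ℝ) ^ 2)
  k_growth : ∀ n ≥ 1, ∑' i : ℕ, 1 / (k (n + i) : ℝ) ^ 5 ≤ 1 / (4 * (k n : ℝ) ^ 4)
  q_large : ∀ n ≥ 1, 2 * (k n : ℝ) < (q n : ℝ) ^ (1 / 4 : ℝ)
  shear_step : ∀ n > 4,
    (shearAmount q σ n : ℝ) / (stripCount k n : ℝ) ≤ 1 / ((n : ℝ) * (k n : ℝ) ^ 2)

/-! ### Partial partitions -/

/-- The square with lower left corner `c` and side `s`, projected to the torus. -/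
def square (c : ℝ × ℝ) (s : ℝ) : Set Torus :=
  toTorus '' (Icc c.1 (c.1 + s) ×ˢ Icc c.2 (c.2 + s))

/-- A set `η` of tuples `I = (I 0, …, I (K-1))`, standing for the partial partition with
elements `⋃ l, I l`: all pieces of all elements are measurable, the pieces of one element are
disjoint, and so are different elements. -/
structure IsPartialDecomposition {K : ℕ} (η : Set (Fin K → Set Torus)) : Prop where
  measurable : ∀ I ∈ η, ∀ l, MeasurableSet (I l)
  disjoint_pieces : ∀ I ∈ η, ∀ l l', l ≠ l' → Disjoint (I l) (I l')
  disjoint_elements : ∀ I ∈ η, ∀ I' ∈ η, I ≠ I' → Disjoint (⋃ l, I l) (⋃ l, I' l)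

/-- The conditions on the partial decompositions `η n` of the torus. -/
structure DecompositionConditions (k q : ℕ → ℕ) (h : ℕ → Equiv.Perm Torus)
    (η : ∀ n, Set (Fin (k n) → Set Torus)) : Prop where
  partialDec : ∀ n ≥ 1, IsPartialDecomposition (η n)
  /-- `h n` acts on the elements by rotations and translations: its differential is a rotation. -/
  isometric : ∀ n ≥ 1, ∀ I ∈ η n, ∀ l, ∀ x ∈ I l,
    jacobian (h n) x ∈ Matrix.specialOrthogonalGroup (Fin 2) ℝ
  /-- Pieces are unions of small squares in the good domain. -/
  squares : ∀ n ≥ 1, ∀ I ∈ η n, ∀ l,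
    I l ⊆ goodDomain (stripCount k n) (stripMargin k n) ∧
    ∃ Q : Set ((ℝ × ℝ) × ℝ),
      (∀ z ∈ Q, 0 < z.2 ∧ z.2 < 1 / (2 * (k n : ℝ) ^ 5 * q n)) ∧
      I l = ⋃ z ∈ Q, square z.1 z.2
  /-- The pieces of an element have the same measure, bounded from below. -/
  same_measure : ∀ n ≥ 1, ∀ I ∈ η n, ∀ l l', volume.real (I l) = volume.real (I l')
  measure_ge : ∀ n ≥ 1, ∀ I ∈ η n, ∀ l,
    1 / (2 * (k n : ℝ) ^ 6 * q n) * (1 - 16 / (k n : ℝ) ^ 5) ≤ volume.real (I l)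
  /-- The elements cover almost all of the torus. -/
  cover : ∀ n ≥ 1, 1 - 25 / (k n : ℝ) ^ 5 ≤ volume.real (⋃ I ∈ η n, ⋃ l, I l)
  /-- Each piece is almost equal to the union of those images `h n (I' s)` that meet it. -/
  image_cover : ∀ n ≥ 1, ∀ I ∈ η n, ∀ l,
    volume.real (symmDiff (I l)
      (⋃ I' ∈ η n, ⋃ s, ⋃ _ : (h n '' I' s ∩ I l).Nonempty, h n '' I' s))
      ≤ 41 / (k n : ℝ) ^ 5 * volume.real (I l)
  /-- Each piece is almost equal to the union of those pieces of the next decomposition that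
  meet it. -/
  next_cover : ∀ n ≥ 1, ∀ I ∈ η n, ∀ l,
    volume.real (symmDiff (I l)
      (⋃ I' ∈ η (n + 1), ⋃ s, ⋃ _ : (I' s ∩ I l).Nonempty, I' s))
      ≤ 25 / (k (n + 1) : ℝ) ^ 5 * volume.real (I l)

/-- The arc `T_j = [j/K, (j+1)/K]` of lines. -/
def arc (K j : ℕ) : Set UnitAddCircle :=
  (fun x : ℝ => (x : UnitAddCircle)) '' Icc ((j : ℝ) / K) (((j : ℝ) + 1) / K)

/-- The sets `(⋃ l, I l) × T_j` in the projectivized tangent bundle. -/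
def etaHat {K : ℕ} (η : Set (Fin K → Set Torus)) : Set (Set ProjTM) :=
  {S | ∃ I ∈ η, ∃ j : Fin K, S = (⋃ l, I l) ×ˢ arc K j}

/-- The images of the sets of `etaHat η` under `(H, dH) ∘ (g, dg)`. -/
def nuHat {K : ℕ} (H g : Equiv.Perm Torus) (η : Set (Fin K → Set Torus)) : Set (Set ProjTM) :=
  {S | ∃ E ∈ etaHat η, S = projExt H '' (projExt g '' E)}

/-- Convergence of partial partitions to the decomposition into points. -/
def ConvergesToPoints {X : Type*} [MeasurableSpace X] (μ : Measure X) (ζ : ℕ → Set (Set X)) :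
    Prop :=
  ∀ A : Set X, MeasurableSet A → ∃ B : ℕ → Set X,
    (∀ n, MeasurableSet (B n) ∧ ∃ 𝒮 ⊆ ζ n, B n = ⋃₀ 𝒮) ∧
    Tendsto (fun n => μ (symmDiff A (B n))) atTop (𝓝 0)

/-- The map `(Φ, dΦ)` is `(γ, δ, ε₁, ε₂)`-distributing the set `(⋃ l, I l) × T_j`. -/
def Distributes {K : ℕ} (Φ : Equiv.Perm Torus) (I : Fin K → Set Torus) (j : Fin K)
    (γ δ ε₁ ε₂ : ℝ) : Prop :=
  ∃ J : Fin K → Set UnitAddCircle,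
    (∀ l, MeasurableSet (J l) ∧ J l ⊆ Prod.snd '' (Φ '' I l) ∧
      1 - δ ≤ volume.real (J l) ∧ volume.real (J l) ≤ 1) ∧
    (∀ l, ∃ c : UnitAddCircle,
      Φ '' I l ⊆ {x | ∃ s ∈ Icc (0 : ℝ) γ, x.1 = c + (s : UnitAddCircle)}) ∧
    (∀ l, ∀ J' ⊆ J l, MeasurableSet J' →
      |volume.real (I l ∩ Φ ⁻¹' (univ ×ˢ J')) / volume.real (I l)
          - volume.real J' / volume.real (J l)|
        ≤ ε₁ * (volume.real J' / volume.real (J l))) ∧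
    (∀ i : Fin K, ∃! l : Fin K, (l + j : ℕ) ≡ i [MOD K] ∧
      ∀ J' ⊆ J l, MeasurableSet J' →
        |volume.real (Prod.fst '' ((I l ×ˢ arc K j) ∩
              projExt Φ ⁻¹' ((univ ×ˢ J') ×ˢ arc K i))) / volume.real (I l)
            - volume.real J' / volume.real (J l)|
          ≤ ε₂ * (volume.real J' / volume.real (J l)))

/-! ### The measure on the projectivized tangent bundle -/

/-- The pulled back flat metric `((H)⁻¹)^* ω₀` at `p`, as a Gram matrix. -/
def pullbackMetric (H : Equiv.Perm Torus) (p : Torus) : Matrix (Fin 2) (Fin 2) ℝ :=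
  (jacobian (H⁻¹ : Equiv.Perm Torus) p).transpose * jacobian (H⁻¹ : Equiv.Perm Torus) p

/-- The limit metric `ω_∞ = lim (H n ⁻¹)^* ω₀`, pointwise. -/
def limitMetric (H : ℕ → Equiv.Perm Torus) (p : Torus) : Matrix (Fin 2) (Fin 2) ℝ :=
  limUnder atTop (fun n => pullbackMetric (H n) p)

/-- The density, with respect to `dt`, of the normalized arc length on the space of lines that
is induced by the inner product with Gram matrix `G`: the curve `v(φ) / |v(φ)|_G` with
`v(φ) = (cos φ, sin φ)` has `G`-speed `√(det G) / G(v, v)`, and its length for `φ ∈ [0, π]` is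
`π`. -/
def angleDensity (G : Matrix (Fin 2) (Fin 2) ℝ) (t : UnitAddCircle) : ℝ :=
  Real.sqrt G.det / (lineVec t ⬝ᵥ G.mulVec (lineVec t))

/-- The measure `μ̄` on the projectivized tangent bundle: the area `μ` on the base, and on each
fiber the normalized arc length with respect to the metric `G`. -/
def muBar (G : Torus → Matrix (Fin 2) (Fin 2) ℝ) : Measure ProjTM :=
  (volume : Measure ProjTM).withDensity fun x => ENNReal.ofReal (angleDensity (G x.1) x.2)

/-- Weak mixing: `T` preserves `μ`, and no nonconstant square-integrable function is an
eigenfunction of `T`. -/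
def IsWeaklyMixing {X : Type*} [MeasurableSpace X] (μ : Measure X) (T : X → X) : Prop :=
  MeasurePreserving T μ μ ∧
    ∀ (u : X → ℂ) (z : ℂ), MemLp u 2 μ → (∀ᵐ x ∂μ, u (T x) = z * u x) →
      ∃ c : ℂ, ∀ᵐ x ∂μ, u x = c

end AbC

end

open AbC

noncomputable section

namespace AbC

/-! ### The circle of lines -/

/-! The differential of `h n` is a rotation outside a set of measure `O(1 / n ^ 2)`, and composing
with a map with orthogonal differential does not change the pulled back metric. By Borel–Cantelli,
at almost every point the metrics pulled back by `(H n)⁻¹` are constant from some index on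
(`eventually_stable`). So the limit metric exists and is positive definite, and `muBar (limitMetric
H)` agrees, up to a small mass, with `muBar (pullbackMetric (H n))`, which is the image of Lebesgue
measure under `(H n, dH n)` (`map_projExt`, `norm_integral_limit_sub_le`). Since the conjugated
rotations preserve these images, their limit `f` preserves `muBar (limitMetric H)`
(`measurePreserving_limit`).

For weak mixing it suffices that `A ∘ (f, df) ^ m n` becomes asymptotically independent of every
measurable set, for continuous `A` (`isWeaklyMixing_of_tendsto`). Closeness of `f ^ m n` to the
power of `f n` is a `C¹` statement, while the action on lines could be very sensitive to `C¹`
errors. It is not on stable points, where the conjugated rotation is an isometry of a fixed metric,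
so its differential does not shrink vectors too much (`tendsto_integral_norm_projExt_sub`).

The power of `f n` equals `Ψ ∘ Φ n ∘ Ψ⁻¹` with `Ψ = H (n - 1) ∘ g n`, and sets are approximated by
`Ψ`-images of elements `(⋃ l, I l) × T_j`. On one such element, `Φ n` sends each piece to a nearly
vertical set, uniformly distributed in `r`, and turns `T_j` approximately into `T_(l + j)`. The
shear `g n` tilts the vertical set to a line of large slope, which fills the torus
(`norm_integral_slope_sub_le`). The arcs `T_(l + j)` run once through the whole fiber as `l` varies,
so the element becomes equidistributed (`norm_setIntegral_element_sub_le`). The test function seen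
there is `A ∘ (H (n - 1), dH (n - 1))`, which oscillates little at scale `3 / k n` by the diameter
condition. The estimates are collected in `norm_setIntegral_projExt_sub_le`. -/

instance : IsProbabilityMeasure (volume : Measure UnitAddCircle) :=
  ⟨UnitAddCircle.measure_univ⟩

instance : IsProbabilityMeasure (volume : Measure Torus) :=
  inferInstanceAs (IsProbabilityMeasure ((volume : Measure UnitAddCircle).prod volume))

instance : IsProbabilityMeasure (volume : Measure ProjTM) :=
  inferInstanceAs (IsProbabilityMeasure ((volume : Measure Torus).prod volume))

/-- A vector of the plane as a complex number. -/
def toC (w : Fin 2 → ℝ) : ℂ := ⟨w 0, w 1⟩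

lemma toC_eq_zero {w : Fin 2 → ℝ} : toC w = 0 ↔ w = 0 := by
  constructor
  · intro h
    have h0 := congrArg Complex.re h
    have h1 := congrArg Complex.im h
    funext i
    fin_cases i
    · exact h0
    · exact h1
  · rintro rfl; rfl

lemma continuous_toC : Continuous toC := by
  have : toC = fun w => Complex.equivRealProdCLM.symm (w 0, w 1) := by
    funext w; apply Complex.ext <;> simp [toC]
  rw [this]; fun_prop

lemma toC_smul (c : ℝ) (w : Fin 2 → ℝ) : toC (c • w) = c * toC w := by
  apply Complex.ext <;> simp [toC]

/-- The projective circle coordinate of a complex number. -/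
def argCoord (z : ℂ) : UnitAddCircle := ((Complex.arg z / Real.pi : ℝ) : UnitAddCircle)

lemma lineCoord_eq (w : Fin 2 → ℝ) : lineCoord w = argCoord (toC w) := rfl

/-- Squaring the unit vector identifies `z` with `-z`. Identities and continuity for line
coordinates are checked on this square, so the branch cut of `arg` never matters. -/
lemma toCircle_argCoord {z : ℂ} (hz : z ≠ 0) :
    ((AddCircle.toCircle (argCoord z) : Circle) : ℂ) = (z / ‖z‖) ^ 2 := by
  have hn : (‖z‖ : ℂ) ≠ 0 := by exact_mod_cast norm_ne_zero_iff.2 hz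
  have h := Complex.norm_mul_exp_arg_mul_I z
  have h2 : z / ‖z‖ = Complex.exp (z.arg * Complex.I) := by
    rw [div_eq_iff hn, mul_comm]; exact h.symm
  rw [h2, argCoord, AddCircle.toCircle_apply_mk, Circle.coe_exp, ← Complex.exp_nat_mul]
  congr 1
  have hpi : (Real.pi : ℂ) ≠ 0 := by exact_mod_cast Real.pi_ne_zero
  push_cast
  field_simp

lemma toCircle_inj {s t : UnitAddCircle}
    (h : ((AddCircle.toCircle s : Circle) : ℂ) = (AddCircle.toCircle t : Circle)) : s = t :=
  AddCircle.injective_toCircle one_ne_zero (Circle.ext h)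

lemma argCoord_mul {z w : ℂ} (hz : z ≠ 0) (hw : w ≠ 0) :
    argCoord (z * w) = argCoord z + argCoord w := by
  apply toCircle_inj
  rw [AddCircle.toCircle_add, Circle.coe_mul, toCircle_argCoord hz, toCircle_argCoord hw,
    toCircle_argCoord (mul_ne_zero hz hw), norm_mul]
  push_cast
  ring

lemma argCoord_real {c : ℝ} (hc : c ≠ 0) : argCoord (c : ℂ) = 0 := by
  apply toCircle_inj
  have hc' : (c : ℂ) ≠ 0 := by exact_mod_cast hc
  rw [toCircle_argCoord hc', div_pow, Complex.norm_real, ← Complex.ofReal_pow, ← Complex.ofReal_pow]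
  rw [Real.norm_eq_abs, sq_abs, div_self (by exact_mod_cast pow_ne_zero 2 hc)]
  simp

lemma lineCoord_smul {c : ℝ} (hc : c ≠ 0) (w : Fin 2 → ℝ) :
    lineCoord (c • w) = lineCoord w := by
  by_cases hw : w = 0
  · simp [hw]
  rw [lineCoord_eq, lineCoord_eq, toC_smul, argCoord_mul (by exact_mod_cast hc)
    (fun h => hw (toC_eq_zero.1 h)), argCoord_real hc, zero_add]

lemma toC_lineVec (t : UnitAddCircle) :
    toC (lineVec t) = Complex.exp ((Real.pi * (AddCircle.equivIco 1 0 t : ℝ) : ℝ) * Complex.I) := by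
  rw [Complex.exp_mul_I, ← Complex.ofReal_cos, ← Complex.ofReal_sin]
  apply Complex.ext <;> simp [toC, lineVec, -Complex.ofReal_cos, -Complex.ofReal_sin]

lemma norm_toC_lineVec (t : UnitAddCircle) : ‖toC (lineVec t)‖ = 1 := by
  rw [toC_lineVec, Complex.norm_exp_ofReal_mul_I]

lemma toC_lineVec_ne (t : UnitAddCircle) : toC (lineVec t) ≠ 0 := by
  intro h
  have := norm_toC_lineVec t
  rw [h] at this; simp at this

lemma lineVec_ne (t : UnitAddCircle) : lineVec t ≠ 0 :=
  fun h => toC_lineVec_ne t (toC_eq_zero.2 h)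

lemma lineVec_dot (t : UnitAddCircle) : lineVec t ⬝ᵥ lineVec t = 1 := by
  simp only [lineVec, dotProduct, Fin.sum_univ_two, Matrix.cons_val_zero, Matrix.cons_val_one]
  rw [← sq, ← sq, Real.cos_sq_add_sin_sq]

lemma lineCoord_lineVec (t : UnitAddCircle) : lineCoord (lineVec t) = t := by
  apply toCircle_inj
  rw [lineCoord_eq, toCircle_argCoord (toC_lineVec_ne t), norm_toC_lineVec]
  rw [toC_lineVec, Complex.ofReal_one, div_one, ← Complex.exp_nat_mul]
  conv_rhs => rw [← AddCircle.coe_equivIco (p := (1 : ℝ)) (a := 0) (y := t)]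
  rw [AddCircle.toCircle_apply_mk, Circle.coe_exp]
  congr 1
  push_cast
  ring

/-- Equal coordinates mean equal squares of unit vectors, so the two vectors agree up to a sign;
hence `c ≠ 0` and not `0 < c`. -/
lemma exists_smul_lineVec_lineCoord {w : Fin 2 → ℝ} (hw : w ≠ 0) :
    ∃ c : ℝ, c ≠ 0 ∧ lineVec (lineCoord w) = c • w := by
  set v := lineVec (lineCoord w) with hv
  have hw' : toC w ≠ 0 := fun h => hw (toC_eq_zero.1 h)
  have h1 : lineCoord v = lineCoord w := lineCoord_lineVec _
  have h2 := toCircle_argCoord hw'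
  have h3 := toCircle_argCoord (toC_lineVec_ne (lineCoord w))
  rw [← hv] at h3
  rw [lineCoord_eq, lineCoord_eq] at h1
  have hnv : ‖toC v‖ = 1 := norm_toC_lineVec _
  rw [h1, h2, hnv, Complex.ofReal_one, div_one] at h3
  have hn : ‖toC w‖ ≠ 0 := norm_ne_zero_iff.2 hw'
  have key : ∀ c : ℝ, toC v = c * toC w → v = c • w := by
    intro c h
    rw [← toC_smul] at h
    have h0 := congrArg Complex.re h
    have h1 := congrArg Complex.im h
    funext i
    fin_cases i
    · exact h0
    · exact h1
  rcases sq_eq_sq_iff_eq_or_eq_neg.1 h3 with h | h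
  · refine ⟨‖toC w‖⁻¹, inv_ne_zero hn, key _ ?_⟩
    rw [← h, Complex.ofReal_inv]; ring
  · refine ⟨-‖toC w‖⁻¹, neg_ne_zero.2 (inv_ne_zero hn), key _ ?_⟩
    have : toC v = -(toC w / ‖toC w‖) := by rw [h, neg_neg]
    rw [this, Complex.ofReal_neg, Complex.ofReal_inv]; ring

lemma projAct_lineCoord (A : Matrix (Fin 2) (Fin 2) ℝ) {w : Fin 2 → ℝ} (hw : w ≠ 0) :
    projAct A (lineCoord w) = lineCoord (A.mulVec w) := by
  obtain ⟨c, hc, h⟩ := exists_smul_lineVec_lineCoord hw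
  rw [projAct, h, Matrix.mulVec_smul, lineCoord_smul hc]

lemma mulVec_ne_zero {B : Matrix (Fin 2) (Fin 2) ℝ} (hB : B.det ≠ 0) {v : Fin 2 → ℝ} (hv : v ≠ 0) :
    B.mulVec v ≠ 0 := fun h => hv (Matrix.eq_zero_of_mulVec_eq_zero hB h)

lemma projAct_mul (A : Matrix (Fin 2) (Fin 2) ℝ) {B : Matrix (Fin 2) (Fin 2) ℝ} (hB : B.det ≠ 0)
    (t : UnitAddCircle) : projAct (A * B) t = projAct A (projAct B t) := by
  rw [projAct, ← Matrix.mulVec_mulVec, ← projAct_lineCoord A (mulVec_ne_zero hB (lineVec_ne t))]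
  rfl

lemma projAct_one (t : UnitAddCircle) : projAct 1 t = t := by
  rw [projAct, Matrix.one_mulVec, lineCoord_lineVec]

/-- A rotation is multiplication by the complex number in its first column, and arguments add. On
fibers such differentials are therefore translations. -/
lemma projAct_rotation {A : Matrix (Fin 2) (Fin 2) ℝ}
    (hA : A ∈ Matrix.specialOrthogonalGroup (Fin 2) ℝ) (t : UnitAddCircle) :
    projAct A t = t + lineCoord (A.col 0) := by
  rw [Matrix.mem_specialOrthogonalGroup_iff, Matrix.mem_orthogonalGroup_iff'] at hA
  obtain ⟨hA, hdet⟩ := hA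
  have e00 := congrFun (congrFun hA 0) 0
  have e01 := congrFun (congrFun hA 0) 1
  have e11 := congrFun (congrFun hA 1) 1
  simp [Matrix.mul_apply, Fin.sum_univ_two] at e00 e01 e11
  rw [Matrix.det_fin_two] at hdet
  have h1 : A 1 1 = A 0 0 := by
    linear_combination -A 1 1 * e00 + A 1 0 * e01 + A 0 0 * hdet
  have h2 : A 0 1 = - A 1 0 := by
    linear_combination -A 0 1 * e00 + A 0 0 * e01 - A 1 0 * hdet
  have hmul : toC (A.mulVec (lineVec t)) = toC (A.col 0) * toC (lineVec t) := by
    apply Complex.ext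
    · simp [toC, Matrix.mulVec, dotProduct, Fin.sum_univ_two, h2, Matrix.col]; ring
    · simp [toC, Matrix.mulVec, dotProduct, Fin.sum_univ_two, h1, Matrix.col]; ring
  have hc : toC (A.col 0) ≠ 0 := by
    rw [Ne, toC_eq_zero]
    intro h
    have a := congrFun h 0
    have b := congrFun h 1
    simp [Matrix.col] at a b
    rw [a, b] at e00; simp at e00
  rw [projAct, lineCoord_eq, hmul, argCoord_mul hc (toC_lineVec_ne t), ← lineCoord_eq,
    ← lineCoord_eq, lineCoord_lineVec, add_comm]

/-- `arg` jumps by `2π` at its cut, which is invisible modulo one after division by `π`; the squared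
unit vector is continuous. -/
lemma continuousAt_lineCoord {w : Fin 2 → ℝ} (hw : w ≠ 0) : ContinuousAt lineCoord w := by
  have hind : @Topology.IsInducing Circle ℂ _ _ (fun z => (z : ℂ)) := ⟨rfl⟩
  rw [(AddCircle.homeomorphCircle (T := (1 : ℝ)) one_ne_zero).isInducing.continuousAt_iff,
    hind.continuousAt_iff]
  have hev : (fun w => (toC w / ‖toC w‖) ^ 2) =ᶠ[𝓝 w]
      ((fun z : Circle => (z : ℂ)) ∘ (AddCircle.homeomorphCircle (T := (1 : ℝ)) one_ne_zero) ∘ lineCoord :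
        (Fin 2 → ℝ) → ℂ) := by
    filter_upwards [isOpen_ne.mem_nhds hw] with x hx
    simp only [Function.comp, AddCircle.homeomorphCircle_apply]
    rw [lineCoord_eq]
    exact (toCircle_argCoord fun h => hx (toC_eq_zero.1 h)).symm
  refine ContinuousAt.congr ?_ hev
  have hc := continuous_toC.continuousAt (x := w)
  have hn : ((‖toC w‖ : ℝ) : ℂ) ≠ 0 := by
    exact_mod_cast norm_ne_zero_iff.2 fun h => hw (toC_eq_zero.1 h)
  exact (hc.div (Complex.continuous_ofReal.continuousAt.comp hc.norm) hn).pow 2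

lemma measurable_lineCoord : Measurable lineCoord := by
  have h : Measurable fun w : Fin 2 → ℝ => Complex.arg (toC w) / Real.pi :=
    (Complex.measurable_arg.comp continuous_toC.measurable).div_const _
  exact (AddCircle.measurable_mk' (a := (1 : ℝ))).comp h

lemma measurable_lineVec : Measurable lineVec := by
  have h : Measurable fun t : UnitAddCircle => ((AddCircle.equivIco 1 0 t : Ico (0 : ℝ) (0 + 1)) : ℝ) :=
    measurable_subtype_coe.comp (AddCircle.measurableEquivIco (1 : ℝ) 0).measurable
  refine measurable_pi_iff.2 fun i => ?_
  fin_cases i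
  · exact Real.measurable_cos.comp (h.const_mul _)
  · exact Real.measurable_sin.comp (h.const_mul _)

lemma measurable_projAct (A : Matrix (Fin 2) (Fin 2) ℝ) : Measurable (projAct A) := by
  refine measurable_lineCoord.comp ?_
  exact (Continuous.measurable (by fun_prop : Continuous fun v : Fin 2 → ℝ => A.mulVec v)).comp
    measurable_lineVec

/-! ### Change of variables on the circle of lines -/

/-- The angle runs over all directions, so `θ / π` winds twice around the circle of lines. -/
lemma lintegral_angle (f : UnitAddCircle → ℝ≥0∞) (hf : Measurable f) :
    ∫⁻ θ in Ioo (-Real.pi) Real.pi, f ((θ / Real.pi : ℝ) : UnitAddCircle)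
      = ENNReal.ofReal (2 * Real.pi) * ∫⁻ t, f t := by
  have hpi := Real.pi_pos
  rw [setLIntegral_congr Ioo_ae_eq_Ioc]
  have hm : Measurable fun x : ℝ => f ((x : ℝ) : UnitAddCircle) :=
    hf.comp (AddCircle.measurable_mk' (a := (1 : ℝ)))
  have key : ∫⁻ s in Ioc (-1 : ℝ) 1, f (s : UnitAddCircle) = 2 * ∫⁻ t, f t := by
    rw [← Ioc_union_Ioc_eq_Ioc (by norm_num : (-1 : ℝ) ≤ 0) (by norm_num : (0 : ℝ) ≤ 1),
      lintegral_union measurableSet_Ioc (by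
        rw [Set.disjoint_left]; intro x hx hx'; exact absurd hx.2 (not_le.2 hx'.1))]
    have h1 := UnitAddCircle.lintegral_preimage (-1) f
    have h2 := UnitAddCircle.lintegral_preimage 0 f
    norm_num at h1 h2
    rw [h1, h2, two_mul]
  rw [mul_comm (2 : ℝ), ENNReal.ofReal_mul hpi.le, mul_assoc,
    show ENNReal.ofReal 2 = 2 by norm_num, ← key]
  have hmap := Real.smul_map_volume_mul_left hpi.ne'
  rw [abs_of_pos hpi] at hmap
  conv_lhs => rw [← hmap]
  rw [Measure.restrict_smul, lintegral_smul_measure, smul_eq_mul,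
    setLIntegral_map (f := fun a : ℝ => f ((a / Real.pi : ℝ) : UnitAddCircle)) measurableSet_Ioc ((AddCircle.measurable_mk' (a := (1 : ℝ))).comp (measurable_id.div_const _) |> hf.comp)
      (measurable_const_mul _)]
  congr 1
  have hset : (fun x : ℝ => Real.pi * x) ⁻¹' Ioc (-Real.pi) Real.pi = Ioc (-1) 1 := by
    ext x
    simp only [mem_preimage, mem_Ioc]
    constructor
    · rintro ⟨a, b⟩; constructor <;> nlinarith
    · rintro ⟨a, b⟩; constructor <;> nlinarith
  rw [hset]
  refine lintegral_congr fun x => ?_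
  rw [mul_div_cancel_left₀ _ hpi.ne']

lemma lintegral_radius {c : ℝ} (hc : 0 < c) :
    ∫⁻ r in Ioi (0 : ℝ), ENNReal.ofReal r * (if r ^ 2 * c < 1 then 1 else 0)
      = ENNReal.ofReal (1 / (2 * c)) := by
  set b := 1 / Real.sqrt c with hb
  have hsc : 0 < Real.sqrt c := Real.sqrt_pos.2 hc
  have hb0 : 0 < b := by positivity
  have hb2 : b ^ 2 = 1 / c := by rw [hb, div_pow, one_pow, Real.sq_sqrt hc.le]
  have hiff : ∀ r : ℝ, 0 < r → (r ^ 2 * c < 1 ↔ r < b) := by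
    intro r hr
    rw [← lt_div_iff₀ hc, ← hb2]
    exact pow_lt_pow_iff_left₀ hr.le hb0.le two_ne_zero
  have h1 : ∫⁻ r in Ioi (0 : ℝ), ENNReal.ofReal r * (if r ^ 2 * c < 1 then 1 else 0)
      = ∫⁻ r in Ioi (0 : ℝ), (Iio b).indicator (fun r => ENNReal.ofReal r) r := by
    refine setLIntegral_congr_fun measurableSet_Ioi fun r hr => ?_
    simp only [hiff r hr, indicator, mem_Iio]
    split_ifs <;> simp
  rw [h1, lintegral_indicator measurableSet_Iio, Measure.restrict_restrict measurableSet_Iio,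
    inter_comm, Ioi_inter_Iio, setLIntegral_congr Ioo_ae_eq_Ioc,
    ← ofReal_integral_eq_lintegral_ofReal]
  · rw [← intervalIntegral.integral_of_le hb0.le, integral_id, hb2]
    congr 1; field_simp; ring
  · exact (intervalIntegrable_iff_integrableOn_Ioc_of_le hb0.le).1
      (continuous_id.intervalIntegrable _ _)
  · filter_upwards [ae_restrict_mem measurableSet_Ioc] with r hr using hr.1.le

/-- Polar coordinates: the radius in direction `v` ends at `G(v, v) ^ (-1/2)`, which contributes `1
/ (2 G(v, v))`. Arc length on lines thus appears as sector area of an ellipse, and the action of a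
matrix on lines can be handled by the linear change of variables in the plane. -/
lemma lintegral_ellipse (G : Matrix (Fin 2) (Fin 2) ℝ)
    (hG : ∀ v : Fin 2 → ℝ, v ≠ 0 → 0 < v ⬝ᵥ G.mulVec v) (f : UnitAddCircle → ℝ≥0∞)
    (hf : Measurable f) :
    ∫⁻ w : Fin 2 → ℝ, (if w ⬝ᵥ G.mulVec w < 1 then f (lineCoord w) else 0)
      = ENNReal.ofReal Real.pi *
        ∫⁻ t, f t * ENNReal.ofReal (1 / (lineVec t ⬝ᵥ G.mulVec (lineVec t))) := by
  have hmp := (volume_preserving_finTwoArrow ℝ).symm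
  have hq : Continuous fun w : Fin 2 → ℝ => w ⬝ᵥ G.mulVec w := by
    simp only [dotProduct, Matrix.mulVec, Fin.sum_univ_two]; fun_prop
  have hqm := (hq.measurable.comp measurable_lineVec)
  have hmeas : Measurable fun w : Fin 2 → ℝ =>
      (if w ⬝ᵥ G.mulVec w < 1 then f (lineCoord w) else 0) :=
    Measurable.ite (measurableSet_lt hq.measurable measurable_const)
      (hf.comp measurable_lineCoord) measurable_const
  rw [← hmp.lintegral_comp hmeas, ← lintegral_comp_polarCoord_symm]
  have hF : Measurable fun t : UnitAddCircle =>
      f t * ENNReal.ofReal (1 / (2 * (lineVec t ⬝ᵥ G.mulVec (lineVec t)))) :=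
    hf.mul (ENNReal.measurable_ofReal.comp ((hqm.const_mul 2).const_div 1))
  have hpt : ∀ p ∈ polarCoord.target,
      ENNReal.ofReal p.1 • (if (MeasurableEquiv.finTwoArrow (α := ℝ)).symm (polarCoord.symm p) ⬝ᵥ
          G.mulVec ((MeasurableEquiv.finTwoArrow (α := ℝ)).symm (polarCoord.symm p)) < 1
        then f (lineCoord ((MeasurableEquiv.finTwoArrow (α := ℝ)).symm (polarCoord.symm p))) else 0)
      = f ((p.2 / Real.pi : ℝ) : UnitAddCircle) * (ENNReal.ofReal p.1 * (if p.1 ^ 2 *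
        (lineVec ((p.2 / Real.pi : ℝ) : UnitAddCircle) ⬝ᵥ
          G.mulVec (lineVec ((p.2 / Real.pi : ℝ) : UnitAddCircle))) < 1 then 1 else 0)) := by
    rintro ⟨r, θ⟩ ⟨hr, hθ⟩
    simp only [mem_Ioi] at hr
    have hw : (MeasurableEquiv.finTwoArrow (α := ℝ)).symm (polarCoord.symm (r, θ))
        = r • ![Real.cos θ, Real.sin θ] := by
      rw [polarCoord_symm_apply]
      funext i; fin_cases i <;> rfl
    rw [hw]
    set e : Fin 2 → ℝ := ![Real.cos θ, Real.sin θ] with he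
    have hce : toC e = Complex.cos θ + Complex.sin θ * Complex.I := by
      apply Complex.ext <;> simp [toC, he, ← Complex.ofReal_cos, ← Complex.ofReal_sin]
    have hee : e ⬝ᵥ e = 1 := by
      simp only [he, dotProduct, Fin.sum_univ_two, Matrix.cons_val_zero, Matrix.cons_val_one]
      rw [← sq, ← sq, Real.cos_sq_add_sin_sq]
    have he0 : e ≠ 0 := by
      intro h; rw [h] at hee; simp at hee
    have hlc : lineCoord e = ((θ / Real.pi : ℝ) : UnitAddCircle) := by
      rw [lineCoord_eq, argCoord, hce, Complex.arg_cos_add_sin_mul_I ⟨hθ.1, hθ.2.le⟩]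
    have hlr : lineCoord (r • e) = ((θ / Real.pi : ℝ) : UnitAddCircle) := by
      rw [lineCoord_smul (ne_of_gt hr), hlc]
    -- The chosen unit vector of the line may be the opposite of `(cos θ, sin θ)`; the quadratic
    -- form does not see the sign.
    obtain ⟨c, hc, hcv⟩ := exists_smul_lineVec_lineCoord he0
    have hc2 : c ^ 2 = 1 := by
      have := lineVec_dot (lineCoord e)
      rw [hcv, smul_dotProduct, dotProduct_smul, hee] at this
      simpa [sq] using this
    rw [hlc] at hcv
    have hquad : ∀ (a : ℝ) (v : Fin 2 → ℝ),
        (a • v) ⬝ᵥ G.mulVec (a • v) = a ^ 2 * (v ⬝ᵥ G.mulVec v) := by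
      intro a v
      rw [Matrix.mulVec_smul, smul_dotProduct, dotProduct_smul, smul_eq_mul, smul_eq_mul]; ring
    rw [hlr, hcv, hquad, hquad, hc2, one_mul]
    by_cases h : r ^ 2 * (e ⬝ᵥ G.mulVec e) < 1
    · simp only [h, if_true, smul_eq_mul, mul_one]; rw [mul_comm]
    · simp only [h, if_false, smul_zero, mul_zero]
  rw [setLIntegral_congr_fun polarCoord.open_target.measurableSet hpt, polarCoord_target]
  change ∫⁻ z in Ioi (0 : ℝ) ×ˢ Ioo (-Real.pi) Real.pi, _ ∂((volume : Measure ℝ).prod volume) = _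
  have hmk : Measurable fun p : ℝ × ℝ => ((p.2 / Real.pi : ℝ) : UnitAddCircle) :=
    (AddCircle.measurable_mk' (a := (1 : ℝ))).comp (measurable_snd.div_const _)
  rw [← Measure.prod_restrict, lintegral_prod_symm]
  · have hin : ∀ θ : ℝ, ∫⁻ r in Ioi (0 : ℝ), f ((θ / Real.pi : ℝ) : UnitAddCircle) *
        (ENNReal.ofReal r * (if r ^ 2 *
        (lineVec ((θ / Real.pi : ℝ) : UnitAddCircle) ⬝ᵥ
          G.mulVec (lineVec ((θ / Real.pi : ℝ) : UnitAddCircle))) < 1 then 1 else 0))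
        = (fun t => f t * ENNReal.ofReal (1 / (2 * (lineVec t ⬝ᵥ G.mulVec (lineVec t)))))
          ((θ / Real.pi : ℝ) : UnitAddCircle) := by
      intro θ
      rw [lintegral_const_mul]
      · simp only
        rw [lintegral_radius (hG _ (lineVec_ne _))]
      · refine ENNReal.measurable_ofReal.mul (Measurable.ite ?_ measurable_const measurable_const)
        exact measurableSet_lt ((measurable_id.pow_const 2).mul_const _) measurable_const
    simp only [hin]
    rw [lintegral_angle _ hF, mul_comm (2 : ℝ), ENNReal.ofReal_mul Real.pi_pos.le, mul_assoc,
      ← lintegral_const_mul _ hF]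
    congr 1
    refine lintegral_congr fun t => ?_
    rw [mul_left_comm, ← ENNReal.ofReal_mul (by norm_num)]
    congr 2
    have := hG _ (lineVec_ne t)
    field_simp
  · refine Measurable.aemeasurable ?_
    refine (hf.comp hmk).mul ((ENNReal.measurable_ofReal.comp measurable_fst).mul
      (Measurable.ite ?_ measurable_const measurable_const))
    exact measurableSet_lt ((measurable_fst.pow_const 2).mul (hqm.comp hmk)) measurable_const

lemma gram_dot (J : Matrix (Fin 2) (Fin 2) ℝ) (v : Fin 2 → ℝ) :
    v ⬝ᵥ (J.transpose * J).mulVec v = J.mulVec v ⬝ᵥ J.mulVec v := by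
  rw [← Matrix.mulVec_mulVec, Matrix.dotProduct_mulVec, Matrix.vecMul_transpose]

lemma dot_self_pos {v : Fin 2 → ℝ} (hv : v ≠ 0) : 0 < v ⬝ᵥ v := by
  have h0 : 0 ≤ v ⬝ᵥ v := by
    simp only [dotProduct, Fin.sum_univ_two]; nlinarith [mul_self_nonneg (v 0), mul_self_nonneg (v 1)]
  exact lt_of_le_of_ne h0 fun h => hv (dotProduct_self_eq_zero.1 h.symm)

lemma gram_dot_pos {J : Matrix (Fin 2) (Fin 2) ℝ} (hJ : J.det ≠ 0) {v : Fin 2 → ℝ} (hv : v ≠ 0) :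
    0 < v ⬝ᵥ (J.transpose * J).mulVec v := by
  rw [gram_dot]; exact dot_self_pos (mulVec_ne_zero hJ hv)

/-- The projective action of `J⁻¹` carries Lebesgue measure to the normalized arc length of the
inner product with Gram matrix `Jᵀ J`. -/
lemma lintegral_projAct_inv {J : Matrix (Fin 2) (Fin 2) ℝ} (hJ : J.det ≠ 0)
    (f : UnitAddCircle → ℝ≥0∞) (hf : Measurable f) :
    ∫⁻ t, f (projAct J⁻¹ t) = ∫⁻ t, f t * ENNReal.ofReal (angleDensity (J.transpose * J) t) := by
  -- `J` maps the ellipse of `Jᵀ J` onto the unit disc and multiplies area by `|det J|`. Integrating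
  -- over the disc directly and after the substitution `w ↦ J w` gives the density.
  have hJu : IsUnit J.det := isUnit_iff_ne_zero.2 hJ
  have h1 := lintegral_ellipse 1 (fun v hv => by simpa using dot_self_pos hv)
    (fun t => f (projAct J⁻¹ t)) (hf.comp (measurable_projAct _))
  have h2 := lintegral_ellipse (J.transpose * J) (fun v hv => gram_dot_pos hJ hv) f hf
  simp only [Matrix.one_mulVec, lineVec_dot, div_one, ENNReal.ofReal_one, mul_one] at h1
  have hlin : Measurable (Matrix.toLin' J) :=
    (LinearMap.continuous_on_pi (Matrix.toLin' J)).measurable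
  have hvol : (volume : Measure (Fin 2 → ℝ))
      = ENNReal.ofReal |J.det| • Measure.map (Matrix.toLin' J) volume := by
    rw [Real.map_matrix_volume_pi_eq_smul_volume_pi hJ, smul_smul,
      ← ENNReal.ofReal_mul (abs_nonneg _), ← abs_mul, mul_inv_cancel₀ hJ]
    simp
  have hd : Continuous fun w : Fin 2 → ℝ => w ⬝ᵥ w := by
    simp only [dotProduct, Fin.sum_univ_two]; fun_prop
  rw [hvol, lintegral_smul_measure, lintegral_map
    (f := fun w => if w ⬝ᵥ w < 1 then f (projAct J⁻¹ (lineCoord w)) else 0) (Measurable.ite (measurableSet_lt hd.measurable measurable_const)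
      ((hf.comp (measurable_projAct _)).comp measurable_lineCoord) measurable_const) hlin] at h1
  have h3 : ∀ᵐ w : Fin 2 → ℝ, (if Matrix.toLin' J w ⬝ᵥ Matrix.toLin' J w < 1 then
        f (projAct J⁻¹ (lineCoord (Matrix.toLin' J w))) else 0)
      = if w ⬝ᵥ (J.transpose * J).mulVec w < 1 then f (lineCoord w) else 0 := by
    have h0 : ∀ᵐ w : Fin 2 → ℝ, w ≠ 0 := by
      simp [ae_iff]
    filter_upwards [h0] with w hw
    rw [gram_dot, Matrix.toLin'_apply, projAct_lineCoord _ (mulVec_ne_zero hJ hw),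
      Matrix.mulVec_mulVec, Matrix.nonsing_inv_mul _ hJu, Matrix.one_mulVec]
  rw [lintegral_congr_ae h3, h2, smul_eq_mul, mul_left_comm] at h1
  have hpi0 : ENNReal.ofReal Real.pi ≠ 0 := by simp [Real.pi_pos]
  have h4 := (ENNReal.mul_right_inj hpi0 ENNReal.ofReal_ne_top).1 h1
  have hqm : Measurable fun t : UnitAddCircle =>
      1 / (lineVec t ⬝ᵥ (J.transpose * J).mulVec (lineVec t)) := by
    refine Measurable.const_div ?_ 1
    have hq : Continuous fun w : Fin 2 → ℝ => w ⬝ᵥ (J.transpose * J).mulVec w := by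
      simp only [dotProduct, Matrix.mulVec, Fin.sum_univ_two]; fun_prop
    exact hq.measurable.comp measurable_lineVec
  have hprod : Measurable fun t => f t *
      ENNReal.ofReal (1 / (lineVec t ⬝ᵥ (J.transpose * J).mulVec (lineVec t))) :=
    hf.mul hqm.ennreal_ofReal
  rw [← h4, ← lintegral_const_mul _ hprod]
  refine lintegral_congr fun t => ?_
  rw [mul_left_comm, ← ENNReal.ofReal_mul (abs_nonneg _)]
  congr 2
  rw [angleDensity, Matrix.det_mul, Matrix.det_transpose, Real.sqrt_mul_self_eq_abs, mul_one_div]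

/-! ### Smooth maps of the torus and their Jacobians -/

lemma toTorus_add (x y : ℝ × ℝ) : toTorus (x + y) = toTorus x + toTorus y := rfl

lemma toTorus_sub (x y : ℝ × ℝ) : toTorus (x - y) = toTorus x - toTorus y := rfl

lemma isOpenQuotientMap_toTorus : IsOpenQuotientMap toTorus := by
  have h : IsOpenQuotientMap ((↑) : ℝ → UnitAddCircle) := QuotientAddGroup.isOpenQuotientMap_mk
  exact h.prodMap h

lemma continuous_toTorus : Continuous toTorus := isOpenQuotientMap_toTorus.continuous

lemma surjective_toTorus : Function.Surjective toTorus := isOpenQuotientMap_toTorus.surjective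

lemma smallRep_coe {a : ℝ} (ha : a ∈ Ico (-1 / 2 : ℝ) (1 / 2)) :
    smallRep (a : UnitAddCircle) = a := by
  have h : a ∈ Ico (-1 / 2 : ℝ) (-1 / 2 + 1) := ⟨ha.1, by linarith [ha.2]⟩
  have := (AddCircle.equivIco_coe_eq (p := (1 : ℝ)) h)
  rw [smallRep, this]

/-- For small `v` the increment of the lift lies in the box where `smallRep` inverts the covering,
so the chart expression is the increment itself. -/
lemma localMap_eventuallyEq {h : Torus → Torus} {F : ℝ × ℝ → ℝ × ℝ}
    (hF : ∀ x, h (toTorus x) = toTorus (F x)) {x : ℝ × ℝ} (hc : ContinuousAt F x) :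
    localMap h (toTorus x) =ᶠ[𝓝 0] fun v => F (x + v) - F x := by
  have hc' : Tendsto (fun v => F (x + v) - F x) (𝓝 0) (𝓝 0) := by
    have h1 : Tendsto (fun v : ℝ × ℝ => x + v) (𝓝 0) (𝓝 x) := by
      have : Continuous fun v : ℝ × ℝ => x + v := by fun_prop
      simpa using this.tendsto 0
    simpa using (hc.tendsto.comp h1).sub_const (F x)
  have hU : Ico (-1 / 2 : ℝ) (1 / 2) ×ˢ Ico (-1 / 2 : ℝ) (1 / 2) ∈ 𝓝 (0 : ℝ × ℝ) :=
    prod_mem_nhds (Ico_mem_nhds (by norm_num) (by norm_num))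
      (Ico_mem_nhds (by norm_num) (by norm_num))
  filter_upwards [hc' hU] with v hv
  rw [localMap, ← toTorus_add, hF, hF, ← toTorus_sub]
  exact Prod.ext (smallRep_coe hv.1) (smallRep_coe hv.2)

/-- The matrix of a linear map of the plane. -/
def matOf (L : ℝ × ℝ →L[ℝ] ℝ × ℝ) : Matrix (Fin 2) (Fin 2) ℝ :=
  !![(L (1, 0)).1, (L (0, 1)).1; (L (1, 0)).2, (L (0, 1)).2]

lemma matOf_comp (L M : ℝ × ℝ →L[ℝ] ℝ × ℝ) : matOf (L.comp M) = matOf L * matOf M := by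
  have key : ∀ v : ℝ × ℝ, L v = v.1 • L (1, 0) + v.2 • L (0, 1) := by
    intro v
    rw [← map_smul, ← map_smul, ← map_add]
    congr 1
    ext <;> simp
  ext i j
  fin_cases i <;> fin_cases j <;>
    simp only [matOf, ContinuousLinearMap.comp_apply, key (M _)] <;>
    simp [Matrix.mul_apply, Fin.sum_univ_two, mul_comm]

lemma matOf_id : matOf (ContinuousLinearMap.id ℝ (ℝ × ℝ)) = 1 := by
  ext i j
  fin_cases i <;> fin_cases j <;> simp [matOf]

lemma continuous_matOf : Continuous matOf := by
  unfold matOf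
  refine continuous_matrix fun i j => ?_
  fin_cases i <;> fin_cases j <;> simp <;> fun_prop

lemma jacobian_eq_matOf {h : Torus → Torus} {F : ℝ × ℝ → ℝ × ℝ}
    (hF : ∀ x, h (toTorus x) = toTorus (F x)) {x : ℝ × ℝ} {L : ℝ × ℝ →L[ℝ] ℝ × ℝ}
    (hL : HasFDerivAt F L x) : jacobian h (toTorus x) = matOf L := by
  have h1 : HasFDerivAt (fun v => F (x + v) - F x) L 0 := by
    have h2 : HasFDerivAt F L (x + 0) := by simpa using hL
    have h3 : HasFDerivAt (fun v : ℝ × ℝ => x + v) (ContinuousLinearMap.id ℝ (ℝ × ℝ)) 0 :=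
      (hasFDerivAt_id _).const_add x
    exact (h2.comp 0 h3).sub_const _
  have h2 := (h1.congr_of_eventuallyEq (localMap_eventuallyEq hF hL.continuousAt)).fderiv
  rw [jacobian, h2, matOf]

lemma IsSmoothMap.continuous {h : Torus → Torus} (hh : IsSmoothMap h) : Continuous h := by
  obtain ⟨F, hF, hl⟩ := hh
  refine isOpenQuotientMap_toTorus.isQuotientMap.continuous_iff.2 ?_
  have : h ∘ toTorus = toTorus ∘ F := funext hl
  rw [this]
  exact continuous_toTorus.comp hF.continuous

lemma IsSmoothMap.continuous_jacobian {h : Torus → Torus} (hh : IsSmoothMap h) :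
    Continuous (jacobian h) := by
  obtain ⟨F, hF, hl⟩ := hh
  refine isOpenQuotientMap_toTorus.isQuotientMap.continuous_iff.2 ?_
  have : jacobian h ∘ toTorus = fun x => matOf (fderiv ℝ F x) := funext fun x =>
    jacobian_eq_matOf hl (hF.differentiable (by simp) x).hasFDerivAt
  rw [this]
  exact continuous_matOf.comp (hF.continuous_fderiv (by simp))

lemma IsSmoothMap.comp {h h' : Torus → Torus} (hh : IsSmoothMap h) (hh' : IsSmoothMap h') :
    IsSmoothMap (h ∘ h') := by
  obtain ⟨F, hF, hl⟩ := hh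
  obtain ⟨F', hF', hl'⟩ := hh'
  exact ⟨F ∘ F', hF.comp hF', fun x => by simp [hl, hl']⟩

lemma isSmoothMap_id : IsSmoothMap id := ⟨id, contDiff_id, fun _ => rfl⟩

lemma jacobian_comp {h h' : Torus → Torus} (hh : IsSmoothMap h) (hh' : IsSmoothMap h')
    (p : Torus) : jacobian (h ∘ h') p = jacobian h (h' p) * jacobian h' p := by
  obtain ⟨F, hF, hl⟩ := hh
  obtain ⟨F', hF', hl'⟩ := hh'
  obtain ⟨x, rfl⟩ := surjective_toTorus p
  have h1 := (hF.differentiable (by simp) (F' x)).hasFDerivAt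
  have h2 := (hF'.differentiable (by simp) x).hasFDerivAt
  rw [jacobian_eq_matOf (F := F ∘ F') (fun x => by simp [hl, hl']) (h1.comp x h2), matOf_comp,
    hl' x, jacobian_eq_matOf hl h1, jacobian_eq_matOf hl' h2]

lemma jacobian_id (p : Torus) : jacobian id p = 1 := by
  obtain ⟨x, rfl⟩ := surjective_toTorus p
  rw [jacobian_eq_matOf (F := id) (fun _ => rfl) (hasFDerivAt_id x), matOf_id]

lemma isSmoothDiffeo_one : IsSmoothDiffeo 1 := ⟨isSmoothMap_id, isSmoothMap_id⟩

lemma IsSmoothDiffeo.mul {F G : Equiv.Perm Torus} (hF : IsSmoothDiffeo F)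
    (hG : IsSmoothDiffeo G) : IsSmoothDiffeo (F * G) := ⟨hF.1.comp hG.1, hG.2.comp hF.2⟩

lemma IsSmoothDiffeo.inv {F : Equiv.Perm Torus} (hF : IsSmoothDiffeo F) :
    IsSmoothDiffeo F⁻¹ := ⟨hF.2, hF.1⟩

lemma IsSmoothDiffeo.pow {F : Equiv.Perm Torus} (hF : IsSmoothDiffeo F) (n : ℕ) :
    IsSmoothDiffeo (F ^ n) := by
  induction n with
  | zero => exact isSmoothDiffeo_one
  | succ n ih => rw [pow_succ]; exact ih.mul hF

lemma rot_apply (t : UnitAddCircle) (x : Torus) : rot t x = (x.1 + t, x.2) := rfl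

lemma rot_inv (t : UnitAddCircle) : (rot t)⁻¹ = rot (-t) := by
  rw [inv_eq_iff_mul_eq_one]
  ext x <;> simp [rot_apply]

lemma rot_pow (t : UnitAddCircle) (n : ℕ) : rot t ^ n = rot (n • t) := by
  induction n with
  | zero => ext x <;> simp [rot_apply]
  | succ n ih => rw [pow_succ, ih]; ext x <;> simp [rot_apply, succ_nsmul, add_comm, add_left_comm, add_assoc]

lemma rot_lift (s : ℝ) (x : ℝ × ℝ) :
    rot (s : UnitAddCircle) (toTorus x) = toTorus (x + (s, 0)) := by
  simp [rot_apply, toTorus]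

lemma isSmoothMap_rot (t : UnitAddCircle) : IsSmoothMap (rot t) := by
  obtain ⟨s, rfl⟩ := QuotientAddGroup.mk_surjective t
  exact ⟨fun x => x + (s, 0), by fun_prop, rot_lift s⟩

lemma isSmoothDiffeo_rot (t : UnitAddCircle) : IsSmoothDiffeo (rot t) := by
  refine ⟨isSmoothMap_rot t, ?_⟩
  have : ((rot t).symm : Torus → Torus) = rot (-t) := by rw [← rot_inv]; rfl
  rw [this]; exact isSmoothMap_rot _

lemma jacobian_rot (t : UnitAddCircle) (p : Torus) : jacobian (rot t) p = 1 := by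
  obtain ⟨s, rfl⟩ := QuotientAddGroup.mk_surjective t
  obtain ⟨x, rfl⟩ := surjective_toTorus p
  rw [← matOf_id]
  exact jacobian_eq_matOf (rot_lift s) ((hasFDerivAt_id x).add_const _)

lemma IsSmoothDiffeo.continuous {F : Equiv.Perm Torus} (hF : IsSmoothDiffeo F) : Continuous F :=
  hF.1.continuous

lemma IsSmoothDiffeo.continuous_jacobian {F : Equiv.Perm Torus} (hF : IsSmoothDiffeo F) :
    Continuous (jacobian F) := hF.1.continuous_jacobian

lemma jacobian_mul {F G : Equiv.Perm Torus} (hF : IsSmoothDiffeo F) (hG : IsSmoothDiffeo G)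
    (p : Torus) : jacobian (F * G : Equiv.Perm Torus) p = jacobian F (G p) * jacobian G p :=
  jacobian_comp hF.1 hG.1 p

lemma jacobian_one (p : Torus) : jacobian (1 : Equiv.Perm Torus) p = 1 := jacobian_id p

lemma jacobian_inv_mul {F : Equiv.Perm Torus} (hF : IsSmoothDiffeo F) (p : Torus) :
    jacobian (F⁻¹ : Equiv.Perm Torus) (F p) * jacobian F p = 1 := by
  rw [← jacobian_mul hF.inv hF, inv_mul_cancel, jacobian_one]

lemma IsSmoothDiffeo.det_ne {F : Equiv.Perm Torus} (hF : IsSmoothDiffeo F) (p : Torus) :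
    (jacobian F p).det ≠ 0 := by
  intro h
  have := congrArg Matrix.det (jacobian_inv_mul hF p)
  rw [Matrix.det_mul, h, mul_zero, Matrix.det_one] at this
  exact zero_ne_one this

lemma jacobian_inv_apply {F : Equiv.Perm Torus} (hF : IsSmoothDiffeo F) (p : Torus) :
    jacobian F p = (jacobian (F⁻¹ : Equiv.Perm Torus) (F p))⁻¹ :=
  (Matrix.inv_eq_right_inv (jacobian_inv_mul hF p)).symm

/-! ### The projectivized derivative extension -/

lemma projExt_mul {F G : Equiv.Perm Torus} (hF : IsSmoothDiffeo F) (hG : IsSmoothDiffeo G) :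
    projExt (F * G : Equiv.Perm Torus) = projExt F ∘ projExt G := by
  funext x
  simp only [projExt, Function.comp]
  rw [jacobian_mul hF hG, projAct_mul _ (hG.det_ne _)]
  rfl

lemma projExt_one : projExt (1 : Equiv.Perm Torus) = id := by
  funext x
  simp only [projExt, jacobian_one, projAct_one]
  rfl

lemma projExt_rot (t : UnitAddCircle) (x : ProjTM) :
    projExt (rot t) x = ((x.1.1 + t, x.1.2), x.2) := by
  simp only [projExt, jacobian_rot, projAct_one]
  rfl

lemma projExt_pow {F : Equiv.Perm Torus} (hF : IsSmoothDiffeo F) (n : ℕ) :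
    projExt (F ^ n : Equiv.Perm Torus) = (projExt F)^[n] := by
  induction n with
  | zero => exact projExt_one
  | succ n ih => rw [pow_succ, projExt_mul (hF.pow n) hF, ih]; rfl

lemma projExt_inv_comp {F : Equiv.Perm Torus} (hF : IsSmoothDiffeo F) :
    projExt (F⁻¹ : Equiv.Perm Torus) ∘ projExt F = id := by
  rw [← projExt_mul hF.inv hF, inv_mul_cancel, projExt_one]

lemma projExt_comp_inv {F : Equiv.Perm Torus} (hF : IsSmoothDiffeo F) :
    projExt F ∘ projExt (F⁻¹ : Equiv.Perm Torus) = id := by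
  rw [← projExt_mul hF hF.inv, mul_inv_cancel, projExt_one]

lemma bijective_projExt {F : Equiv.Perm Torus} (hF : IsSmoothDiffeo F) :
    Function.Bijective (projExt F) :=
  ⟨Function.LeftInverse.injective (g := projExt (F⁻¹ : Equiv.Perm Torus))
      (congrFun (projExt_inv_comp hF)),
    Function.RightInverse.surjective (g := projExt (F⁻¹ : Equiv.Perm Torus))
      (congrFun (projExt_comp_inv hF))⟩

lemma measurable_lineCoord_mulVec {j : Torus → Matrix (Fin 2) (Fin 2) ℝ} (hj : Continuous j) :
    Measurable fun x : ProjTM => lineCoord ((j x.1).mulVec (lineVec x.2)) := by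
  have h2 : Measurable fun x : ProjTM => (x.1, lineVec x.2) :=
    measurable_fst.prodMk (measurable_lineVec.comp measurable_snd)
  have h : Continuous fun p : Torus × (Fin 2 → ℝ) => (j p.1).mulVec p.2 :=
    (hj.comp continuous_fst).matrix_mulVec continuous_snd
  have h1 : Measurable fun p : Torus × (Fin 2 → ℝ) => (j p.1).mulVec p.2 := h.measurable
  exact measurable_lineCoord.comp (h1.comp h2)

lemma measurable_projExt_of_continuous {F : Torus → Torus} (hF : Continuous F)
    (hj : Continuous (jacobian F)) : Measurable (projExt F) := by
  unfold projExt projAct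
  exact (hF.measurable.comp measurable_fst).prodMk (measurable_lineCoord_mulVec hj)

lemma measurable_projExt {F : Equiv.Perm Torus} (hF : IsSmoothDiffeo F) :
    Measurable (projExt F) :=
  measurable_projExt_of_continuous hF.continuous hF.continuous_jacobian

/-! ### Area-preserving diffeomorphisms -/

lemma IsAreaPreservingDiffeo.mul {F G : Equiv.Perm Torus} (hF : IsAreaPreservingDiffeo F)
    (hG : IsAreaPreservingDiffeo G) : IsAreaPreservingDiffeo (F * G) :=
  ⟨hF.1.mul hG.1, hF.2.comp hG.2⟩

lemma IsAreaPreservingDiffeo.inv {F : Equiv.Perm Torus} (hF : IsAreaPreservingDiffeo F) :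
    IsAreaPreservingDiffeo F⁻¹ := by
  refine ⟨hF.1.inv, ?_⟩
  let e : Torus ≃ᵐ Torus := ⟨F, hF.1.1.continuous.measurable, hF.1.2.continuous.measurable⟩
  exact MeasurePreserving.symm e hF.2

lemma isAreaPreservingDiffeo_one : IsAreaPreservingDiffeo 1 :=
  ⟨isSmoothDiffeo_one, MeasurePreserving.id _⟩

lemma isAreaPreservingDiffeo_rot (t : UnitAddCircle) : IsAreaPreservingDiffeo (rot t) :=
  ⟨isSmoothDiffeo_rot t, (measurePreserving_add_right volume t).prod (MeasurePreserving.id volume)⟩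

lemma isAreaPreservingDiffeo_bigConj {g φ : ℕ → Equiv.Perm Torus}
    (hg : ∀ n ≥ 1, IsAreaPreservingDiffeo (g n)) (hφ : ∀ n ≥ 1, IsAreaPreservingDiffeo (φ n))
    (n : ℕ) : IsAreaPreservingDiffeo (bigConj g φ n) := by
  induction n with
  | zero => exact isAreaPreservingDiffeo_one
  | succ n ih => exact ih.mul ((hg _ (by omega)).mul (hφ _ (by omega)))

lemma measurePreserving_projExt_rot (t : UnitAddCircle) :
    MeasurePreserving (projExt (rot t)) (volume : Measure ProjTM) volume := by
  have h : projExt (rot t) = Prod.map (rot t) id := by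
    funext x; rw [projExt_rot]; rfl
  rw [h]
  exact (isAreaPreservingDiffeo_rot t).2.prod (MeasurePreserving.id volume)

/-! ### Comparison of measures with a common minorant -/

lemma norm_integral_sub_le_of_le {X : Type*} [MeasurableSpace X] {κ μ : Measure X}
    [IsFiniteMeasure μ] (h : κ ≤ μ) {f : X → ℂ} {M : ℝ} (hf : Measurable f)
    (hM : ∀ x, ‖f x‖ ≤ M) :
    ‖∫ x, f x ∂μ - ∫ x, f x ∂κ‖ ≤ M * (μ.real univ - κ.real univ) := by
  have : IsFiniteMeasure κ := isFiniteMeasure_of_le μ h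
  have hadd : μ - κ + κ = μ := Measure.sub_add_cancel_of_le h
  have : IsFiniteMeasure (μ - κ) := isFiniteMeasure_of_le μ Measure.sub_le
  have hint : ∀ ν : Measure X, IsFiniteMeasure ν → Integrable f ν := fun ν _ =>
    Integrable.of_bound hf.aestronglyMeasurable M (Eventually.of_forall hM)
  have h1 : ∫ x, f x ∂μ = ∫ x, f x ∂(μ - κ) + ∫ x, f x ∂κ := by
    conv_lhs => rw [← hadd]
    exact integral_add_measure (hint _ inferInstance) (hint _ inferInstance)
  have h2 : μ.real univ = (μ - κ).real univ + κ.real univ := by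
    conv_lhs => rw [← hadd]
    exact measureReal_add_apply
  rw [h1, add_sub_cancel_right, h2, add_sub_cancel_right]
  exact norm_integral_le_of_norm_le_const (Eventually.of_forall hM)

/-- Passing from either measure to the common minorant costs at most `M` times the mass that is
lost. -/
lemma norm_integral_sub_le_of_minorant {X : Type*} [MeasurableSpace X] {κ μ ν : Measure X}
    [IsProbabilityMeasure μ] [IsProbabilityMeasure ν] (h : κ ≤ μ) (h' : κ ≤ ν) {f : X → ℂ}
    {M : ℝ} (hf : Measurable f) (hM : ∀ x, ‖f x‖ ≤ M) :
    ‖∫ x, f x ∂μ - ∫ x, f x ∂ν‖ ≤ 2 * M * (1 - κ.real univ) := by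
  have h1 := norm_integral_sub_le_of_le h hf hM
  have h2 := norm_integral_sub_le_of_le h' hf hM
  rw [probReal_univ] at h1 h2
  have h3 : ∫ x, f x ∂μ - ∫ x, f x ∂ν
      = (∫ x, f x ∂μ - ∫ x, f x ∂κ) - (∫ x, f x ∂ν - ∫ x, f x ∂κ) := by ring
  rw [h3]
  refine (norm_sub_le _ _).trans ?_
  linarith

/-! ### The fiberwise arc length measures -/

lemma measurable_angleDensity {G : Torus → Matrix (Fin 2) (Fin 2) ℝ} (hG : Continuous G) :
    Measurable fun x : ProjTM => angleDensity (G x.1) x.2 := by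
  have h2 : Measurable fun x : ProjTM => (x.1, lineVec x.2) :=
    measurable_fst.prodMk (measurable_lineVec.comp measurable_snd)
  have h : Continuous fun p : Torus × (Fin 2 → ℝ) => p.2 ⬝ᵥ (G p.1).mulVec p.2 :=
    continuous_snd.dotProduct ((hG.comp continuous_fst).matrix_mulVec continuous_snd)
  have h1 : Measurable fun p : Torus × (Fin 2 → ℝ) => p.2 ⬝ᵥ (G p.1).mulVec p.2 := h.measurable
  have h3 : Continuous fun p : Torus => Real.sqrt (G p).det := by fun_prop
  exact (h3.measurable.comp measurable_fst).div (h1.comp h2)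

lemma IsSmoothDiffeo.continuous_pullbackMetric {H : Equiv.Perm Torus} (hH : IsSmoothDiffeo H) :
    Continuous (pullbackMetric H) :=
  hH.inv.continuous_jacobian.matrix_transpose.matrix_mul hH.inv.continuous_jacobian

/-- Fubini: area preservation treats the base, and `lintegral_projAct_inv` treats each fiber. -/
lemma map_projExt {H : Equiv.Perm Torus} (hH : IsAreaPreservingDiffeo H) :
    Measure.map (projExt H) volume = muBar (pullbackMetric H) := by
  have hdens := (measurable_angleDensity hH.1.continuous_pullbackMetric).ennreal_ofReal
  refine Measure.ext fun A hA => ?_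
  have hmeas : Measurable (A.indicator (1 : ProjTM → ℝ≥0∞)) := measurable_one.indicator hA
  rw [← lintegral_indicator_one hA, lintegral_map hmeas (measurable_projExt hH.1), muBar,
    withDensity_apply _ hA, ← lintegral_indicator hA]
  change ∫⁻ a, _ ∂((volume : Measure Torus).prod volume)
    = ∫⁻ a, _ ∂((volume : Measure Torus).prod volume)
  rw [lintegral_prod (fun a => A.indicator (1 : ProjTM → ℝ≥0∞) (projExt H a))
      (hmeas.comp (measurable_projExt hH.1)).aemeasurable,
    lintegral_prod _ (hdens.indicator hA).aemeasurable]
  rw [← hH.2.lintegral_comp (f := fun p => ∫⁻ t, A.indicator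
    (fun x => ENNReal.ofReal (angleDensity (pullbackMetric H x.1) x.2)) (p, t))
    (hdens.indicator hA).lintegral_prod_right']
  refine lintegral_congr fun p => ?_
  -- Here `J` is the differential of `H⁻¹` at `H p`, so that `J⁻¹` is the differential of `H` at
  -- `p`.
  have h1 := lintegral_projAct_inv (hH.1.inv.det_ne (H p))
    (fun t => A.indicator (1 : ProjTM → ℝ≥0∞) (H p, t)) (hmeas.comp measurable_prodMk_left)
  rw [← jacobian_inv_apply hH.1] at h1
  refine h1.trans (lintegral_congr fun t => ?_)
  by_cases h : (H p, t) ∈ A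
  · rw [indicator_of_mem h, indicator_of_mem h, Pi.one_apply, one_mul]; rfl
  · rw [indicator_of_notMem h, indicator_of_notMem h, zero_mul]

lemma isProbabilityMeasure_muBar_pullbackMetric {H : Equiv.Perm Torus}
    (hH : IsAreaPreservingDiffeo H) : IsProbabilityMeasure (muBar (pullbackMetric H)) := by
  rw [← map_projExt hH]
  exact Measure.isProbabilityMeasure_map (measurable_projExt hH.1).aemeasurable

lemma integral_muBar_pullbackMetric {H : Equiv.Perm Torus} (hH : IsAreaPreservingDiffeo H)
    {f : ProjTM → ℂ} (hf : Measurable f) :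
    ∫ x, f x ∂(muBar (pullbackMetric H)) = ∫ x, f (projExt H x) := by
  rw [← map_projExt hH, integral_map (measurable_projExt hH.1).aemeasurable
    hf.aestronglyMeasurable]

lemma muBar_pullbackMetric_prod_univ {H : Equiv.Perm Torus} (hH : IsAreaPreservingDiffeo H)
    {Z : Set Torus} (hZ : MeasurableSet Z) :
    muBar (pullbackMetric H) (Z ×ˢ univ) = volume Z := by
  rw [← map_projExt hH, Measure.map_apply (measurable_projExt hH.1) (hZ.prod MeasurableSet.univ)]
  have h : projExt H ⁻¹' (Z ×ˢ univ) = (H ⁻¹' Z) ×ˢ univ := by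
    ext x; simp [projExt]
  rw [h]
  change ((volume : Measure Torus).prod volume) _ = _
  rw [Measure.prod_prod, measure_univ, mul_one, hH.2.measure_preimage hZ.nullMeasurableSet]

lemma muBar_restrict_congr {G G' : Torus → Matrix (Fin 2) (Fin 2) ℝ} {Z : Set Torus}
    (hZ : MeasurableSet Z) (h : ∀ x ∈ Z, G x = G' x) :
    (muBar G).restrict (Z ×ˢ univ) = (muBar G').restrict (Z ×ˢ univ) := by
  have hm : MeasurableSet (Z ×ˢ (univ : Set UnitAddCircle)) := hZ.prod MeasurableSet.univ
  rw [muBar, muBar, restrict_withDensity hm, restrict_withDensity hm]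
  refine withDensity_congr_ae ?_
  filter_upwards [ae_restrict_mem hm] with x hx
  rw [h _ hx.1]

/-- The part over `Z` is a common minorant of both probability measures, and its mass is the area of
`Z`. -/
lemma norm_integral_muBar_sub_le {G : Torus → Matrix (Fin 2) (Fin 2) ℝ}
    [IsProbabilityMeasure (muBar G)] {H : Equiv.Perm Torus} (hH : IsAreaPreservingDiffeo H)
    {Z : Set Torus} (hZ : MeasurableSet Z) (h : ∀ x ∈ Z, G x = pullbackMetric H x)
    {f : ProjTM → ℂ} {M : ℝ} (hf : Measurable f) (hM : ∀ x, ‖f x‖ ≤ M) :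
    ‖∫ x, f x ∂(muBar G) - ∫ x, f (projExt H x)‖ ≤ 2 * M * volume.real Zᶜ := by
  have := isProbabilityMeasure_muBar_pullbackMetric hH
  have h1 : (muBar (pullbackMetric H)).restrict (Z ×ˢ univ) ≤ muBar G := by
    rw [← muBar_restrict_congr hZ h]; exact Measure.restrict_le_self
  have h2 := norm_integral_sub_le_of_minorant h1 Measure.restrict_le_self hf hM
  rw [integral_muBar_pullbackMetric hH hf, measureReal_restrict_apply MeasurableSet.univ,
    univ_inter, measureReal_def, muBar_pullbackMetric_prod_univ hH hZ] at h2
  rwa [probReal_compl_eq_one_sub hZ]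

/-- The differential of `h⁻¹` enters the Gram matrix `Jᵀ J` as a left factor of `J`, and orthogonal
left factors cancel. -/
lemma pullbackMetric_mul_of_orthogonal {H h : Equiv.Perm Torus} (hH : IsSmoothDiffeo H)
    (hh : IsSmoothDiffeo h) {x : Torus}
    (hx : jacobian h ((H * h)⁻¹ x) ∈ Matrix.orthogonalGroup (Fin 2) ℝ) :
    pullbackMetric (H * h) x = pullbackMetric H x := by
  have hy : (H⁻¹ : Equiv.Perm Torus) x = h ((H * h)⁻¹ x) := by simp [mul_inv_rev]
  rw [pullbackMetric, pullbackMetric, mul_inv_rev, jacobian_mul hh.inv hH.inv, hy]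
  set y := (H * h)⁻¹ x with hydef
  have h3 := (Matrix.mem_orthogonalGroup_iff _ _).1 hx
  have h1 : jacobian (h⁻¹ : Equiv.Perm Torus) (h y) = (jacobian h y).transpose := by
    have h2 := jacobian_inv_mul hh y
    calc jacobian (h⁻¹ : Equiv.Perm Torus) (h y)
        = jacobian (h⁻¹ : Equiv.Perm Torus) (h y) * (jacobian h y * (jacobian h y).transpose) := by
          rw [h3, mul_one]
      _ = _ := by rw [← mul_assoc, h2, one_mul]
  rw [h1, Matrix.transpose_mul, Matrix.transpose_transpose, ← mul_assoc,
    mul_assoc _ (jacobian h y), h3, mul_one]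

/-! ### Stabilizing metrics -/

/-- The points at which the pulled back metrics are constant from index `N` on. -/
def stableSet (H : ℕ → Equiv.Perm Torus) (N : ℕ) : Set Torus :=
  {x | ∀ n ≥ N, pullbackMetric (H n) x = pullbackMetric (H N) x}

section stable

variable {H : ℕ → Equiv.Perm Torus}

lemma measurableSet_stableSet (hH : ∀ n, IsAreaPreservingDiffeo (H n)) (N : ℕ) :
    MeasurableSet (stableSet H N) := by
  have : stableSet H N =
      ⋂ n, ⋂ (_ : n ≥ N), {x | pullbackMetric (H n) x = pullbackMetric (H N) x} := by
    ext x; simp [stableSet]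
  rw [this]
  exact (isClosed_iInter fun n => isClosed_iInter fun _ => isClosed_eq
    (hH n).1.continuous_pullbackMetric (hH N).1.continuous_pullbackMetric).measurableSet

lemma stableSet_mono : Monotone (stableSet H) := fun N N' hNN' x hx n hn => by
  rw [hx n (hNN'.trans hn), hx N' hNN']

lemma limitMetric_eq_of_mem_stableSet {N : ℕ} {x : Torus} (hx : x ∈ stableSet H N) :
    Tendsto (fun n => pullbackMetric (H n) x) atTop (𝓝 (pullbackMetric (H N) x)) ∧
      limitMetric H x = pullbackMetric (H N) x := by
  have h : Tendsto (fun n => pullbackMetric (H n) x) atTop (𝓝 (pullbackMetric (H N) x)) := by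
    refine tendsto_const_nhds.congr' ?_
    filter_upwards [eventually_ge_atTop N] with n hn
    exact (hx n hn).symm
  exact ⟨h, h.limUnder_eq⟩

lemma limitMetric_posDef_of_mem_stableSet (hH : ∀ n, IsAreaPreservingDiffeo (H n)) {N : ℕ}
    {x : Torus} (hx : x ∈ stableSet H N) :
    (limitMetric H x).PosDef ∧
      Tendsto (fun n => pullbackMetric (H n) x) atTop (𝓝 (limitMetric H x)) := by
  obtain ⟨h1, h2⟩ := limitMetric_eq_of_mem_stableSet hx
  rw [h2]
  refine ⟨?_, h1⟩
  have hdet := (hH N).1.inv.det_ne x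
  have := Matrix.PosDef.conjTranspose_mul_self (jacobian ((H N)⁻¹ : Equiv.Perm Torus) x)
    (Matrix.mulVec_injective_of_isUnit
      ((Matrix.isUnit_iff_isUnit_det _).2 (isUnit_iff_ne_zero.2 hdet)))
  rwa [Matrix.conjTranspose_eq_transpose_of_trivial] at this

lemma tendsto_volume_stableSet_compl (hH : ∀ n, IsAreaPreservingDiffeo (H n))
    (hst : ∀ᵐ x, ∃ N, x ∈ stableSet H N) :
    Tendsto (fun N => volume.real (stableSet H N)ᶜ) atTop (𝓝 0) := by
  have h1 : Tendsto (fun N => volume (stableSet H N)ᶜ) atTop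
      (𝓝 (volume (⋂ N, (stableSet H N)ᶜ))) :=
    tendsto_measure_iInter_atTop (fun N => (measurableSet_stableSet hH N).compl.nullMeasurableSet)
      (fun _ _ h => compl_subset_compl.2 (stableSet_mono h)) ⟨0, measure_ne_top _ _⟩
  have h2 : volume (⋂ N, (stableSet H N)ᶜ) = 0 := by
    rw [← compl_iUnion]
    refine measure_mono_null ?_ (ae_iff.1 hst)
    intro x hx
    simpa using hx
  rw [h2] at h1
  exact (ENNReal.tendsto_toReal (by simp)).comp h1

/-- Over a stable set the measure is that of a single pulled back metric, so it projects to the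
area. The stable sets exhaust the torus up to a null set, whose preimage is null because `muBar` has
a density. -/
lemma isProbabilityMeasure_muBar_limitMetric (hH : ∀ n, IsAreaPreservingDiffeo (H n))
    (hst : ∀ᵐ x, ∃ N, x ∈ stableSet H N) : IsProbabilityMeasure (muBar (limitMetric H)) := by
  constructor
  have hN : ∀ N, muBar (limitMetric H) (stableSet H N ×ˢ univ) = volume (stableSet H N) := by
    intro N
    have hm := measurableSet_stableSet hH N
    have h1 := muBar_restrict_congr hm
      (fun x hx => (limitMetric_eq_of_mem_stableSet (H := H) hx).2)
    have h2 := congrArg (fun ν => ν univ) h1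
    simp only [Measure.restrict_apply_univ] at h2
    rw [h2, muBar_pullbackMetric_prod_univ (hH N) hm]
  have hmono : Monotone fun N => stableSet H N ×ˢ (univ : Set UnitAddCircle) :=
    fun _ _ h => prod_mono (stableSet_mono h) le_rfl
  have h1 := tendsto_measure_iUnion_atTop (μ := muBar (limitMetric H)) hmono
  have h2 := tendsto_measure_iUnion_atTop (μ := (volume : Measure Torus)) (stableSet_mono (H := H))
  simp only [Function.comp_def, hN] at h1 h2
  have h3 := tendsto_nhds_unique h1 h2
  have hU : volume (⋃ N, stableSet H N) = 1 := by
    rw [prob_compl_eq_zero_iff₀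
      (MeasurableSet.iUnion (measurableSet_stableSet hH)).nullMeasurableSet |>.symm]
    refine measure_mono_null ?_ (ae_iff.1 hst)
    intro x hx; simpa using hx
  have hnull : muBar (limitMetric H) (⋃ N, stableSet H N ×ˢ (univ : Set UnitAddCircle))ᶜ = 0 := by
    refine withDensity_absolutelyContinuous _ _ ?_
    rw [← iUnion_prod_const, compl_prod_eq_union, compl_univ, prod_empty, union_empty]
    change ((volume : Measure Torus).prod volume) _ = 0
    rw [Measure.prod_prod, (prob_compl_eq_zero_iff
      (MeasurableSet.iUnion (measurableSet_stableSet hH))).2 hU, zero_mul]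
  have h4 : MeasurableSet (⋃ N, stableSet H N ×ˢ (univ : Set UnitAddCircle)) :=
    MeasurableSet.iUnion fun N => (measurableSet_stableSet hH N).prod MeasurableSet.univ
  rw [← measure_add_measure_compl h4, hnull, add_zero, h3, hU]

/-- The transport principle of the proof: the limit measure may be replaced by the image of Lebesgue
measure under `(H n, dH n)`, with an error that tends to zero by `tendsto_volume_stableSet_compl`.
-/
lemma norm_integral_limit_sub_le (hH : ∀ n, IsAreaPreservingDiffeo (H n))
    (hst : ∀ᵐ x, ∃ N, x ∈ stableSet H N) {f : ProjTM → ℂ} {M : ℝ} (hf : Measurable f)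
    (hM : ∀ x, ‖f x‖ ≤ M) (n : ℕ) :
    ‖∫ x, f x ∂(muBar (limitMetric H)) - ∫ x, f (projExt (H n) x)‖
      ≤ 2 * M * volume.real (stableSet H n)ᶜ := by
  have := isProbabilityMeasure_muBar_limitMetric hH hst
  exact norm_integral_muBar_sub_le (hH n) (measurableSet_stableSet hH n)
    (fun x hx => (limitMetric_eq_of_mem_stableSet hx).2) hf hM

end stable

/-! ### Convergence of the derivative extensions -/

lemma edist_le_dTilde1 (F G : Equiv.Perm Torus) (x : Torus) : edist (F x) (G x) ≤ dTilde1 F G :=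
  (le_iSup (fun x => edist (F x) (G x)) x).trans (le_max_left _ _)

lemma edist_jacobian_le_dTilde1 (F G : Equiv.Perm Torus) (x : Torus) (i j : Fin 2) :
    edist (jacobian F x i j) (jacobian G x i j) ≤ dTilde1 F G :=
  ((le_iSup (fun j => edist (jacobian F x i j) (jacobian G x i j)) j).trans
    ((le_iSup (fun i => ⨆ j, edist (jacobian F x i j) (jacobian G x i j)) i).trans
      (le_iSup (fun x => ⨆ i, ⨆ j, edist (jacobian F x i j) (jacobian G x i j)) x))).trans
    (le_max_right _ _)

/-- The limit differential is invertible, so the limit of the image vectors is nonzero and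
`lineCoord` is continuous there. -/
lemma tendsto_projExt {F : ℕ → Equiv.Perm Torus} {f : Equiv.Perm Torus} (hf : IsSmoothDiffeo f)
    (h : Tendsto (fun n => d1 (F n) f) atTop (𝓝 0)) (x : ProjTM) :
    Tendsto (fun n => projExt (F n) x) atTop (𝓝 (projExt f x)) := by
  have h' : Tendsto (fun n => dTilde1 (F n) f) atTop (𝓝 0) :=
    tendsto_of_tendsto_of_tendsto_of_le_of_le tendsto_const_nhds h (fun _ => zero_le)
      (fun _ => le_max_left _ _)
  have hzero : ∀ a : ℕ → ℝ≥0∞, (∀ n, a n ≤ dTilde1 (F n) f) → Tendsto a atTop (𝓝 0) :=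
    fun a ha => tendsto_of_tendsto_of_tendsto_of_le_of_le tendsto_const_nhds h'
      (fun _ => zero_le) ha
  have h1 : Tendsto (fun n => F n x.1) atTop (𝓝 (f x.1)) :=
    tendsto_iff_edist_tendsto_0.2 (hzero _ fun n => edist_le_dTilde1 _ _ _)
  have h2 : Tendsto (fun n => jacobian (F n) x.1) atTop (𝓝 (jacobian f x.1)) := by
    refine tendsto_pi_nhds.2 fun i => tendsto_pi_nhds.2 fun j => ?_
    exact tendsto_iff_edist_tendsto_0.2 (hzero _ fun n => edist_jacobian_le_dTilde1 _ _ _ _ _)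
  have h3 : Continuous fun A : Matrix (Fin 2) (Fin 2) ℝ => A.mulVec (lineVec x.2) := by fun_prop
  have h4 := (continuousAt_lineCoord
    (mulVec_ne_zero (hf.det_ne x.1) (lineVec_ne x.2))).tendsto.comp ((h3.tendsto _).comp h2)
  exact h1.prodMk_nhds h4

lemma measurePreserving_projExt_conj_rot {H : Equiv.Perm Torus} (hH : IsAreaPreservingDiffeo H)
    (t : UnitAddCircle) :
    MeasurePreserving (projExt (H * rot t * H⁻¹ : Equiv.Perm Torus)) (muBar (pullbackMetric H))
      (muBar (pullbackMetric H)) := by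
  have hR := isSmoothDiffeo_rot t
  have hm := measurable_projExt ((hH.1.mul hR).mul hH.1.inv)
  refine ⟨hm, ?_⟩
  rw [← map_projExt hH, Measure.map_map hm (measurable_projExt hH.1),
    ← projExt_mul ((hH.1.mul hR).mul hH.1.inv) hH.1, inv_mul_cancel_right, projExt_mul hH.1 hR,
    ← Measure.map_map (measurable_projExt hH.1) (measurable_projExt hR),
    (measurePreserving_projExt_rot t).map_eq]

lemma measurePreserving_limit {H : ℕ → Equiv.Perm Torus}
    (hH : ∀ n, IsAreaPreservingDiffeo (H n)) (hst : ∀ᵐ x, ∃ N, x ∈ stableSet H N)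
    {f : Equiv.Perm Torus} (hf : IsSmoothDiffeo f) (t : ℕ → UnitAddCircle)
    (hconv : Tendsto (fun n => d1 (H n * rot (t n) * (H n)⁻¹) f) atTop (𝓝 0)) :
    MeasurePreserving (projExt f) (muBar (limitMetric H)) (muBar (limitMetric H)) := by
  have := isProbabilityMeasure_muBar_limitMetric hH hst
  set ν := muBar (limitMetric H) with hν
  have hfm := measurable_projExt hf
  refine ⟨hfm, ?_⟩
  have : IsProbabilityMeasure (Measure.map (projExt f) ν) :=
    Measure.isProbabilityMeasure_map hfm.aemeasurable
  refine ext_of_forall_integral_eq_of_IsFiniteMeasure fun A => ?_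
  rw [integral_map hfm.aemeasurable A.continuous.aestronglyMeasurable]
  set fn : ℕ → Equiv.Perm Torus := fun n => H n * rot (t n) * (H n)⁻¹ with hfn
  have hsm : ∀ n, IsSmoothDiffeo (fn n) := fun n =>
    ((hH n).1.mul (isSmoothDiffeo_rot _)).mul (hH n).1.inv
  set B : ProjTM → ℂ := fun x => (A x : ℂ) with hB
  have hBm : Measurable B := Complex.measurable_ofReal.comp A.continuous.measurable
  have hBM : ∀ x, ‖B x‖ ≤ ‖A‖ := fun x => by
    rw [hB, Complex.norm_real]; exact A.norm_coe_le_norm x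
  have h1 : Tendsto (fun n => ∫ x, B (projExt (fn n) x) ∂ν) atTop
      (𝓝 (∫ x, B (projExt f x) ∂ν)) := by
    refine tendsto_integral_of_dominated_convergence (fun _ => ‖A‖)
      (fun n => (hBm.comp (measurable_projExt (hsm n))).aestronglyMeasurable)
      (integrable_const _) (fun n => Eventually.of_forall fun x => hBM _)
      (Eventually.of_forall fun x => ?_)
    exact ((Complex.continuous_ofReal.comp A.continuous).tendsto _).comp
      (tendsto_projExt hf hconv x)
  have h2 : Tendsto (fun n => ∫ x, B (projExt (fn n) x) ∂ν) atTop (𝓝 (∫ x, B x ∂ν)) := by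
    rw [tendsto_iff_norm_sub_tendsto_zero]
    -- Two transports, one for `B` and one for `B ∘ (fn n, d fn n)`, cost `2 * ‖A‖` times the
    -- unstable area each.
    have hz : Tendsto (fun n => 4 * ‖A‖ * volume.real (stableSet H n)ᶜ) atTop (𝓝 0) := by
      simpa using (tendsto_volume_stableSet_compl hH hst).const_mul (4 * ‖A‖)
    refine squeeze_zero (fun _ => norm_nonneg _) (fun n => ?_) hz
    have a1 := norm_integral_limit_sub_le hH hst (hBm.comp (measurable_projExt (hsm n)))
      (fun x => hBM _) n
    have a2 := norm_integral_limit_sub_le hH hst hBm hBM n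
    have a3 : ∫ x, (B ∘ projExt (fn n)) (projExt (H n) x) = ∫ x, B (projExt (H n) x) := by
      have hmp := measurePreserving_projExt_conj_rot (hH n) (t n)
      rw [← integral_muBar_pullbackMetric (hH n) (hBm.comp (measurable_projExt (hsm n))),
        ← integral_muBar_pullbackMetric (hH n) hBm]
      conv_rhs => rw [← hmp.map_eq]
      rw [integral_map hmp.measurable.aemeasurable hBm.aestronglyMeasurable]
      rfl
    rw [a3] at a1
    rw [norm_sub_rev] at a2
    refine (norm_sub_le_norm_sub_add_norm_sub _ (∫ x, B (projExt (H n) x)) _).trans ?_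
    refine (add_le_add a1 a2).trans (le_of_eq (by ring))
  have h3 := tendsto_nhds_unique h1 h2
  simp only [hB, integral_complex_ofReal] at h3
  exact_mod_cast h3

/-! ### Shears -/

lemma isClosed_goodDomain (a : ℕ) (ε : ℝ) : IsClosed (goodDomain a ε) := by
  refine (Finset.range a).finite_toSet.isClosed_biUnion fun j _ => ?_
  have h : strip a ε j = Prod.snd ⁻¹' ((fun x : ℝ => (x : UnitAddCircle)) ''
      Icc ((j + 2 * ε) / a : ℝ) ((j + 1 - 2 * ε) / a : ℝ)) := by
    ext x
    simp only [strip, mem_ofPred_eq, mem_preimage, mem_image, eq_comm]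
  rw [h]
  exact (isCompact_Icc.image (AddCircle.continuous_mk' 1)).isClosed.preimage continuous_snd

section shear

variable {a b q : ℕ} {ε : ℝ} {g : Equiv.Perm Torus}

lemma IsStepShear.inv_mem_goodDomain (h : IsStepShear a b q ε g) {y : Torus}
    (hy : y ∈ goodDomain a ε) : g.symm y ∈ goodDomain a ε := by
  simp only [goodDomain, mem_iUnion, Finset.mem_range] at hy ⊢
  obtain ⟨j, hj, r, hr, hyr⟩ := hy
  refine ⟨j, hj, ?_⟩
  have hx : ((y.1 - ((b * j / a : ℝ) : UnitAddCircle), y.2) : Torus) ∈ strip a ε j := ⟨r, hr, hyr⟩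
  have h1 := h.translates j hj _ hx
  rw [sub_add_cancel] at h1
  rw [show g.symm y = _ from (Equiv.symm_apply_eq g).2 h1.symm]
  exact hx

/-- At a boundary point of a closed strip the map is known on one side only. The derivative within
the strip still determines the differential, because `ε < 1 / 4` makes the strip nondegenerate. -/
lemma IsStepShear.jacobian_eq_one (h : IsStepShear a b q ε g) (hg : IsSmoothDiffeo g)
    (ha : 0 < a) (hε : ε < 1 / 4) {x : Torus} (hx : x ∈ goodDomain a ε) :
    jacobian g x = 1 := by
  simp only [goodDomain, mem_iUnion, Finset.mem_range] at hx
  obtain ⟨j, hj, r, hr, hxr⟩ := hx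
  obtain ⟨⟨θ, r'⟩, rfl⟩ := surjective_toTorus x
  obtain ⟨F, hF, hl⟩ := hg.1
  have ha' : (0 : ℝ) < a := by exact_mod_cast ha
  have hxx : toTorus (θ, r') = toTorus (θ, r) := Prod.ext rfl hxr
  rw [hxx]
  have hF' := (hF.differentiable (by simp) (θ, r)).hasFDerivAt
  rw [jacobian_eq_matOf hl hF', ← matOf_id]
  congr 1
  set s : Set (ℝ × ℝ) := univ ×ˢ Icc ((j + 2 * ε) / a : ℝ) ((j + 1 - 2 * ε) / a : ℝ) with hs
  have hmem : (θ, r) ∈ s := ⟨mem_univ _, hr⟩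
  have huniq : UniqueDiffWithinAt ℝ s (θ, r) :=
    uniqueDiffWithinAt_univ.prod (uniqueDiffOn_Icc (by gcongr; linarith) r hr)
  have hlm := localMap_eventuallyEq hl (x := (θ, r)) hF'.continuousAt
  have hsh : Tendsto (fun w : ℝ × ℝ => w - (θ, r)) (𝓝 (θ, r)) (𝓝 0) := by
    have : Continuous fun w : ℝ × ℝ => w - (θ, r) := by fun_prop
    simpa using this.tendsto (θ, r)
  have hU : Ico (-1 / 2 : ℝ) (1 / 2) ×ˢ Ico (-1 / 2 : ℝ) (1 / 2) ∈ 𝓝 (0 : ℝ × ℝ) :=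
    prod_mem_nhds (Ico_mem_nhds (by norm_num) (by norm_num))
      (Ico_mem_nhds (by norm_num) (by norm_num))
  have htr : ∀ w ∈ s, g (toTorus w) = toTorus w + (((b * j / a : ℝ) : UnitAddCircle), 0) := by
    intro w hw
    rw [h.translates j hj _ ⟨w.2, hw.2, rfl⟩]
    exact Prod.ext rfl (add_zero _).symm
  -- The translation is known only modulo integers; comparing increments in the chart at the base
  -- point removes the ambiguity of the lift.
  have hev : F =ᶠ[𝓝[s] (θ, r)] fun w => w + (F (θ, r) - (θ, r)) := by
    filter_upwards [mem_nhdsWithin_of_mem_nhds (hsh.eventually hlm), self_mem_nhdsWithin,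
      mem_nhdsWithin_of_mem_nhds (hsh hU)] with w hw hws hwU
    have hw2 : localMap g (toTorus (θ, r)) (w - (θ, r)) = w - (θ, r) := by
      rw [localMap, ← toTorus_add, add_sub_cancel, htr w hws, htr _ hmem, add_sub_add_right_eq_sub,
        ← toTorus_sub]
      exact Prod.ext (smallRep_coe hwU.1) (smallRep_coe hwU.2)
    rw [hw2, add_sub_cancel] at hw
    rw [sub_eq_iff_eq_add.1 hw.symm]; abel
  have hid : HasFDerivWithinAt F (ContinuousLinearMap.id ℝ (ℝ × ℝ)) s (θ, r) := by
    refine HasFDerivWithinAt.congr_of_eventuallyEq ?_ hev (by simp)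
    exact ((hasFDerivAt_id _).add_const _).hasFDerivWithinAt
  exact huniq.eq hF'.hasFDerivWithinAt hid

/-- The step function `b j / a` follows the linear shear `b r` with error at most `b / a`, since `|j
- a r| ≤ 1` on strip `j`. -/
lemma IsStepShear.exists_apply_eq (h : IsStepShear a b q ε g) (ha : 0 < a) (hε : 0 ≤ ε)
    {x : Torus} (hx : x ∈ goodDomain a ε) :
    ∃ s : UnitAddCircle, g x = (x.1 + s, x.2) ∧ ‖s - b • x.2‖ ≤ b / a := by
  simp only [goodDomain, mem_iUnion, Finset.mem_range] at hx
  obtain ⟨j, hj, r, hr, hxr⟩ := hx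
  have ha' : (0 : ℝ) < a := by exact_mod_cast ha
  refine ⟨_, h.translates j hj x ⟨r, hr, hxr⟩, ?_⟩
  rw [hxr, ← AddCircle.coe_nsmul, ← AddCircle.coe_sub]
  refine (UnitAddCircle.norm_eq (x := b * j / a - b • r)).le.trans ?_
  refine (round_le _ 0).trans ?_
  have h1 : (b * j / a - b • r - ((0 : ℤ) : ℝ) : ℝ) = (b / a : ℝ) * (j - a * r) := by
    rw [nsmul_eq_mul]; push_cast; field_simp; ring
  rw [h1, abs_mul, abs_of_nonneg (by positivity)]
  have h2 : |(j : ℝ) - a * r| ≤ 1 := by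
    have h3 := (div_le_iff₀ ha').1 hr.1
    have h4 := (le_div_iff₀ ha').1 hr.2
    rw [abs_le]; constructor <;> linarith
  calc (b / a : ℝ) * |(j : ℝ) - a * r| ≤ (b / a : ℝ) * 1 := by gcongr
    _ = b / a := mul_one _

/-! ### Arcs -/

lemma norm_coe_le (x : ℝ) : ‖(x : UnitAddCircle)‖ ≤ |x| := by
  rw [UnitAddCircle.norm_eq]
  simpa using round_le x 0

lemma exists_coe_eq_abs_eq_norm (t : UnitAddCircle) :
    ∃ x : ℝ, (x : UnitAddCircle) = t ∧ |x| = ‖t‖ := by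
  obtain ⟨y, rfl⟩ := QuotientAddGroup.mk_surjective t
  refine ⟨y - round y, ?_, (UnitAddCircle.norm_eq (x := y)).symm⟩
  have h : ((round y : ℝ) : UnitAddCircle) = 0 := by
    rw [AddCircle.coe_eq_zero_iff]; exact ⟨round y, by simp⟩
  rw [AddCircle.coe_sub, h, sub_zero]

/-- The midpoint of `arc K j`. -/
def arcMid (K j : ℕ) : UnitAddCircle := ((((j : ℝ) + 1 / 2) / K : ℝ) : UnitAddCircle)

lemma arc_eq_closedBall {K : ℕ} (hK : 0 < K) (j : ℕ) :
    arc K j = Metric.closedBall (arcMid K j) (1 / (2 * K)) := by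
  have hK' : (0 : ℝ) < K := by exact_mod_cast hK
  ext t
  simp only [arc, mem_image, mem_Icc, Metric.mem_closedBall, dist_eq_norm, arcMid]
  constructor
  · rintro ⟨x, ⟨h1, h2⟩, rfl⟩
    rw [← AddCircle.coe_sub]
    refine (norm_coe_le _).trans ?_
    rw [div_le_iff₀ hK'] at h1
    rw [le_div_iff₀ hK'] at h2
    rw [abs_le, ← neg_div, div_le_iff₀ (by positivity), le_div_iff₀ (by positivity)]
    have e : (x - (j + 1 / 2) / K) * (2 * K) = 2 * (x * K) - (2 * j + 1) := by field_simp
    rw [e]; constructor <;> linarith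
  · intro h
    obtain ⟨x, hx, hx2⟩ := exists_coe_eq_abs_eq_norm (t - ((((j : ℝ) + 1 / 2) / K : ℝ) :
      UnitAddCircle))
    rw [← hx2, abs_le] at h
    refine ⟨x + (j + 1 / 2) / K, ⟨?_, ?_⟩, ?_⟩
    · have : (j : ℝ) / K = -(1 / (2 * K)) + (j + 1 / 2) / K := by field_simp; ring
      linarith [h.1]
    · have : ((j : ℝ) + 1) / K = 1 / (2 * K) + (j + 1 / 2) / K := by field_simp; ring
      linarith [h.2]
    · rw [AddCircle.coe_add, hx, sub_add_cancel]

lemma isCompact_arc (K j : ℕ) : IsCompact (arc K j) :=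
  isCompact_Icc.image (AddCircle.continuous_mk' 1)

lemma measurableSet_arc (K j : ℕ) : MeasurableSet (arc K j) := (isCompact_arc K j).measurableSet

lemma volume_real_arc {K : ℕ} (hK : 0 < K) (j : ℕ) : volume.real (arc K j) = 1 / K := by
  have hK' : (1 : ℝ) ≤ K := by exact_mod_cast hK
  rw [measureReal_def, arc_eq_closedBall hK, AddCircle.volume_closedBall, ENNReal.toReal_ofReal]
  · rw [min_eq_right]
    · field_simp
    · rw [mul_one_div, div_le_one (by positivity)]; linarith
  · positivity

/-- The half-open arc `[j/K, (j+1)/K)`. -/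
def arcIco (K j : ℕ) : Set UnitAddCircle :=
  {t | ⌊(K : ℝ) * (AddCircle.equivIco 1 0 t : ℝ)⌋₊ = j}

lemma equivIco_mem (t : UnitAddCircle) :
    0 ≤ (AddCircle.equivIco 1 0 t : ℝ) ∧ (AddCircle.equivIco 1 0 t : ℝ) < 1 := by
  have := (AddCircle.equivIco (1 : ℝ) 0 t).2
  simpa using this

lemma arcIco_subset {K : ℕ} (hK : 0 < K) (j : ℕ) : arcIco K j ⊆ arc K j := by
  intro t ht
  have hK' : (0 : ℝ) < K := by exact_mod_cast hK
  obtain ⟨h0, h1⟩ := equivIco_mem t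
  refine ⟨(AddCircle.equivIco 1 0 t : ℝ), ?_, AddCircle.coe_equivIco⟩
  rw [arcIco, mem_ofPred_eq, Nat.floor_eq_iff (by positivity)] at ht
  constructor
  · rw [div_le_iff₀ hK', mul_comm]; exact ht.1
  · rw [le_div_iff₀ hK', mul_comm]; exact ht.2.le

/-- The closed arcs overlap at endpoints. The half-open ones are level sets of a function, hence
disjoint, and only one point is lost. -/
lemma arc_ae_eq_arcIco {K : ℕ} (j : Fin K) : arc K j =ᵐ[volume] arcIco K j := by
  have hK : 0 < K := j.pos
  have hK' : (0 : ℝ) < K := by exact_mod_cast hK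
  refine ae_eq_set.2 ⟨?_, by rw [sdiff_eq_empty.2 (arcIco_subset hK j), measure_empty]⟩
  refine measure_mono_null (t := {((((j : ℝ) + 1) / K : ℝ) : UnitAddCircle)}) ?_
    (by rw [← Metric.closedBall_zero, AddCircle.volume_closedBall]; simp)
  rintro _ ⟨⟨x, ⟨h1, h2⟩, rfl⟩, hx⟩
  by_contra hne
  refine hx ?_
  have h3 : x < ((j : ℝ) + 1) / K := lt_of_le_of_ne h2 fun h => hne (by rw [h]; rfl)
  have h4 : x ∈ Ico (0 : ℝ) (0 + 1) := by
    refine ⟨le_trans (by positivity) h1, h3.trans_le ?_⟩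
    rw [zero_add, div_le_one hK']
    exact_mod_cast j.2
  rw [arcIco, mem_ofPred_eq, AddCircle.equivIco_coe_eq h4]
  have h0 : 0 ≤ x := h4.1
  rw [Nat.floor_eq_iff (by positivity)]
  rw [div_le_iff₀ hK'] at h1
  rw [lt_div_iff₀ hK'] at h3
  constructor <;> linarith

lemma aedisjoint_arc {K : ℕ} {i j : Fin K} (hij : i ≠ j) :
    AEDisjoint volume (arc K i) (arc K j) := by
  refine AEDisjoint.congr (Disjoint.aedisjoint ?_) (arc_ae_eq_arcIco i) (arc_ae_eq_arcIco j)
  rw [Set.disjoint_left]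
  intro t hi hj
  rw [arcIco, mem_ofPred_eq] at hi hj
  exact hij (Fin.ext (hi.symm.trans hj))

lemma iUnion_arc {K : ℕ} (hK : 0 < K) : ⋃ j : Fin K, arc K j = univ := by
  have hK' : (0 : ℝ) < K := by exact_mod_cast hK
  refine eq_univ_of_forall fun t => ?_
  obtain ⟨h0, h1⟩ := equivIco_mem t
  have h2 : ⌊(K : ℝ) * (AddCircle.equivIco 1 0 t : ℝ)⌋₊ < K := by
    rw [Nat.floor_lt (by positivity)]; nlinarith
  exact mem_iUnion.2 ⟨⟨_, h2⟩, arcIco_subset hK _ rfl⟩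

lemma aedisjoint_prod_arc {K : ℕ} {V V' : Set Torus} {i j : Fin K} (hij : i ≠ j) :
    AEDisjoint (volume : Measure ProjTM) (V ×ˢ arc K i) (V' ×ˢ arc K j) := by
  rw [AEDisjoint, prod_inter_prod]
  change ((volume : Measure Torus).prod volume) _ = 0
  rw [Measure.prod_prod, aedisjoint_arc hij, mul_zero]

lemma volume_real_prod_arc {K : ℕ} (hK : 0 < K) (V : Set Torus) (j : ℕ) :
    volume.real (V ×ˢ arc K j) = volume.real V / K := by
  change ((volume : Measure Torus).prod volume).real _ = _
  rw [measureReal_prod_prod, volume_real_arc hK, mul_one_div]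

lemma sum_setIntegral_univ_prod_arc {K : ℕ} (hK : 0 < K) {A : ProjTM → ℂ}
    (hA : Integrable A) : ∑ i : Fin K, ∫ x in univ ×ˢ arc K i, A x = ∫ x, A x := by
  have h := integral_iUnion_ae (μ := (volume : Measure ProjTM))
    (s := fun i : Fin K => (univ : Set Torus) ×ˢ arc K i) (f := A)
    (fun i => (MeasurableSet.univ.prod (measurableSet_arc K i)).nullMeasurableSet)
    (fun i j hij => aedisjoint_prod_arc hij) hA.integrableOn
  rw [← prod_iUnion, iUnion_arc hK, univ_prod_univ, setIntegral_univ, tsum_fintype] at h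
  exact h.symm

/-! ### Averaging along a line of large slope -/

lemma ptDist_eq (x y : ProjTM) :
    ptDist x y = Real.sqrt (‖x.1.1 - y.1.1‖ ^ 2 + ‖x.1.2 - y.1.2‖ ^ 2 + ‖x.2 - y.2‖ ^ 2) := rfl

/-- Moving `r` by at most `1 / b` realizes any horizontal shift of the line `(c + b r, r)`. The
integral along the line thus changes by at most `τ` under horizontal shifts, and averaging over the
shifts gives the integral over the torus. -/
lemma norm_integral_slope_sub_le {A : ProjTM → ℂ} {M τ κ : ℝ} (hA : Measurable A)
    (hM : ∀ x, ‖A x‖ ≤ M) (hτ : ∀ y y', ptDist y y' < κ → ‖A y - A y'‖ ≤ τ)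
    {b : ℕ} (hb : 0 < b) (hbκ : 1 / (b : ℝ) < κ) (c t : UnitAddCircle) :
    ‖(∫ r : UnitAddCircle, A ((c + b • r, r), t)) - ∫ p : Torus, A (p, t)‖ ≤ τ := by
  have hb' : (0 : ℝ) < b := by exact_mod_cast hb
  have hbm : Measurable fun r : UnitAddCircle => b • r := (continuous_nsmul b).measurable
  have hm : ∀ s : UnitAddCircle, Measurable fun r : UnitAddCircle => A ((c + b • r + s, r), t) :=
    fun s => hA.comp ((((hbm.const_add c).add_const s).prodMk measurable_id).prodMk
      measurable_const)
  have hint : ∀ s : UnitAddCircle, Integrable fun r : UnitAddCircle => A ((c + b • r + s, r), t) :=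
    fun s => Integrable.of_bound (hm s).aestronglyMeasurable M (Eventually.of_forall fun _ => hM _)
  have key : ∀ s : UnitAddCircle, ‖(∫ r : UnitAddCircle, A ((c + b • r, r), t))
      - ∫ r : UnitAddCircle, A ((c + b • r + s, r), t)‖ ≤ τ := by
    intro s
    obtain ⟨h0, h1⟩ := equivIco_mem s
    set x : ℝ := (AddCircle.equivIco 1 0 s : ℝ) with hx
    have hxs : (x : UnitAddCircle) = s := AddCircle.coe_equivIco
    -- A `b`-th part of the shift `s`; the representative of `s` in `[0, 1)` gives `‖u‖ ≤ 1 / b`.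
    set u : UnitAddCircle := ((x / b : ℝ) : UnitAddCircle) with hu
    have hbu : b • u = s := by
      rw [hu, ← AddCircle.coe_nsmul, nsmul_eq_mul, mul_div_cancel₀ _ hb'.ne', hxs]
    have hnu : ‖u‖ ≤ 1 / b := by
      refine (norm_coe_le _).trans ?_
      rw [abs_of_nonneg (by positivity)]
      gcongr
    have h2 : ∫ r : UnitAddCircle, A ((c + b • r, r), t)
        = ∫ r : UnitAddCircle, A ((c + b • (r + u), r + u), t) :=
      (integral_add_right_eq_self (fun r : UnitAddCircle => A ((c + b • r, r), t)) u).symm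
    have h3 : ∀ r : UnitAddCircle, A ((c + b • (r + u), r + u), t)
        = A ((c + b • r + s, r + u), t) := by
      intro r; rw [nsmul_add, hbu, add_assoc]
    simp only [h3] at h2
    have hm2 : Measurable fun r : UnitAddCircle => A ((c + b • r + s, r + u), t) :=
      hA.comp ((((hbm.const_add c).add_const s).prodMk (measurable_id.add_const u)).prodMk
        measurable_const)
    rw [h2, ← integral_sub (Integrable.of_bound hm2.aestronglyMeasurable M
      (Eventually.of_forall fun _ => hM _)) (hint s)]
    refine (norm_integral_le_of_norm_le_const (C := τ) (Eventually.of_forall fun r => ?_)).trans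
      (by rw [probReal_univ, mul_one])
    refine hτ _ _ ?_
    rw [ptDist_eq]
    simp only [sub_self, norm_zero, add_sub_cancel_left]
    rw [show ((0 : ℝ) ^ 2 + ‖u‖ ^ 2 + 0 ^ 2) = ‖u‖ ^ 2 by ring, Real.sqrt_sq (norm_nonneg _)]
    exact hnu.trans_lt hbκ
  have hm3 : Measurable fun p : UnitAddCircle × UnitAddCircle =>
      A ((c + b • p.2 + p.1, p.2), t) :=
    hA.comp (((((hbm.comp measurable_snd).const_add c).add measurable_fst).prodMk
      measurable_snd).prodMk measurable_const)
  have hi3 : Integrable (fun p : UnitAddCircle × UnitAddCircle => A ((c + b • p.2 + p.1, p.2), t))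
      ((volume : Measure UnitAddCircle).prod volume) :=
    Integrable.of_bound hm3.aestronglyMeasurable M (Eventually.of_forall fun _ => hM _)
  have hi4 : Integrable (fun p : UnitAddCircle × UnitAddCircle => A (p, t))
      ((volume : Measure UnitAddCircle).prod volume) :=
    Integrable.of_bound (hA.comp (measurable_id.prodMk measurable_const)).aestronglyMeasurable M
      (Eventually.of_forall fun _ => hM _)
  have hF : ∫ p : Torus, A (p, t)
      = ∫ s : UnitAddCircle, ∫ r : UnitAddCircle, A ((c + b • r + s, r), t) := by
    change ∫ p : Torus, A (p, t) ∂((volume : Measure UnitAddCircle).prod volume) = _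
    rw [integral_prod_symm _ hi4, integral_integral_swap (f := fun s r : UnitAddCircle =>
      A ((c + b • r + s, r), t)) hi3]
    congr 1
    funext r
    exact (integral_add_left_eq_self (fun s => A ((s, r), t)) (c + b • r)).symm
  have hconst : ∫ r : UnitAddCircle, A ((c + b • r, r), t)
      = ∫ _ : UnitAddCircle, ∫ r : UnitAddCircle, A ((c + b • r, r), t) := by
    simp
  rw [hF, hconst, ← integral_sub (integrable_const _) hi3.integral_prod_left]
  exact (norm_integral_le_of_norm_le_const (C := τ) (Eventually.of_forall key)).trans
      (by rw [probReal_univ, mul_one])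

/-! ### Uniform distribution of a piece -/

/-- The image of area on `V` under `ρ` and the multiple `volume.real V` of Lebesgue measure share
the minorant `volume.real V * (1 - ε)` times Lebesgue measure on `J`. Each exceeds it by mass at
most `volume.real V * (ε + δ)`. -/
lemma norm_setIntegral_comp_sub_le {V : Set Torus} {ρ : Torus → UnitAddCircle}
    (hρ : Measurable ρ) {J : Set UnitAddCircle} (hJ : MeasurableSet J) {δ ε : ℝ}
    (hδ : 1 - δ ≤ volume.real J) (hJ0 : 0 < volume.real J) (hε : ε ≤ 1)
    (hε0 : 0 ≤ ε) (hV0 : 0 < volume.real V)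
    (hdist : ∀ J' ⊆ J, MeasurableSet J' →
      |volume.real (V ∩ ρ ⁻¹' J') / volume.real V - volume.real J' / volume.real J|
        ≤ ε * (volume.real J' / volume.real J))
    {F : UnitAddCircle → ℂ} {M : ℝ} (hF : Measurable F) (hM : ∀ x, ‖F x‖ ≤ M) :
    ‖(∫ x in V, F (ρ x)) - volume.real V * ∫ r, F r‖ ≤ 2 * M * volume.real V * (ε + δ) := by
  set v := volume.real V with hv
  have hM0 : 0 ≤ M := (norm_nonneg _).trans (hM 0)
  have hJ1 : volume.real J ≤ 1 := measureReal_le_one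
  set κ : Measure UnitAddCircle := ENNReal.ofReal (v * (1 - ε)) • volume.restrict J with hκ
  set μ₁ : Measure UnitAddCircle := Measure.map ρ (volume.restrict V) with hμ₁
  set μ₂ : Measure UnitAddCircle := ENNReal.ofReal v • volume with hμ₂
  have : IsFiniteMeasure μ₂ := by rw [hμ₂]; exact Measure.smul_finite _ ENNReal.ofReal_ne_top
  have hκA : ∀ A, MeasurableSet A →
      κ A = ENNReal.ofReal (v * (1 - ε) * volume.real (A ∩ J)) := by
    intro A hA
    rw [hκ, Measure.smul_apply, Measure.restrict_apply hA, smul_eq_mul,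
      ENNReal.ofReal_mul (p := v * (1 - ε)) (by nlinarith), ofReal_measureReal]
  have h1 : κ ≤ μ₁ := by
    refine Measure.le_iff.2 fun A hA => ?_
    rw [hκA A hA, hμ₁, Measure.map_apply hρ hA, Measure.restrict_apply (hρ hA)]
    have h2 := (abs_le.1 (hdist (A ∩ J) inter_subset_right (hA.inter hJ))).1
    have h3 : (1 - ε) * (volume.real (A ∩ J) / volume.real J)
        ≤ volume.real (V ∩ ρ ⁻¹' (A ∩ J)) / v := by linarith
    have h4 : volume.real (A ∩ J) ≤ volume.real (A ∩ J) / volume.real J := by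
      rw [le_div_iff₀ hJ0]
      exact mul_le_of_le_one_right measureReal_nonneg hJ1
    rw [le_div_iff₀ hV0] at h3
    have h5 : v * (1 - ε) * volume.real (A ∩ J) ≤ volume.real (V ∩ ρ ⁻¹' (A ∩ J)) := by
      refine le_trans ?_ h3
      have : (1 - ε) * volume.real (A ∩ J) ≤ (1 - ε) * (volume.real (A ∩ J) / volume.real J) :=
        mul_le_mul_of_nonneg_left h4 (by linarith)
      nlinarith
    refine (ENNReal.ofReal_le_ofReal h5).trans ?_
    rw [ofReal_measureReal]
    exact measure_mono fun x hx => ⟨hx.2.1, hx.1⟩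
  have h2 : κ ≤ μ₂ := by
    refine Measure.le_iff.2 fun A hA => ?_
    rw [hκA A hA, hμ₂, Measure.smul_apply, smul_eq_mul,
      ENNReal.ofReal_mul (p := v * (1 - ε)) (by nlinarith), ofReal_measureReal]
    exact mul_le_mul' (ENNReal.ofReal_le_ofReal (by nlinarith)) (measure_mono inter_subset_left)
  have e1 := norm_integral_sub_le_of_le h1 hF hM
  have e2 := norm_integral_sub_le_of_le h2 hF hM
  have hk : κ.real univ = v * (1 - ε) * volume.real J := by
    rw [measureReal_def, hκA _ MeasurableSet.univ, univ_inter, ENNReal.toReal_ofReal]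
    exact mul_nonneg (by nlinarith) hJ0.le
  have m1 : μ₁.real univ = v := by
    rw [hμ₁, measureReal_def, Measure.map_apply hρ MeasurableSet.univ, preimage_univ,
      Measure.restrict_apply_univ, ← measureReal_def]
  have m2 : μ₂.real univ = v := by
    rw [hμ₂, measureReal_def, Measure.smul_apply, measure_univ, smul_eq_mul, mul_one,
      ENNReal.toReal_ofReal hV0.le]
  have i1 : ∫ x, F x ∂μ₁ = ∫ x in V, F (ρ x) := by
    rw [hμ₁, integral_map hρ.aemeasurable hF.aestronglyMeasurable]
  have i2 : ∫ x, F x ∂μ₂ = v * ∫ r, F r := by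
    rw [hμ₂, integral_smul_measure, ENNReal.toReal_ofReal hV0.le, Complex.real_smul]
  rw [i1, m1, hk] at e1
  rw [i2, m2, hk] at e2
  rw [norm_sub_rev] at e2
  refine (norm_sub_le_norm_sub_add_norm_sub _ (∫ x, F x ∂κ) _).trans ((add_le_add e1 e2).trans ?_)
  have h6 : v - v * (1 - ε) * volume.real J ≤ v * (ε + δ) := by
    have : (1 - ε) * (1 - volume.real J) ≤ δ := by nlinarith
    nlinarith
  nlinarith

end shear

/-! ### Uniform distribution of the elements of a decomposition -/

lemma integrable_of_forall_norm_le {X : Type*} [MeasurableSpace X] {μ : Measure X} [IsFiniteMeasure μ]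
    {A : X → ℂ} {M : ℝ} (hA : Measurable A) (hM : ∀ x, ‖A x‖ ≤ M) : Integrable A μ :=
  Integrable.of_bound hA.aestronglyMeasurable M (Eventually.of_forall hM)

lemma norm_setIntegral_sub_le_of_norm_sub_le {X : Type*} [MeasurableSpace X] {μ : Measure X}
    [IsFiniteMeasure μ] {F G : X → ℂ} {M τ : ℝ} (hF : Measurable F) (hG : Measurable G)
    (hFM : ∀ x, ‖F x‖ ≤ M) (hGM : ∀ x, ‖G x‖ ≤ M) {s : Set X} (h : ∀ x ∈ s, ‖F x - G x‖ ≤ τ) :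
    ‖(∫ x in s, F x ∂μ) - ∫ x in s, G x ∂μ‖ ≤ τ * μ.real s := by
  rw [← integral_sub (integrable_of_forall_norm_le hF hFM) (integrable_of_forall_norm_le hG hGM)]
  exact norm_setIntegral_le_of_norm_le_const (measure_lt_top _ _) h

/-- `2 ^ 2 + (3 / 2) ^ 2 = (5 / 2) ^ 2`, which is below `3 ^ 2`. This is why oscillation is
controlled at scale `3 / K`. -/
lemma ptDist_lt_of_le {K : ℕ} (hK : 0 < K) {θ θ' r t t' : UnitAddCircle}
    (h1 : ‖θ - θ'‖ ≤ 2 / K) (h2 : ‖t - t'‖ ≤ 3 / (2 * K)) :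
    ptDist ((θ, r), t) ((θ', r), t') < 3 / K := by
  have hK' : (0 : ℝ) < K := by exact_mod_cast hK
  rw [ptDist_eq, Real.sqrt_lt' (by positivity)]
  simp only [sub_self, norm_zero]
  have a1 : ‖θ - θ'‖ ^ 2 ≤ (2 / K) ^ 2 := by gcongr
  have a2 : ‖t - t'‖ ^ 2 ≤ (3 / (2 * K)) ^ 2 := by gcongr
  have a3 : ((3 : ℝ) / K) ^ 2 - (2 / K) ^ 2 - (3 / (2 * K)) ^ 2 = 11 / (4 * K ^ 2) := by
    field_simp; ring
  have a4 : (0 : ℝ) < 11 / (4 * K ^ 2) := by positivity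
  linarith

/-- The piece `V` with the lines of `arc K j` is carried near the line `(c + b r, r)` with fiber
coordinate near the midpoint of `arc K i`. It is uniformly distributed in `r`, so it averages `A`
over `univ × arc K i`. Three replacements cost `τ` each: the image by the line, the line by the
torus, and the midpoint by the arc. `X` collects the exceptional base points. -/
lemma norm_setIntegral_piece_sub_le {A : ProjTM → ℂ} {M τ : ℝ} {K b : ℕ} (hK : 0 < K)
    (hA : Measurable A) (hM : ∀ x, ‖A x‖ ≤ M)
    (hτ : ∀ y y', ptDist y y' < 3 / K → ‖A y - A y'‖ ≤ τ) (hb : 0 < b)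
    (hbK : 1 / (b : ℝ) < 3 / K) {Ψ : ProjTM → ProjTM} (hΨ : Measurable Ψ)
    {ρ β : Torus → UnitAddCircle} (hρ : Measurable ρ) (hβ : Measurable β)
    {V X : Set Torus} (hV : MeasurableSet V) (hX : MeasurableSet X) (hV0 : 0 < volume.real V)
    {c : UnitAddCircle} (hΨV : ∀ x ∈ V, x ∉ X → ∀ t, ∃ θ : UnitAddCircle,
      Ψ (x, t) = ((θ, ρ x), t + β x) ∧ ‖θ - (c + b • ρ x)‖ ≤ 2 / K)
    {i j : ℕ} {S : Set Torus} {δ ε : ℝ}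
    (hS : ∀ x ∈ S, x ∈ V ∧ (x ∈ X ∨ ∃ t ∈ arc K j, t + β x ∈ arc K i))
    (hSV : volume.real V * (1 - ε) ≤ volume.real S)
    {J : Set UnitAddCircle} (hJ : MeasurableSet J) (hδ : 1 - δ ≤ volume.real J)
    (hJ0 : 0 < volume.real J) (hε : ε ≤ 1) (hε0 : 0 ≤ ε)
    (hdist : ∀ J' ⊆ J, MeasurableSet J' →
      |volume.real (V ∩ ρ ⁻¹' J') / volume.real V - volume.real J' / volume.real J|
        ≤ ε * (volume.real J' / volume.real J)) :
    ‖(∫ z in V ×ˢ arc K j, A (Ψ z)) - volume.real V * ∫ z in univ ×ˢ arc K i, A z‖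
      ≤ volume.real V / K * (3 * τ + 2 * M * (2 * ε + δ)) + 2 * M / K * volume.real (V ∩ X) := by
  have hK' : (0 : ℝ) < K := by exact_mod_cast hK
  have hM0 : 0 ≤ M := (norm_nonneg _).trans (hM ((0, 0), 0))
  set v := volume.real V with hv
  set t₀ := arcMid K i with ht₀
  have hbm : Measurable fun r : UnitAddCircle => b • r := (continuous_nsmul b).measurable
  set F : UnitAddCircle → ℂ := fun r => A ((c + b • r, r), t₀) with hF
  have hFm : Measurable F :=
    hA.comp (((hbm.const_add c).prodMk measurable_id).prodMk measurable_const)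
  have hFM : ∀ r, ‖F r‖ ≤ M := fun r => hM _
  have hFρ : Measurable fun z : ProjTM => F (ρ z.1) := hFm.comp (hρ.comp measurable_fst)
  have hAΨ : Measurable fun z : ProjTM => A (Ψ z) := hA.comp hΨ
  -- Good points of `V` whose fiber translation `β` takes at least one line of `arc K j` into `arc K
  -- i`, written through the compact difference set to make measurability evident.
  set W : Set Torus := (V \ X) ∩ β ⁻¹' ((fun p : UnitAddCircle × UnitAddCircle => p.1 - p.2) ''
    (arc K i ×ˢ arc K j)) with hW
  have hWm : MeasurableSet W := (hV.diff hX).inter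
    (hβ (((isCompact_arc K i).prod (isCompact_arc K j)).image
      (by fun_prop)).measurableSet)
  have hWV : W ⊆ V := fun x hx => hx.1.1
  have hsub : S ⊆ W ∪ (V ∩ X) := by
    intro x hx
    obtain ⟨hxV, h⟩ := hS x hx
    by_cases hxX : x ∈ X
    · exact Or.inr ⟨hxV, hxX⟩
    · obtain ⟨t, ht, hti⟩ := h.resolve_left hxX
      refine Or.inl ⟨⟨hxV, hxX⟩, ?_⟩
      exact ⟨(t + β x, t), ⟨hti, ht⟩, by simp⟩
  have hVW : volume.real (V \ W) ≤ ε * v + volume.real (V ∩ X) := by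
    have h1 : volume.real S ≤ volume.real W + volume.real (V ∩ X) :=
      (measureReal_mono hsub).trans (measureReal_union_le _ _)
    rw [measureReal_sdiff hWV hWm]
    linarith
  have hWpt : ∀ z ∈ W ×ˢ arc K j, ‖A (Ψ z) - F (ρ z.1)‖ ≤ τ := by
    rintro ⟨x, t⟩ ⟨⟨⟨hxV, hxX⟩, ⟨s, t₁⟩, ⟨hs, ht₁⟩, hst⟩, ht⟩
    obtain ⟨θ, hθ, hθ2⟩ := hΨV x hxV hxX t
    rw [hθ]
    refine hτ _ _ (ptDist_lt_of_le hK hθ2 ?_)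
    rw [arc_eq_closedBall hK, Metric.mem_closedBall] at hs ht₁ ht
    -- One line `t₁` landing in the target arc controls every `t` in the source arc: three
    -- half-lengths `1 / (2 * K)` add up to the `3 / (2 * K)` of `ptDist_lt_of_le`.
    have e1 : t + β x - t₀ = (t - arcMid K j) - (t₁ - arcMid K j) + (s - t₀) := by
      simp only at hst
      rw [← hst]; abel
    rw [e1]
    refine (norm_add_le _ _).trans ((add_le_add_left (norm_sub_le _ _) _).trans ?_)
    rw [← dist_eq_norm, ← dist_eq_norm, ← dist_eq_norm]
    have e2 : (3 : ℝ) / (2 * K) = 1 / (2 * K) + 1 / (2 * K) + 1 / (2 * K) := by ring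
    rw [e2]
    exact add_le_add (add_le_add ht ht₁) hs
  have s1 : ‖(∫ z in V ×ˢ arc K j, A (Ψ z)) - ∫ z in V ×ˢ arc K j, F (ρ z.1)‖
      ≤ τ * (v / K) + 2 * M * (volume.real (V \ W) / K) := by
    have hun : V ×ˢ arc K j = W ×ˢ arc K j ∪ (V \ W) ×ˢ arc K j := by
      rw [← union_prod, union_sdiff_cancel hWV]
    have hdj : Disjoint (W ×ˢ arc K j) ((V \ W) ×ˢ arc K j) :=
      Disjoint.set_prod_left disjoint_sdiff_right _ _
    have hdm : MeasurableSet ((V \ W) ×ˢ arc K j) :=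
      (hV.diff hWm).prod (measurableSet_arc K j)
    rw [hun, setIntegral_union hdj hdm (integrable_of_forall_norm_le hAΨ fun _ => hM _)
      (integrable_of_forall_norm_le hAΨ fun _ => hM _), setIntegral_union hdj hdm
      (integrable_of_forall_norm_le hFρ fun _ => hM _) (integrable_of_forall_norm_le hFρ fun _ => hM _),
      add_sub_add_comm]
    refine (norm_add_le _ _).trans (add_le_add ?_ ?_)
    · refine (norm_setIntegral_sub_le_of_norm_sub_le hAΨ hFρ (fun _ => hM _) (fun _ => hM _)
        hWpt).trans ?_
      rw [volume_real_prod_arc hK]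
      have hτ0 : 0 ≤ τ := (norm_nonneg _).trans (hτ ((0, 0), 0) ((0, 0), 0) (by
        rw [ptDist_eq]; simp [hK]))
      have : volume.real W ≤ v := measureReal_mono hWV
      gcongr
    · refine (norm_setIntegral_sub_le_of_norm_sub_le hAΨ hFρ (fun _ => hM _) (fun _ => hM _)
        (τ := 2 * M) fun z _ => ?_).trans ?_
      · refine (norm_sub_le _ _).trans ?_
        have h1 := hM (Ψ z)
        have h2 := hFM (ρ z.1)
        linarith
      · rw [volume_real_prod_arc hK]
  have s2 : (∫ z in V ×ˢ arc K j, F (ρ z.1)) = (∫ x in V, F (ρ x)) * (1 / K : ℝ) := by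
    have h := setIntegral_prod_mul (μ := (volume : Measure Torus))
      (ν := (volume : Measure UnitAddCircle)) (fun x => F (ρ x)) (fun _ => (1 : ℂ)) V (arc K j)
    simp only [mul_one] at h
    refine h.trans ?_
    rw [setIntegral_const, volume_real_arc hK]
    simp
  have s3 := norm_setIntegral_comp_sub_le hρ hJ hδ hJ0 hε hε0 hV0 hdist hFm hFM
  have s4 := norm_integral_slope_sub_le hA hM hτ hb hbK c t₀
  have hA₀ : Measurable fun z : ProjTM => A (z.1, t₀) :=
    hA.comp (measurable_fst.prodMk measurable_const)
  have s5 : ‖(∫ z in univ ×ˢ arc K i, A (z.1, t₀)) - ∫ z in univ ×ˢ arc K i, A z‖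
      ≤ τ * (1 / K) := by
    refine (norm_setIntegral_sub_le_of_norm_sub_le hA₀ hA (fun _ => hM _) (fun _ => hM _)
      (τ := τ) ?_).trans ?_
    · rintro ⟨x, t⟩ ⟨-, ht⟩
      rw [arc_eq_closedBall hK, Metric.mem_closedBall] at ht
      refine hτ _ _ (ptDist_lt_of_le hK (by simp; positivity) ?_)
      rw [norm_sub_rev, ← dist_eq_norm]
      refine ht.trans ?_
      gcongr; norm_num
    · rw [volume_real_prod_arc hK, probReal_univ]
  have s6 : (∫ z in univ ×ˢ arc K i, A (z.1, t₀)) = (∫ x : Torus, A (x, t₀)) * (1 / K : ℝ) := by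
    have h := setIntegral_prod_mul (μ := (volume : Measure Torus))
      (ν := (volume : Measure UnitAddCircle)) (fun x => A (x, t₀)) (fun _ => (1 : ℂ)) univ (arc K i)
    simp only [mul_one] at h
    refine h.trans ?_
    rw [setIntegral_univ, setIntegral_const, volume_real_arc hK]
    simp
  have hdec : (∫ z in V ×ˢ arc K j, A (Ψ z)) - v * ∫ z in univ ×ˢ arc K i, A z
      = ((∫ z in V ×ˢ arc K j, A (Ψ z)) - ∫ z in V ×ˢ arc K j, F (ρ z.1))
        + (1 / K : ℝ) * ((∫ x in V, F (ρ x)) - v * ∫ r, F r)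
        + (v / K : ℝ) * ((∫ r, F r) - ∫ p : Torus, A (p, t₀))
        + (v : ℂ) * ((∫ z in univ ×ˢ arc K i, A (z.1, t₀)) - ∫ z in univ ×ˢ arc K i, A z) := by
    rw [s2, s6]; push_cast; ring
  have n2 : ‖((1 / K : ℝ) : ℂ) * ((∫ x in V, F (ρ x)) - v * ∫ r, F r)‖
      ≤ (1 / K) * (2 * M * v * (ε + δ)) := by
    rw [norm_mul, Complex.norm_real, Real.norm_of_nonneg (by positivity)]
    gcongr
  have n3 : ‖((v / K : ℝ) : ℂ) * ((∫ r, F r) - ∫ p : Torus, A (p, t₀))‖ ≤ (v / K) * τ := by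
    rw [norm_mul, Complex.norm_real, Real.norm_of_nonneg (by positivity)]
    gcongr
  have n4 : ‖(v : ℂ) * ((∫ z in univ ×ˢ arc K i, A (z.1, t₀)) - ∫ z in univ ×ˢ arc K i, A z)‖
      ≤ v * (τ * (1 / K)) := by
    rw [norm_mul, Complex.norm_real, Real.norm_of_nonneg hV0.le]
    gcongr
  rw [hdec]
  refine (norm_add_le _ _).trans ((add_le_add ((norm_add_le _ _).trans (add_le_add
    ((norm_add_le _ _).trans (add_le_add s1 n2)) n3)) n4).trans ?_)
  have h7 : 2 * M * (volume.real (V \ W) / K) ≤ 2 * M * ((ε * v + volume.real (V ∩ X)) / K) := by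
    gcongr
  refine (add_le_add (add_le_add (add_le_add (add_le_add le_rfl h7) le_rfl) le_rfl) le_rfl).trans
    (le_of_eq ?_)
  field_simp
  ring

/-- An estimate on the pieces of an element that is uniform in the arc of lines yields an estimate
on the element. -/
lemma norm_setIntegral_element_sub_le {A B : ProjTM → ℂ} {M C D v : ℝ} {K : ℕ}
    (hA : Measurable A) (hM : ∀ x, ‖A x‖ ≤ M) (hB : Measurable B) (hBM : ∀ x, ‖B x‖ ≤ M)
    {I : Fin K → Set Torus} (hI : ∀ l, MeasurableSet (I l))
    (hdisj : ∀ l l', l ≠ l' → Disjoint (I l) (I l')) (hv : ∀ l, volume.real (I l) = v)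
    {X : Set Torus} (hX : MeasurableSet X) (j : Fin K)
    (h : ∀ l : Fin K, ‖(∫ z in I l ×ˢ arc K j, B z)
      - volume.real (I l) * ∫ z in univ ×ˢ arc K ((l + j : Fin K) : ℕ), A z‖
      ≤ volume.real (I l) / K * C + D / K * volume.real (I l ∩ X)) :
    ‖∫ z in (⋃ l, I l) ×ˢ arc K j, (B z - ∫ y, A y)‖
      ≤ C * volume.real ((⋃ l, I l) ×ˢ arc K j)
        + D * volume.real (((⋃ l, I l) ×ˢ arc K j) ∩ (X ×ˢ univ)) := by
  have hK : 0 < K := j.pos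
  have : NeZero K := ⟨hK.ne'⟩
  have hBi : Integrable B := integrable_of_forall_norm_le hB hBM
  have hU : volume.real (⋃ l, I l) = ∑ l, volume.real (I l) :=
    measureReal_iUnion_fintype (fun l l' hl => hdisj l l' hl) hI
  have hUX : volume.real ((⋃ l, I l) ∩ X) = ∑ l, volume.real (I l ∩ X) := by
    rw [iUnion_inter]
    exact measureReal_iUnion_fintype
      (fun l l' hl => (hdisj l l' hl).mono inter_subset_left inter_subset_left)
      (fun l => (hI l).inter hX)
  have hint : (∫ z in (⋃ l, I l) ×ˢ arc K j, B z) = ∑ l, ∫ z in I l ×ˢ arc K j, B z := by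
    rw [iUnion_prod_const, integral_iUnion_fintype
      (fun l => (hI l).prod (measurableSet_arc K j))
      (fun l l' hl => Disjoint.set_prod_left (hdisj l l' hl) _ _) (fun l => hBi.integrableOn)]
  have hsum : ∑ l : Fin K, (volume.real (I l) : ℂ) *
      ∫ z in univ ×ˢ arc K ((l + j : Fin K) : ℕ), A z = v * ∫ y, A y := by
    simp only [hv]
    rw [← Finset.mul_sum, ← sum_setIntegral_univ_prod_arc hK (integrable_of_forall_norm_le hA hM)]
    congr 1
    -- Addition in `Fin K` is modulo `K`, so `l ↦ l + j` is a permutation and every target arc is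
    -- hit exactly once.
    exact Equiv.sum_comp (Equiv.addRight j) (fun i : Fin K => ∫ z in univ ×ˢ arc K (i : ℕ), A z)
  -- `K` pieces of area `v` times an arc of length `1 / K`.
  have hvol : volume.real ((⋃ l, I l) ×ˢ arc K j) = v := by
    rw [volume_real_prod_arc hK, hU]
    simp only [hv, Finset.sum_const, Finset.card_univ, Fintype.card_fin, nsmul_eq_mul]
    have hK' : (K : ℝ) ≠ 0 := by exact_mod_cast hK.ne'
    field_simp
  have hvolX : volume.real (((⋃ l, I l) ×ˢ arc K j) ∩ (X ×ˢ univ))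
      = volume.real ((⋃ l, I l) ∩ X) / K := by
    rw [prod_inter_prod, inter_univ, volume_real_prod_arc hK]
  rw [integral_sub hBi.integrableOn (integrable_const _), setIntegral_const, hvol, hvolX, hUX, hint,
    Complex.real_smul, ← hsum, ← Finset.sum_sub_distrib]
  refine (norm_sum_le _ _).trans ((Finset.sum_le_sum fun l _ => h l).trans (le_of_eq ?_))
  rw [Finset.sum_add_distrib, ← Finset.sum_mul, ← Finset.mul_sum, ← Finset.sum_div, ← hU,
    ← volume_real_prod_arc hK _ j, hvol]
  ring

lemma norm_setIntegral_iUnion_le {ι : Type*} [Finite ι] {f : ProjTM → ℂ}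
    (hf : Integrable f) {C D : ℝ} (hC : 0 ≤ C) (hD : 0 ≤ D) {E : ι → Set ProjTM}
    (hE : ∀ i, MeasurableSet (E i))
    (hdisj : Pairwise (Function.onFun (AEDisjoint volume) E)) {Y : Set ProjTM}
    (hY : MeasurableSet Y)
    (h : ∀ i, ‖∫ z in E i, f z‖ ≤ C * volume.real (E i) + D * volume.real (E i ∩ Y)) :
    ‖∫ z in ⋃ i, E i, f z‖ ≤ C + D * volume.real Y := by
  have := Fintype.ofFinite ι
  rw [integral_iUnion_ae (fun i => (hE i).nullMeasurableSet) hdisj hf.integrableOn, tsum_fintype]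
  refine (norm_sum_le _ _).trans ((Finset.sum_le_sum fun i _ => h i).trans ?_)
  rw [Finset.sum_add_distrib, ← Finset.mul_sum, ← Finset.mul_sum]
  have h1 : ∀ E' : ι → Set ProjTM, (∀ i, MeasurableSet (E' i)) →
      Pairwise (Function.onFun (AEDisjoint volume) E') →
      ∑ i, volume.real (E' i) = volume.real (⋃ i, E' i) := by
    intro E' hm hd
    rw [measureReal_def, measure_iUnion₀ hd (fun i => (hm i).nullMeasurableSet), tsum_fintype,
      ENNReal.toReal_sum (fun i _ => measure_ne_top _ _)]
    rfl
  rw [h1 E hE hdisj, h1 (fun i => E i ∩ Y) (fun i => (hE i).inter hY)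
    (fun i j hij => (hdisj hij).mono inter_subset_left inter_subset_left)]
  refine add_le_add (mul_le_of_le_one_right hC measureReal_le_one) ?_
  refine mul_le_mul_of_nonneg_left (measureReal_mono ?_) hD
  exact iUnion_subset fun i => inter_subset_right

/-! ### Rotational differentials -/

lemma isClosed_specialOrthogonalGroup :
    IsClosed (Matrix.specialOrthogonalGroup (Fin 2) ℝ : Set (Matrix (Fin 2) (Fin 2) ℝ)) := by
  have h : (Matrix.specialOrthogonalGroup (Fin 2) ℝ : Set (Matrix (Fin 2) (Fin 2) ℝ))
      = {A | A * A.transpose = 1} ∩ {A | A.det = 1} := by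
    ext A
    simp only [SetLike.mem_coe, Matrix.mem_specialOrthogonalGroup_iff,
      Matrix.mem_orthogonalGroup_iff]
    rfl
  rw [h]
  exact (isClosed_eq (by fun_prop) continuous_const).inter
    (isClosed_eq (by fun_prop) continuous_const)

lemma transpose_mem_specialOrthogonalGroup {A : Matrix (Fin 2) (Fin 2) ℝ}
    (hA : A ∈ Matrix.specialOrthogonalGroup (Fin 2) ℝ) :
    A.transpose ∈ Matrix.specialOrthogonalGroup (Fin 2) ℝ := by
  rw [Matrix.mem_specialOrthogonalGroup_iff, Matrix.mem_orthogonalGroup_iff] at *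
  rw [Matrix.transpose_transpose, Matrix.det_transpose]
  exact ⟨mul_eq_one_comm.1 hA.1, hA.2⟩

lemma jacobian_inv_mem_specialOrthogonalGroup {F : Equiv.Perm Torus} (hF : IsSmoothDiffeo F)
    {y : Torus} (h : jacobian F y ∈ Matrix.specialOrthogonalGroup (Fin 2) ℝ) :
    jacobian (F⁻¹ : Equiv.Perm Torus) (F y) ∈ Matrix.specialOrthogonalGroup (Fin 2) ℝ := by
  have h1 := (Matrix.mem_orthogonalGroup_iff _ _).1 (Matrix.mem_specialOrthogonalGroup_iff.1 h).1
  have h2 : jacobian (F⁻¹ : Equiv.Perm Torus) (F y) = (jacobian F y).transpose := by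
    calc _ = jacobian (F⁻¹ : Equiv.Perm Torus) (F y) *
          (jacobian F y * (jacobian F y).transpose) := by rw [h1, mul_one]
      _ = _ := by rw [← mul_assoc, jacobian_inv_mul hF, one_mul]
  rw [h2]
  exact transpose_mem_specialOrthogonalGroup h

/-- The points at which the differential of `F` is not a rotation or that `F` maps outside `D`. -/
def badSet (F : Equiv.Perm Torus) (D : Set Torus) : Set Torus :=
  {x | jacobian F x ∉ Matrix.specialOrthogonalGroup (Fin 2) ℝ ∨ F x ∉ D}

lemma measurableSet_badSet {F : Equiv.Perm Torus} (hF : IsSmoothDiffeo F) {D : Set Torus}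
    (hD : MeasurableSet D) : MeasurableSet (badSet F D) :=
  (isClosed_specialOrthogonalGroup.preimage hF.continuous_jacobian).measurableSet.compl.union
    (hF.continuous.measurable hD).compl

lemma IsAreaPreservingDiffeo.real_preimage {F : Equiv.Perm Torus} (hF : IsAreaPreservingDiffeo F)
    {Z : Set Torus} (hZ : MeasurableSet Z) : volume.real (F ⁻¹' Z) = volume.real Z := by
  rw [measureReal_def, hF.2.measure_preimage hZ.nullMeasurableSet, measureReal_def]

/-- The differential of `φ` is a rotation off a set of measure at most twice that of `Uᶜ`: if `g (φ
y)` lies in the good domain then so does `φ y`, where `dg = 1` and `dφ = d(g ∘ φ)`. In `φ ∘ R ∘ φ⁻¹`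
this set is met twice, and `Uᶜ` once more through the image, which makes five. -/
lemma volume_real_badSet_le {a b q : ℕ} {ε : ℝ} {g φ : Equiv.Perm Torus}
    (hg : IsAreaPreservingDiffeo g) (hφ : IsAreaPreservingDiffeo φ) (h : IsStepShear a b q ε g)
    (ha : 0 < a) (hε : ε < 1 / 4) {U : Set Torus} (hU : MeasurableSet U)
    (hUg : U ⊆ goodDomain a ε)
    (hUrot : ∀ x ∈ U, jacobian (g * φ : Equiv.Perm Torus) x ∈
      Matrix.specialOrthogonalGroup (Fin 2) ℝ) (t : UnitAddCircle) :
    volume.real (badSet (φ * rot t * φ⁻¹) (goodDomain a ε)) ≤ 5 * volume.real Uᶜ := by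
  set D : Set Torus := jacobian φ ⁻¹' Matrix.specialOrthogonalGroup (Fin 2) ℝ with hD
  have hDm : MeasurableSet D :=
    (isClosed_specialOrthogonalGroup.preimage hφ.1.continuous_jacobian).measurableSet
  have hDc : volume.real Dᶜ ≤ 2 * volume.real Uᶜ := by
    have hsub : Dᶜ ⊆ Uᶜ ∪ (g * φ : Equiv.Perm Torus) ⁻¹' Uᶜ := by
      intro y hy
      by_contra hcon
      simp only [mem_union, mem_compl_iff, mem_preimage, not_or, not_not] at hcon
      refine hy ?_
      have h1 : φ y ∈ goodDomain a ε := by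
        have := h.inv_mem_goodDomain (hUg hcon.2)
        rwa [Equiv.Perm.mul_apply, Equiv.symm_apply_apply] at this
      have h2 := hUrot y hcon.1
      rw [jacobian_mul hg.1 hφ.1, h.jacobian_eq_one hg.1 ha hε h1, one_mul] at h2
      exact h2
    refine (measureReal_mono hsub).trans ((measureReal_union_le _ _).trans ?_)
    rw [(hg.mul hφ).real_preimage hU.compl]
    linarith
  have hR := isAreaPreservingDiffeo_rot t
  have hsub : badSet (φ * rot t * φ⁻¹) (goodDomain a ε) ⊆
      ((φ⁻¹ : Equiv.Perm Torus) ⁻¹' Dᶜ ∪ (rot t * φ⁻¹ : Equiv.Perm Torus) ⁻¹' Dᶜ)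
        ∪ (φ * rot t * φ⁻¹ : Equiv.Perm Torus) ⁻¹' Uᶜ := by
    intro x hx
    by_contra hcon
    simp only [mem_union, mem_compl_iff, mem_preimage, not_or, not_not] at hcon
    obtain ⟨⟨h1, h2⟩, h3⟩ := hcon
    refine hx.elim (fun hx => hx ?_) fun hx => hx (hUg h3)
    rw [mul_assoc, jacobian_mul hφ.1 (hR.1.mul hφ.1.inv), jacobian_mul hR.1 hφ.1.inv,
      jacobian_rot, one_mul]
    refine mul_mem h2 ?_
    have h4 := jacobian_inv_mem_specialOrthogonalGroup hφ.1 h1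
    rwa [show φ ((φ⁻¹ : Equiv.Perm Torus) x) = x from φ.apply_symm_apply x] at h4
  refine (measureReal_mono hsub).trans ((measureReal_union_le _ _).trans
    ((add_le_add_left (measureReal_union_le _ _) _).trans ?_))
  rw [hφ.inv.real_preimage hDm.compl, (hR.mul hφ.inv).real_preimage hDm.compl,
    ((hφ.mul hR).mul hφ.inv).real_preimage hU.compl]
  linarith

/-! ### Distribution of unions of elements -/

/-- Equidistribution under `(g, dg) ∘ (Φ, dΦ)` in the flat picture. The error is relative to the
measure of each element, so it survives arbitrary unions. -/
lemma norm_setIntegral_sUnion_etaHat_le {A : ProjTM → ℂ} {M τ : ℝ} {K a b q : ℕ} {εs : ℝ}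
    (hK : 0 < K) (hA : Measurable A) (hM : ∀ x, ‖A x‖ ≤ M)
    (hτ : ∀ y y', ptDist y y' < 3 / K → ‖A y - A y'‖ ≤ τ) (hb : 0 < b)
    (hbK : 1 / (b : ℝ) < 3 / K) (ha : 0 < a) (hba : (b / a : ℝ) ≤ 1 / K)
    (hεs : εs < 1 / 4) (hεs0 : 0 ≤ εs) {g φ : Equiv.Perm Torus}
    (hg : IsAreaPreservingDiffeo g) (hφ : IsAreaPreservingDiffeo φ)
    (hshear : IsStepShear a b q εs g) {η : Set (Fin K → Set Torus)}
    (hη : IsPartialDecomposition η) (hfin : η.Finite)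
    (hsame : ∀ I ∈ η, ∀ l l', volume.real (I l) = volume.real (I l'))
    (hpos : ∀ I ∈ η, ∀ l, 0 < volume.real (I l))
    {U : Set Torus} (hU : MeasurableSet U) (hUg : U ⊆ goodDomain a εs)
    (hUrot : ∀ x ∈ U, jacobian (g * φ : Equiv.Perm Torus) x ∈
      Matrix.specialOrthogonalGroup (Fin 2) ℝ) (t : UnitAddCircle)
    {γ δ ε₁ ε₂ d e : ℝ} (hγ : γ ≤ 1 / K) (hδ : δ ≤ d) (hd : d < 1) (he0 : 0 ≤ e) (he1 : e ≤ 1)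
    (hε₁ : ε₁ ≤ e) (hε₂ : ε₂ ≤ e) (hd0 : 0 ≤ d)
    (hdist : ∀ I ∈ η, ∀ j : Fin K, Distributes (φ * rot t * φ⁻¹) I j γ δ ε₁ ε₂)
    {𝒮 : Set (Set ProjTM)} (h𝒮 : 𝒮 ⊆ etaHat η) :
    ‖∫ z in ⋃₀ 𝒮, (A (projExt g (projExt (φ * rot t * φ⁻¹ : Equiv.Perm Torus) z)) - ∫ y, A y)‖
      ≤ 3 * τ + 2 * M * (2 * e + d) + 10 * M * volume.real Uᶜ := by
  set Φ : Equiv.Perm Torus := φ * rot t * φ⁻¹ with hΦ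
  have hM0 : 0 ≤ M := (norm_nonneg _).trans (hM ((0, 0), 0))
  have hτ0 : 0 ≤ τ := (norm_nonneg _).trans (hτ ((0, 0), 0) ((0, 0), 0) (by
    rw [ptDist_eq]; simp [hK]))
  have hΦs : IsSmoothDiffeo Φ := (hφ.1.mul (isSmoothDiffeo_rot t)).mul hφ.1.inv
  set D := goodDomain a εs with hD
  have hDm : MeasurableSet D := (isClosed_goodDomain a εs).measurableSet
  set X := badSet Φ D with hX
  have hXm : MeasurableSet X := measurableSet_badSet hΦs hDm
  have hXU : volume.real X ≤ 5 * volume.real Uᶜ :=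
    volume_real_badSet_le hg hφ hshear ha hεs hU hUg hUrot t
  set Ψ : ProjTM → ProjTM := fun z => projExt g (projExt Φ z) with hΨ
  have hΨm : Measurable Ψ := (measurable_projExt hg.1).comp (measurable_projExt hΦs)
  set ρ : Torus → UnitAddCircle := fun x => (Φ x).2 with hρ
  have hρm : Measurable ρ := measurable_snd.comp hΦs.continuous.measurable
  set β : Torus → UnitAddCircle := fun x => lineCoord ((jacobian Φ x).col 0) with hβ
  have hβm : Measurable β := by
    have h1 : Continuous fun x => (jacobian Φ x).col 0 :=
      continuous_pi fun i => hΦs.continuous_jacobian.matrix_elem i 0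
    exact measurable_lineCoord.comp h1.measurable
  have hBm : Measurable fun z => A (Ψ z) := hA.comp hΨm
  have hpiece : ∀ I ∈ η, ∀ j l : Fin K, ‖(∫ z in I l ×ˢ arc K j, A (Ψ z))
      - volume.real (I l) * ∫ z in univ ×ˢ arc K ((l + j : Fin K) : ℕ), A z‖
      ≤ volume.real (I l) / K * (3 * τ + 2 * M * (2 * e + d))
        + 2 * M / K * volume.real (I l ∩ X) := by
    intro I hI j l
    obtain ⟨J, hJ1, hJ2, hJ3, hJ4⟩ := hdist I hI j
    obtain ⟨hJm, -, hJδ, -⟩ := hJ1 l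
    obtain ⟨c, hc⟩ := hJ2 l
    have hJd : 1 - d ≤ volume.real (J l) := by linarith
    have hJ0 : 0 < volume.real (J l) := by linarith
    obtain ⟨l', ⟨hl'1, hl'2⟩, -⟩ := hJ4 (l + j)
    -- The congruence alone determines the index, so the piece provided for target arc `l + j` is
    -- piece `l`.
    have hll : l' = l := by
      rw [Fin.val_add] at hl'1
      have h1 : (l' + j : ℕ) ≡ l + j [MOD K] := hl'1.trans (Nat.mod_modEq _ _)
      have h2 := Nat.ModEq.add_right_cancel' _ h1
      exact Fin.ext (Nat.ModEq.eq_of_lt_of_lt h2 l'.2 l.2)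
    subst hll
    -- With the full set `J l'` the fiber condition says that at least the proportion `1 - e` of the
    -- base points have a line of `T_j` going to the target arc.
    have hS := hl'2 (J l') subset_rfl hJm
    rw [div_self hJ0.ne', mul_one] at hS
    have hv := hpos I hI l'
    refine norm_setIntegral_piece_sub_le hK hA hM hτ hb hbK hΨm hρm hβm
      (hη.measurable I hI l') hXm hv (c := c) ?_ (S := Prod.fst '' ((I l' ×ˢ arc K j) ∩
        projExt Φ ⁻¹' ((univ ×ˢ J l') ×ˢ arc K ((l' + j : Fin K) : ℕ)))) ?_ ?_ hJm hJd hJ0 he1 he0 ?_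
    · intro x hx hxX t'
      simp only [hX, badSet, mem_ofPred_eq, not_or, not_not] at hxX
      obtain ⟨s, hs, hsb⟩ := hshear.exists_apply_eq ha hεs0 hxX.2
      obtain ⟨s', hs', hs'2⟩ := hc (mem_image_of_mem Φ hx)
      refine ⟨(Φ x).1 + s, ?_, ?_⟩
      · simp only [hΨ, projExt]
        rw [hs, hshear.jacobian_eq_one hg.1 ha hεs hxX.2, projAct_one, projAct_rotation hxX.1]
      · rw [hs'2, show c + (s' : UnitAddCircle) + s - (c + b • ρ x)
          = (s' : UnitAddCircle) + (s - b • ρ x) by abel]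
        refine (norm_add_le _ _).trans ?_
        -- The horizontal error `2 / K` is one part width of the nearly vertical image and one part
        -- deviation of the step shear.
        have h1 : ‖(s' : UnitAddCircle)‖ ≤ 1 / K := by
          refine (norm_coe_le _).trans ?_
          rw [abs_of_nonneg hs'.1]
          exact hs'.2.trans hγ
        have h2 : (2 : ℝ) / K = 1 / K + 1 / K := by ring
        rw [h2]
        exact add_le_add h1 (hsb.trans hba)
    · rintro x ⟨⟨x', t'⟩, ⟨⟨hx1, hx2⟩, -, hx4⟩, rfl⟩
      refine ⟨hx1, ?_⟩
      by_cases hxX : x' ∈ X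
      · exact Or.inl hxX
      · refine Or.inr ⟨t', hx2, ?_⟩
        simp only [hX, badSet, mem_ofPred_eq, not_or, not_not] at hxX
        simp only [projExt] at hx4
        rwa [projAct_rotation hxX.1] at hx4
    · have h1 := (abs_le.1 hS).1
      have h2 : 1 - e ≤ volume.real (Prod.fst '' ((I l' ×ˢ arc K j) ∩
        projExt Φ ⁻¹' ((univ ×ˢ J l') ×ˢ arc K ((l' + j : Fin K) : ℕ)))) / volume.real (I l') := by
        linarith
      rwa [le_div_iff₀ hv, mul_comm] at h2
    · intro J' hJ' hJ'm
      have h1 := hJ3 l' J' hJ' hJ'm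
      have h2 : Φ ⁻¹' (univ ×ˢ J') = ρ ⁻¹' J' := by
        ext x; simp [hρ]
      rw [h2] at h1
      refine h1.trans ?_
      have : 0 ≤ volume.real J' / volume.real (J l') := by positivity
      gcongr
  -- Indexing by pairs and not by sets: distinct pairs give almost disjoint products, the arcs
  -- sharing endpoints only.
  set ι := {p : η × Fin K // (⋃ l, p.1.1 l) ×ˢ arc K p.2 ∈ 𝒮} with hι
  have : Finite η := hfin
  have hunion : ⋃₀ 𝒮 = ⋃ i : ι, (⋃ l, i.1.1.1 l) ×ˢ arc K i.1.2 := by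
    apply Subset.antisymm
    · refine sUnion_subset fun S hS => ?_
      obtain ⟨I, hI, j, rfl⟩ := h𝒮 hS
      exact subset_iUnion (fun i : ι => (⋃ l, i.1.1.1 l) ×ˢ arc K i.1.2) ⟨(⟨I, hI⟩, j), hS⟩
    · exact iUnion_subset fun i => subset_sUnion_of_mem i.2
  rw [hunion]
  refine (norm_setIntegral_iUnion_le (Y := X ×ˢ univ) (C := 3 * τ + 2 * M * (2 * e + d))
    (D := 2 * M) ((integrable_of_forall_norm_le hBm fun _ => hM _).sub (integrable_const _))
    (by positivity) (by positivity)
    (fun i => (MeasurableSet.iUnion (hη.measurable _ i.1.1.2)).prod (measurableSet_arc K _))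
    ?_ (hXm.prod MeasurableSet.univ) fun i => ?_).trans ?_
  · rintro ⟨⟨⟨I, hI⟩, j⟩, hi⟩ ⟨⟨⟨I', hI'⟩, j'⟩, hi'⟩ hne
    by_cases hII : I = I'
    · subst hII
      have hjj : j ≠ j' := by
        rintro rfl; exact hne rfl
      exact aedisjoint_prod_arc hjj
    · exact (Disjoint.set_prod_left (hη.disjoint_elements I hI I' hI' hII) _ _).aedisjoint
  · obtain ⟨⟨⟨I, hI⟩, j⟩, hi⟩ := i
    have h := norm_setIntegral_element_sub_le hA hM hBm (fun _ => hM _) (hη.measurable I hI)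
      (hη.disjoint_pieces I hI) (fun l => hsame I hI l j) hXm j (D := 2 * M)
      (fun l => hpiece I hI j l)
    exact h
  · have h1 : volume.real (X ×ˢ (univ : Set UnitAddCircle)) = volume.real X := by
      change ((volume : Measure Torus).prod volume).real _ = _
      rw [measureReal_prod_prod, probReal_univ, mul_one]
    rw [h1]
    nlinarith

/-! ### Closeness of derivative extensions in measure -/

lemma isCompact_dot_self_eq_one : IsCompact {w : Fin 2 → ℝ | w ⬝ᵥ w = 1} := by
  refine Metric.isCompact_of_isClosed_isBounded ?_ ?_
  · refine isClosed_eq ?_ continuous_const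
    simp only [dotProduct, Fin.sum_univ_two]; fun_prop
  · refine (Metric.isBounded_closedBall (x := (0 : Fin 2 → ℝ)) (r := 1)).subset fun w hw => ?_
    rw [mem_closedBall_zero_iff, pi_norm_le_iff_of_nonneg zero_le_one]
    have h1 : w 0 * w 0 + w 1 * w 1 = 1 := by
      simpa [dotProduct, Fin.sum_univ_two] using hw
    intro i
    rw [Real.norm_eq_abs, abs_le_one_iff_mul_self_le_one]
    fin_cases i
    · simp only [Fin.zero_eta]; nlinarith [mul_self_nonneg (w 1)]
    · simp only [Fin.mk_one]; nlinarith [mul_self_nonneg (w 0)]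

/-- `lineCoord` is scale invariant, so uniformity away from the origin follows from compactness of
the unit circle. Both vectors are divided by the length of `w`; only the first need then be a unit
vector. -/
lemma exists_dist_lineCoord_lt {c ε : ℝ} (hc : 0 < c) (hε : 0 < ε) :
    ∃ δ > 0, ∀ w w' : Fin 2 → ℝ, c ≤ w ⬝ᵥ w → dist w w' < δ →
      dist (lineCoord w) (lineCoord w') < ε := by
  set S : Set (Fin 2 → ℝ) := {w | w ⬝ᵥ w = 1} with hS
  have hSc : IsCompact S := isCompact_dot_self_eq_one
  have hcont : ∀ w ∈ S, ContinuousAt lineCoord w := by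
    intro w hw
    refine continuousAt_lineCoord fun h => ?_
    rw [h] at hw
    simp [hS] at hw
  have hu := hSc.uniformContinuousAt_of_continuousAt lineCoord hcont (Metric.dist_mem_uniformity hε)
  obtain ⟨δ, hδ, h⟩ := Metric.mem_uniformity_dist.1 hu
  have hsc : 0 < Real.sqrt c := Real.sqrt_pos.2 hc
  refine ⟨δ * Real.sqrt c, by positivity, fun w w' hw hww => ?_⟩
  set r := Real.sqrt (w ⬝ᵥ w) with hr
  have hrc : Real.sqrt c ≤ r := Real.sqrt_le_sqrt hw
  have hr0 : 0 < r := hsc.trans_le hrc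
  have hrr : r * r = w ⬝ᵥ w := Real.mul_self_sqrt (hc.le.trans hw)
  rw [← lineCoord_smul (inv_ne_zero hr0.ne') w, ← lineCoord_smul (inv_ne_zero hr0.ne') w']
  refine h (a := r⁻¹ • w) (b := r⁻¹ • w') ?_ ?_
  · rw [dist_smul₀, norm_inv, Real.norm_of_nonneg hr0.le, ← div_eq_inv_mul, div_lt_iff₀ hr0]
    exact hww.trans_le (by gcongr)
  · simp only [hS, mem_ofPred_eq]
    rw [smul_dotProduct, dotProduct_smul, ← hrr, smul_eq_mul, smul_eq_mul]
    field_simp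

lemma dot_self_smul_inv_sqrt {w : Fin 2 → ℝ} (hw : w ≠ 0) :
    ((Real.sqrt (w ⬝ᵥ w))⁻¹ • w) ⬝ᵥ ((Real.sqrt (w ⬝ᵥ w))⁻¹ • w) = 1 := by
  have hr := Real.sqrt_pos.2 (dot_self_pos hw)
  have hrr := Real.mul_self_sqrt (dot_self_pos hw).le
  rw [smul_dotProduct, dotProduct_smul, smul_eq_mul, smul_eq_mul]
  nth_rw 3 [← hrr]
  field_simp

lemma exists_metric_bounds {G : Torus → Matrix (Fin 2) (Fin 2) ℝ} (hG : Continuous G)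
    (hpos : ∀ x, ∀ v : Fin 2 → ℝ, v ≠ 0 → 0 < v ⬝ᵥ (G x).mulVec v) :
    ∃ c > 0, ∃ C > 0, ∀ x, ∀ v : Fin 2 → ℝ,
      c * (v ⬝ᵥ v) ≤ v ⬝ᵥ (G x).mulVec v ∧ v ⬝ᵥ (G x).mulVec v ≤ C * (v ⬝ᵥ v) := by
  set S : Set (Fin 2 → ℝ) := {w | w ⬝ᵥ w = 1} with hS
  have hSc : IsCompact S := isCompact_dot_self_eq_one
  have hne : ((univ : Set Torus) ×ˢ S).Nonempty := ⟨(0, lineVec 0), mem_univ _, lineVec_dot 0⟩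
  have hcont : Continuous fun p : Torus × (Fin 2 → ℝ) => p.2 ⬝ᵥ (G p.1).mulVec p.2 :=
    continuous_snd.dotProduct ((hG.comp continuous_fst).matrix_mulVec continuous_snd)
  obtain ⟨p₀, hp₀, hmin⟩ := (isCompact_univ.prod hSc).exists_isMinOn hne hcont.continuousOn
  obtain ⟨p₁, hp₁, hmax⟩ := (isCompact_univ.prod hSc).exists_isMaxOn hne hcont.continuousOn
  have hSne : ∀ v ∈ S, v ≠ 0 := by
    rintro v hv rfl; simp [hS] at hv
  refine ⟨_, hpos p₀.1 p₀.2 (hSne _ hp₀.2), _, hpos p₁.1 p₁.2 (hSne _ hp₁.2), fun x v => ?_⟩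
  by_cases hv : v = 0
  · subst hv; simp
  set r := Real.sqrt (v ⬝ᵥ v) with hr
  have hr0 : 0 < r := Real.sqrt_pos.2 (dot_self_pos hv)
  have hrr : r * r = v ⬝ᵥ v := Real.mul_self_sqrt (dot_self_pos hv).le
  have hmem : (x, r⁻¹ • v) ∈ (univ : Set Torus) ×ˢ S := ⟨mem_univ _, dot_self_smul_inv_sqrt hv⟩
  have h1 := hmin hmem
  have h2 := hmax hmem
  simp only [mem_ofPred_eq, Matrix.mulVec_smul, smul_dotProduct, dotProduct_smul,
    smul_eq_mul] at h1 h2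
  have h3 : r⁻¹ * (r⁻¹ * (v ⬝ᵥ (G x).mulVec v)) = (v ⬝ᵥ (G x).mulVec v) / (v ⬝ᵥ v) := by
    rw [← hrr]; field_simp
  rw [h3] at h1 h2
  exact ⟨(le_div_iff₀ (dot_self_pos hv)).1 h1, (div_le_iff₀ (dot_self_pos hv)).1 h2⟩

/-- A rotation is an isometry of the flat metric, hence its conjugate by `H` is one of the metric
pulled back by `H⁻¹`. -/
lemma pullbackMetric_conj_rot {H : Equiv.Perm Torus} (hH : IsSmoothDiffeo H) (t : UnitAddCircle)
    (x : Torus) (v : Fin 2 → ℝ) :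
    (jacobian (H * rot t * H⁻¹ : Equiv.Perm Torus) x).mulVec v ⬝ᵥ
      (pullbackMetric H ((H * rot t * H⁻¹ : Equiv.Perm Torus) x)).mulVec
        ((jacobian (H * rot t * H⁻¹ : Equiv.Perm Torus) x).mulVec v)
      = v ⬝ᵥ (pullbackMetric H x).mulVec v := by
  set F : Equiv.Perm Torus := H * rot t * H⁻¹ with hF
  have hR := isSmoothDiffeo_rot t
  have hFs : IsSmoothDiffeo F := (hH.mul hR).mul hH.inv
  have h1 : jacobian (H⁻¹ : Equiv.Perm Torus) (F x) * jacobian F x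
      = jacobian (H⁻¹ : Equiv.Perm Torus) x := by
    rw [← jacobian_mul hH.inv hFs]
    have h2 : H⁻¹ * F = rot t * H⁻¹ := by rw [hF]; group
    rw [h2, jacobian_mul hR hH.inv, jacobian_rot, one_mul]
  rw [pullbackMetric, pullbackMetric, gram_dot, gram_dot, Matrix.mulVec_mulVec, h1]

lemma dist_le_of_dTilde1_lt {F G : Equiv.Perm Torus} {r : ℝ} (h : dTilde1 F G < ENNReal.ofReal r)
    (x : Torus) :
    dist (F x) (G x) < r ∧ ∀ i j, dist (jacobian F x i j) (jacobian G x i j) < r := by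
  have hr : 0 < r := ENNReal.ofReal_pos.1 (bot_lt_of_lt h)
  constructor
  · rw [← edist_lt_ofReal]; exact (edist_le_dTilde1 F G x).trans_lt h
  · intro i j
    rw [← edist_lt_ofReal]
    exact (edist_jacobian_le_dTilde1 F G x i j).trans_lt h

lemma dist_mulVec_lineVec_le {A B : Matrix (Fin 2) (Fin 2) ℝ} {r : ℝ}
    (h : ∀ i j, dist (A i j) (B i j) < r) (t : UnitAddCircle) :
    dist (A.mulVec (lineVec t)) (B.mulVec (lineVec t)) ≤ 2 * r := by
  have hr : 0 ≤ r := dist_nonneg.trans (h 0 0).le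
  have hb : ∀ j, |lineVec t j| ≤ 1 := by
    have h1 := lineVec_dot t
    simp only [dotProduct, Fin.sum_univ_two] at h1
    intro j
    rw [abs_le_one_iff_mul_self_le_one]
    fin_cases j
    · simp only [Fin.zero_eta]; nlinarith [mul_self_nonneg (lineVec t 1)]
    · simp only [Fin.mk_one]; nlinarith [mul_self_nonneg (lineVec t 0)]
  rw [dist_pi_le_iff (by positivity)]
  intro i
  simp only [Matrix.mulVec, dotProduct, Fin.sum_univ_two]
  rw [Real.dist_eq]
  have e : A i 0 * lineVec t 0 + A i 1 * lineVec t 1 - (B i 0 * lineVec t 0 + B i 1 * lineVec t 1)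
      = (A i 0 - B i 0) * lineVec t 0 + (A i 1 - B i 1) * lineVec t 1 := by ring
  rw [e]
  refine (abs_add_le _ _).trans ?_
  rw [abs_mul, abs_mul, two_mul]
  have h0 := (h i 0).le
  have h1 := (h i 1).le
  rw [Real.dist_eq] at h0 h1
  refine add_le_add ?_ ?_
  · calc _ ≤ r * 1 := mul_le_mul h0 (hb 0) (abs_nonneg _) hr
      _ = r := mul_one r
  · calc _ ≤ r * 1 := mul_le_mul h1 (hb 1) (abs_nonneg _) hr
      _ = r := mul_one r

/-- On the points whose orbit stays in a stable set, closeness of the maps in the `C¹` distance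
implies closeness of the projectivized derivative extensions. -/
lemma exists_dist_projExt_lt {H : ℕ → Equiv.Perm Torus} (hH : ∀ n, IsAreaPreservingDiffeo (H n))
    (N : ℕ) {ε : ℝ} (hε : 0 < ε) :
    ∃ δ > 0, ∀ n ≥ N, ∀ (t : UnitAddCircle) (f : Equiv.Perm Torus),
      dTilde1 (H n * rot t * (H n)⁻¹) f < ENNReal.ofReal δ → ∀ x ∈ stableSet H N,
      (H n * rot t * (H n)⁻¹ : Equiv.Perm Torus) x ∈ stableSet H N → ∀ s,
      dist (projExt (H n * rot t * (H n)⁻¹ : Equiv.Perm Torus) (x, s)) (projExt f (x, s)) < ε := by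
  obtain ⟨c, hc, C, hC, hcC⟩ := exists_metric_bounds (hH N).1.continuous_pullbackMetric
    (fun x v hv => gram_dot_pos ((hH N).1.inv.det_ne x) hv)
  obtain ⟨δ, hδ, h⟩ := exists_dist_lineCoord_lt (c := c / C) (by positivity) hε
  refine ⟨min ε (δ / 4), by positivity, fun n hn t f hd x hx hy s => ?_⟩
  obtain ⟨h1, h2⟩ := dist_le_of_dTilde1_lt hd x
  set F : Equiv.Perm Torus := H n * rot t * (H n)⁻¹ with hF
  rw [Prod.dist_eq, max_lt_iff]
  refine ⟨h1.trans_le (min_le_left _ _), h _ _ ?_ ?_⟩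
  · have e1 := pullbackMetric_conj_rot (hH n).1 t x (lineVec s)
    -- At both endpoints the metric of `H n` is that of `H N`, whose bounds `c` and `C` do not
    -- depend on `n`. The isometry identity then bounds the squared length of the image vector below
    -- by `c / C`.
    rw [← hF, hy n hn, hx n hn] at e1
    have e2 := (hcC x (lineVec s)).1
    have e3 := (hcC (F x) ((jacobian F x).mulVec (lineVec s))).2
    rw [e1] at e3
    rw [lineVec_dot, mul_one] at e2
    rw [div_le_iff₀ hC, mul_comm]
    exact e2.trans e3
  · refine (dist_mulVec_lineVec_le h2 s).trans_lt ?_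
    have := min_le_right ε (δ / 4)
    linarith

/-- The stability index `N` is fixed before the closeness `δ` is chosen; the points with unstable
orbit segment are absorbed by their small measure. -/
lemma tendsto_integral_norm_projExt_sub {H : ℕ → Equiv.Perm Torus}
    (hH : ∀ n, IsAreaPreservingDiffeo (H n)) (hst : ∀ᵐ x, ∃ N, x ∈ stableSet H N)
    (t : ℕ → UnitAddCircle) {f : ℕ → Equiv.Perm Torus} (hf : ∀ n, IsSmoothDiffeo (f n))
    (hd : Tendsto (fun n => d1 (H n * rot (t n) * (H n)⁻¹) (f n)) atTop (𝓝 0))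
    {A : ProjTM → ℂ} (hA : Continuous A) :
    Tendsto (fun n => ∫ x, ‖A (projExt (H n * rot (t n) * (H n)⁻¹ : Equiv.Perm Torus) x)
      - A (projExt (f n) x)‖ ∂(muBar (limitMetric H))) atTop (𝓝 0) := by
  obtain ⟨M, hM⟩ := (isCompact_univ (X := ProjTM)).exists_bound_of_continuousOn hA.continuousOn
  replace hM : ∀ x, ‖A x‖ ≤ M := fun x => hM x (mem_univ x)
  have hM0 : 0 ≤ M := (norm_nonneg _).trans (hM ((0, 0), 0))
  set F : ℕ → Equiv.Perm Torus := fun n => H n * rot (t n) * (H n)⁻¹ with hF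
  have hFa : ∀ n, IsAreaPreservingDiffeo (F n) := fun n =>
    ((hH n).mul (isAreaPreservingDiffeo_rot _)).mul (hH n).inv
  have hz := tendsto_volume_stableSet_compl hH hst
  set D : ℕ → ProjTM → ℝ := fun n x => ‖A (projExt (F n) x) - A (projExt (f n) x)‖ with hD
  have hDm : ∀ n, Measurable (D n) := fun n =>
    ((hA.measurable.comp (measurable_projExt (hFa n).1)).sub
      (hA.measurable.comp (measurable_projExt (hf n)))).norm
  have hDM : ∀ n x, D n x ≤ 2 * M := fun n x =>
    (norm_sub_le _ _).trans (by linarith [hM (projExt (F n) x), hM (projExt (f n) x)])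
  have hD0 : ∀ n x, 0 ≤ D n x := fun n x => norm_nonneg _
  rw [Metric.tendsto_atTop]
  intro ε hε
  obtain ⟨N, hN⟩ := (Metric.tendsto_atTop.1 hz (ε / (16 * (M + 1))) (by positivity))
  have hN' : ∀ n ≥ N, M * volume.real (stableSet H n)ᶜ ≤ ε / 16 := by
    intro n hn
    have h1 := hN n hn
    rw [Real.dist_eq, sub_zero, abs_of_nonneg measureReal_nonneg, lt_div_iff₀ (by positivity)] at h1
    have h2 : 0 ≤ volume.real (stableSet H n)ᶜ := measureReal_nonneg
    nlinarith
  obtain ⟨ε', hε', hA'⟩ := Metric.uniformContinuous_iff.1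
    (CompactSpace.uniformContinuous_of_continuous hA) (ε / 4) (by positivity)
  obtain ⟨δ, hδ, h⟩ := exists_dist_projExt_lt hH N hε'
  have hev : ∀ᶠ n in atTop, d1 (F n) (f n) < ENNReal.ofReal δ :=
    hd.eventually (gt_mem_nhds (ENNReal.ofReal_pos.2 hδ))
  obtain ⟨N₁, hN₁⟩ := eventually_atTop.1 hev
  refine ⟨max N N₁, fun n hn => ?_⟩
  have hnN := (le_max_left _ _).trans hn
  have hclose := hN₁ n ((le_max_right _ _).trans hn)
  rw [Real.dist_eq, sub_zero, abs_of_nonneg (integral_nonneg (hD0 n))]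
  have h1 := norm_integral_limit_sub_le hH hst (f := fun x => (D n x : ℂ)) (M := 2 * M)
    (Complex.measurable_ofReal.comp (hDm n))
    (fun x => by rw [Complex.norm_real, Real.norm_of_nonneg (hD0 n x)]; exact hDM n x) n
  rw [integral_complex_ofReal, integral_complex_ofReal, ← Complex.ofReal_sub, Complex.norm_real,
    Real.norm_eq_abs] at h1
  have h2 := (abs_le.1 h1).2
  set Z := stableSet H N with hZ
  have hZm : MeasurableSet Z := measurableSet_stableSet hH N
  -- Points whose image under `H n` is stable together with its image under `F n`. All maps preserve
  -- area, so the complement is at most twice that of `Z`.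
  set Y : Set Torus := (H n) ⁻¹' (Z ∩ (F n) ⁻¹' Z) with hY
  have hYm : MeasurableSet Y :=
    (hH n).1.continuous.measurable (hZm.inter ((hFa n).1.continuous.measurable hZm))
  have hYc : volume.real Yᶜ ≤ 2 * volume.real Zᶜ := by
    rw [hY, ← preimage_compl, (hH n).real_preimage
      (hZm.inter ((hFa n).1.continuous.measurable hZm)).compl, compl_inter, ← preimage_compl]
    refine (measureReal_union_le _ _).trans ?_
    rw [(hFa n).real_preimage hZm.compl]; linarith
  have hcomp : Measurable fun x => D n (projExt (H n) x) :=
    (hDm n).comp (measurable_projExt (hH n).1)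
  have hpt : ∀ x : ProjTM, D n (projExt (H n) x)
      ≤ ε / 4 + (Yᶜ ×ˢ (univ : Set UnitAddCircle)).indicator (fun _ => 2 * M) x := by
    rintro ⟨x, s⟩
    by_cases hx : x ∈ Y
    · rw [indicator_of_notMem (by simp [hx]), add_zero]
      have h3 := h n hnN (t n) (f n) ((le_max_left _ _).trans_lt hclose) (H n x) hx.1 hx.2
        (projAct (jacobian (H n) x) s)
      have h4 := hA' h3
      rw [dist_eq_norm] at h4
      exact h4.le
    · rw [indicator_of_mem (by simp [hx])]
      linarith [hDM n (projExt (H n) (x, s))]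
  have h3 : ∫ x, D n (projExt (H n) x) ≤ ε / 4 + 2 * M * volume.real Yᶜ := by
    have hm : MeasurableSet (Yᶜ ×ˢ (univ : Set UnitAddCircle)) := hYm.compl.prod MeasurableSet.univ
    refine (integral_mono (Integrable.of_bound hcomp.aestronglyMeasurable (2 * M)
      (Eventually.of_forall fun x => by rw [Real.norm_of_nonneg (hD0 _ _)]; exact hDM _ _))
      ((integrable_const _).add ((integrable_const _).indicator hm)) hpt).trans ?_
    rw [integral_add' (integrable_const _) ((integrable_const _).indicator hm),
      integral_indicator_const _ hm, integral_const, probReal_univ, one_smul, smul_eq_mul]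
    have h4 : volume.real (Yᶜ ×ˢ (univ : Set UnitAddCircle)) = volume.real Yᶜ := by
      change ((volume : Measure Torus).prod volume).real _ = _
      rw [measureReal_prod_prod, probReal_univ, mul_one]
    rw [h4, mul_comm]
  have h5 := hN' n hnN
  have h6 := hN' N le_rfl
  have h7 : M * volume.real Yᶜ ≤ M * (2 * volume.real Zᶜ) := by gcongr
  have h8 : ∫ x, D n x ∂(muBar (limitMetric H)) ≤
    ε / 4 + 2 * M * volume.real Yᶜ + 2 * (2 * M) * volume.real (stableSet H n)ᶜ := by linarith
  change ∫ x, D n x ∂(muBar (limitMetric H)) < ε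
  linarith

/-! ### Mixing of one step of the construction -/

lemma norm_setIntegral_sub_le_symmDiff {X : Type*} [MeasurableSpace X] {μ : Measure X}
    [IsFiniteMeasure μ] {f : X → ℂ} {M : ℝ} (hf : Measurable f) (hM : ∀ x, ‖f x‖ ≤ M)
    {s t : Set X} (hs : MeasurableSet s) (ht : MeasurableSet t) :
    ‖(∫ x in s, f x ∂μ) - ∫ x in t, f x ∂μ‖ ≤ M * μ.real (symmDiff s t) := by
  have hi : Integrable f μ := integrable_of_forall_norm_le hf hM
  have h1 := integral_inter_add_sdiff (μ := μ) (s := s) ht hi.integrableOn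
  have h2 := integral_inter_add_sdiff (μ := μ) (s := t) hs hi.integrableOn
  rw [inter_comm] at h2
  rw [← h1, ← h2, add_sub_add_left_eq_sub]
  rw [measureReal_symmDiff_eq hs ht, mul_add]
  exact (norm_sub_le _ _).trans (add_le_add
    (norm_setIntegral_le_of_norm_le_const (measure_lt_top _ _) fun x _ => hM x)
    (norm_setIntegral_le_of_norm_le_const (measure_lt_top _ _) fun x _ => hM x))

/-- Replace `B` by a union of elements of `nuHat`, pull back by `Ψ = H N ∘ g` to Lebesgue measure,
and apply `norm_setIntegral_sUnion_etaHat_le` to `A ∘ (H N, dH N)`. The remaining terms are the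
costs of these transports. -/
lemma norm_setIntegral_projExt_sub_le {H : ℕ → Equiv.Perm Torus}
    (hH : ∀ n, IsAreaPreservingDiffeo (H n)) (hst : ∀ᵐ x, ∃ N, x ∈ stableSet H N) (N : ℕ)
    {A : ProjTM → ℂ} {M τ : ℝ} {K a b q : ℕ} {εs : ℝ}
    (hK : 0 < K) (hA : Measurable A) (hM : ∀ x, ‖A x‖ ≤ M)
    (hτ : ∀ y y', ptDist y y' < 3 / K → ‖A (projExt (H N) y) - A (projExt (H N) y')‖ ≤ τ)
    (hb : 0 < b) (hbK : 1 / (b : ℝ) < 3 / K) (ha : 0 < a) (hba : (b / a : ℝ) ≤ 1 / K)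
    (hεs : εs < 1 / 4) (hεs0 : 0 ≤ εs) {g φ : Equiv.Perm Torus}
    (hg : IsAreaPreservingDiffeo g) (hφ : IsAreaPreservingDiffeo φ)
    (hshear : IsStepShear a b q εs g) {η : Set (Fin K → Set Torus)}
    (hη : IsPartialDecomposition η) (hfin : η.Finite)
    (hsame : ∀ I ∈ η, ∀ l l', volume.real (I l) = volume.real (I l'))
    (hpos : ∀ I ∈ η, ∀ l, 0 < volume.real (I l))
    {U : Set Torus} (hU : MeasurableSet U) (hUg : U ⊆ goodDomain a εs)
    (hUrot : ∀ x ∈ U, jacobian (g * φ : Equiv.Perm Torus) x ∈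
      Matrix.specialOrthogonalGroup (Fin 2) ℝ) (t : UnitAddCircle)
    {γ δ ε₁ ε₂ d e : ℝ} (hγ : γ ≤ 1 / K) (hδ : δ ≤ d) (hd : d < 1) (he0 : 0 ≤ e) (he1 : e ≤ 1)
    (hε₁ : ε₁ ≤ e) (hε₂ : ε₂ ≤ e) (hd0 : 0 ≤ d)
    (hdist : ∀ I ∈ η, ∀ j : Fin K, Distributes (φ * rot t * φ⁻¹) I j γ δ ε₁ ε₂)
    {B B' : Set ProjTM} (hB : MeasurableSet B) (hB' : MeasurableSet B')
    {𝒮 : Set (Set ProjTM)} (h𝒮 : 𝒮 ⊆ nuHat (H N) g η) (hB𝒮 : B' = ⋃₀ 𝒮) :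
    ‖(∫ x in B, A (projExt (H N * g * (φ * rot t * φ⁻¹) * (H N * g)⁻¹ : Equiv.Perm Torus) x)
        ∂(muBar (limitMetric H)))
      - (muBar (limitMetric H)).real B * ∫ x, A x ∂(muBar (limitMetric H))‖
      ≤ 2 * M * (muBar (limitMetric H)).real (symmDiff B B') + 3 * τ + 2 * M * (2 * e + d)
        + 14 * M * volume.real Uᶜ + 6 * M * volume.real (stableSet H N)ᶜ := by
  have := isProbabilityMeasure_muBar_limitMetric hH hst
  have hM0 : 0 ≤ M := (norm_nonneg _).trans (hM ((0, 0), 0))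
  set ν := muBar (limitMetric H) with hν
  set Φ : Equiv.Perm Torus := φ * rot t * φ⁻¹ with hΦ
  have hΦa : IsAreaPreservingDiffeo Φ := (hφ.mul (isAreaPreservingDiffeo_rot t)).mul hφ.inv
  set Ψ : Equiv.Perm Torus := H N * g with hΨ
  have hΨa : IsAreaPreservingDiffeo Ψ := (hH N).mul hg
  set F : Equiv.Perm Torus := Ψ * Φ * Ψ⁻¹ with hF
  have hFs : IsSmoothDiffeo F := (hΨa.1.mul hΦa.1).mul hΨa.1.inv
  set A' : ProjTM → ℂ := fun x => A (projExt (H N) x) with hA'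
  have hA'm : Measurable A' := hA.comp (measurable_projExt (hH N).1)
  set Iν := ∫ x, A x ∂ν with hI
  set I₀ := ∫ x, A' x with hI₀
  have hII : ‖Iν - I₀‖ ≤ 2 * M * volume.real (stableSet H N)ᶜ :=
    norm_integral_limit_sub_le hH hst hA hM N
  have hIM : ‖Iν‖ ≤ M :=
    (norm_integral_le_of_norm_le_const (Eventually.of_forall hM)).trans
      (by rw [probReal_univ, mul_one])
  set f₁ : ProjTM → ℂ := fun x => A (projExt F x) - Iν with hf₁
  have hf₁m : Measurable f₁ := (hA.comp (measurable_projExt hFs)).sub_const _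
  have hf₁M : ∀ x, ‖f₁ x‖ ≤ 2 * M := fun x =>
    (norm_sub_le _ _).trans (by linarith [hM (projExt F x)])
  have e0 : (∫ x in B, A (projExt F x) ∂ν) - ν.real B * Iν = ∫ x in B, f₁ x ∂ν := by
    have hFi : IntegrableOn (fun x => A (projExt F x)) B ν :=
      (integrable_of_forall_norm_le (hA.comp (measurable_projExt hFs)) fun _ => hM _).integrableOn
    have h1 : ∫ x in B, f₁ x ∂ν = (∫ x in B, A (projExt F x) ∂ν) - ∫ _ in B, Iν ∂ν :=
      integral_sub hFi (integrable_const _)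
    rw [h1, setIntegral_const, Complex.real_smul]
  have e1 := norm_setIntegral_sub_le_symmDiff (μ := ν) hf₁m hf₁M hB hB'
  -- transport to the product measure
  set D := goodDomain a εs with hD
  have hDm : MeasurableSet D := (isClosed_goodDomain a εs).measurableSet
  -- On `Z` the factor `g` has differential one, so `Ψ` and `H N` pull back to the same metric,
  -- which is also the limit metric.
  set Z : Set Torus := stableSet H N ∩ (Ψ⁻¹ : Equiv.Perm Torus) ⁻¹' D with hZ
  have hZm : MeasurableSet Z := (measurableSet_stableSet hH N).inter
    (hΨa.1.inv.continuous.measurable hDm)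
  have hZeq : ∀ x ∈ Z, limitMetric H x = pullbackMetric Ψ x := by
    intro x hx
    rw [(limitMetric_eq_of_mem_stableSet hx.1).2, hΨ, pullbackMetric_mul_of_orthogonal (hH N).1 hg.1]
    rw [hshear.jacobian_eq_one hg.1 ha hεs hx.2]
    exact one_mem _
  have hZc : volume.real Zᶜ ≤ volume.real (stableSet H N)ᶜ + volume.real Uᶜ := by
    rw [hZ, compl_inter, ← preimage_compl]
    refine (measureReal_union_le _ _).trans ?_
    rw [hΨa.inv.real_preimage hDm.compl]
    exact add_le_add le_rfl (measureReal_mono (compl_subset_compl.2 hUg))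
  have e2 := norm_integral_muBar_sub_le (G := limitMetric H) hΨa hZm hZeq
    (f := B'.indicator f₁) (M := 2 * M) (hf₁m.indicator hB')
    (fun x => (norm_indicator_le_norm_self _ _).trans (hf₁M x))
  rw [integral_indicator hB'] at e2
  -- `(Ψ, dΨ)` is injective, so the preimage of the union is exactly the union of these flat
  -- elements.
  set 𝒯 : Set (Set ProjTM) := {E | E ∈ etaHat η ∧ projExt (H N) '' (projExt g '' E) ∈ 𝒮} with h𝒯
  have hpre : projExt Ψ ⁻¹' B' = ⋃₀ 𝒯 := by
    have himg : ∀ E, projExt (H N) '' (projExt g '' E) = projExt Ψ '' E := by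
      intro E
      rw [hΨ, projExt_mul (hH N).1 hg.1, image_comp]
    ext x
    simp only [hB𝒮, mem_preimage, mem_sUnion, h𝒯, mem_ofPred_eq]
    constructor
    · rintro ⟨S, hS, hx⟩
      obtain ⟨E, hE, rfl⟩ := h𝒮 hS
      refine ⟨E, ⟨hE, hS⟩, ?_⟩
      rw [himg] at hx
      exact (bijective_projExt hΨa.1).1.mem_set_image.1 hx
    · rintro ⟨E, ⟨-, hS⟩, hx⟩
      refine ⟨_, hS, ?_⟩
      rw [himg]
      exact mem_image_of_mem _ hx
  have hpm : MeasurableSet (⋃₀ 𝒯) := by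
    rw [← hpre]; exact measurable_projExt hΨa.1 hB'
  have e3 := norm_setIntegral_sUnion_etaHat_le hK hA'm (fun _ => hM _) hτ hb hbK ha hba hεs hεs0
    hg hφ hshear hη hfin hsame hpos hU hUg hUrot t hγ hδ hd he0 he1 hε₁ hε₂ hd0 hdist
    (𝒮 := 𝒯) (fun E hE => hE.1)
  have hconj : ∀ z, f₁ (projExt Ψ z) = A' (projExt g (projExt Φ z)) - Iν := by
    intro z
    have h1 : projExt F ∘ projExt Ψ = projExt (H N) ∘ projExt g ∘ projExt Φ := by
      rw [← projExt_mul hFs hΨa.1, hF, inv_mul_cancel_right, projExt_mul hΨa.1 hΦa.1, hΨ,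
        projExt_mul (hH N).1 hg.1]
      rfl
    have h2 := congrFun h1 z
    simp only [Function.comp] at h2
    simp only [hf₁, hA', h2]
  have hA''m : Measurable fun z => A' (projExt g (projExt Φ z)) :=
    hA'm.comp ((measurable_projExt hg.1).comp (measurable_projExt hΦa.1))
  -- The average was subtracted for the limit measure, while equidistribution is stated with
  -- Lebesgue measure; the difference `Iν - I₀` is one more transport error.
  have hind : (∫ x, B'.indicator f₁ (projExt Ψ x))
      = (∫ z in ⋃₀ 𝒯, (A' (projExt g (projExt Φ z)) - I₀))
        - (volume : Measure ProjTM).real (⋃₀ 𝒯) * (Iν - I₀) := by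
    have h1 : (fun x => B'.indicator f₁ (projExt Ψ x))
        = (⋃₀ 𝒯).indicator fun z => A' (projExt g (projExt Φ z)) - Iν := by
      funext x
      rw [← hpre]
      by_cases hx : projExt Ψ x ∈ B'
      · rw [indicator_of_mem hx, indicator_of_mem (by exact hx), hconj]
      · rw [indicator_of_notMem hx, indicator_of_notMem (by exact hx)]
    have hi : Integrable fun z => A' (projExt g (projExt Φ z)) :=
      integrable_of_forall_norm_le hA''m fun _ => hM _
    rw [h1, integral_indicator hpm, integral_sub hi.integrableOn (integrable_const _),
      integral_sub hi.integrableOn (integrable_const _), setIntegral_const, setIntegral_const,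
      Complex.real_smul, Complex.real_smul]
    ring
  have e4 : ‖((volume : Measure ProjTM).real (⋃₀ 𝒯) : ℂ) * (Iν - I₀)‖
      ≤ 2 * M * volume.real (stableSet H N)ᶜ := by
    rw [norm_mul, Complex.norm_real, Real.norm_of_nonneg measureReal_nonneg]
    exact (mul_le_of_le_one_left (norm_nonneg _) measureReal_le_one).trans hII
  have e5 : ‖∫ x, B'.indicator f₁ (projExt Ψ x)‖ ≤ 3 * τ + 2 * M * (2 * e + d)
      + 10 * M * volume.real Uᶜ + 2 * M * volume.real (stableSet H N)ᶜ := by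
    rw [hind]
    exact (norm_sub_le _ _).trans (add_le_add e3 e4)
  have e6 : ‖∫ x in B', f₁ x ∂ν‖ ≤ 2 * (2 * M) * volume.real Zᶜ + (3 * τ + 2 * M * (2 * e + d)
      + 10 * M * volume.real Uᶜ + 2 * M * volume.real (stableSet H N)ᶜ) :=
    (norm_le_norm_sub_add _ _).trans (add_le_add e2 e5)
  rw [e0]
  refine (norm_le_norm_sub_add _ (∫ x in B', f₁ x ∂ν)).trans ((add_le_add e1 e6).trans ?_)
  have e7 : M * volume.real Zᶜ ≤ M * (volume.real (stableSet H N)ᶜ + volume.real Uᶜ) := by gcongr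
  linarith

/-! ### Weak mixing -/

lemma iterate_ae_eq {X : Type*} [MeasurableSpace X] {μ : Measure X} {T : X → X}
    (hT : MeasurePreserving T μ μ) {u : X → ℂ} {z : ℂ} (h : ∀ᵐ x ∂μ, u (T x) = z * u x) (k : ℕ) :
    ∀ᵐ x ∂μ, u (T^[k] x) = z ^ k * u x := by
  induction k with
  | zero => simp
  | succ k ih =>
    filter_upwards [hT.quasiMeasurePreserving.ae ih, h] with x h1 h2
    rw [Function.iterate_succ_apply, h1, h2, pow_succ]; ring

/-- A mixing sequence of iterates, tested on continuous functions, excludes nonconstant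
eigenfunctions. -/
lemma isWeaklyMixing_of_tendsto {μ : Measure ProjTM} [IsProbabilityMeasure μ] {T : ProjTM → ProjTM}
    (hT : MeasurePreserving T μ μ) (m : ℕ → ℕ)
    (hmix : ∀ A : ProjTM → ℂ, Continuous A → ∀ B, MeasurableSet B →
      Tendsto (fun n => ∫ x in B, A (T^[m n] x) ∂μ) atTop (𝓝 (μ.real B * ∫ x, A x ∂μ))) :
    IsWeaklyMixing μ T := by
  refine ⟨hT, fun u z hu hz => ?_⟩
  have hui : Integrable u μ := hu.integrable (by norm_num)
  -- Continuous functions are dense in `L¹` and `T` preserves `μ`, so the mixing limit extends to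
  -- `u`, where the iterate acts as multiplication by `z ^ m n`.
  have key : ∀ B, MeasurableSet B →
      Tendsto (fun n => z ^ m n * ∫ x in B, u x ∂μ) atTop (𝓝 (μ.real B * ∫ x, u x ∂μ)) := by
    intro B hB
    rw [Metric.tendsto_atTop]
    intro ε hε
    obtain ⟨A, -, hA, hAc, hAi⟩ := hui.exists_hasCompactSupport_integral_sub_le
      (ε := ε / 4) (by positivity)
    obtain ⟨N, hN⟩ := Metric.tendsto_atTop.1 (hmix A hAc B hB) (ε / 4) (by positivity)
    refine ⟨N, fun n hn => ?_⟩
    have h1 := hN n hn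
    rw [dist_eq_norm] at h1 ⊢
    have hTn := hT.iterate (m n)
    have h2 : z ^ m n * ∫ x in B, u x ∂μ = ∫ x in B, u (T^[m n] x) ∂μ := by
      rw [← integral_const_mul]
      refine integral_congr_ae (ae_restrict_of_ae ?_)
      filter_upwards [iterate_ae_eq hT hz (m n)] with x hx
      exact hx.symm
    have hsub : Integrable (fun x => u x - A x) μ := hui.sub hAi
    have hcu : Integrable (fun x => u (T^[m n] x)) μ := hTn.integrable_comp_of_integrable hui
    have hcA : Integrable (fun x => A (T^[m n] x)) μ := hTn.integrable_comp_of_integrable hAi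
    have h3 : ‖(∫ x in B, u (T^[m n] x) ∂μ) - ∫ x in B, A (T^[m n] x) ∂μ‖ ≤ ε / 4 := by
      rw [← integral_sub hcu.integrableOn hcA.integrableOn]
      refine (norm_integral_le_integral_norm _).trans ?_
      refine (setIntegral_le_integral (hcu.sub hcA).norm
        (Eventually.of_forall fun x => norm_nonneg _)).trans ?_
      have h4 : ∫ x, ‖u (T^[m n] x) - A (T^[m n] x)‖ ∂μ = ∫ x, ‖u x - A x‖ ∂μ := by
        conv_rhs => rw [← hTn.map_eq]
        rw [integral_map hTn.measurable.aemeasurable]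
        rw [hTn.map_eq]
        exact hsub.norm.aestronglyMeasurable
      exact h4.le.trans hA
    have h5 : ‖(μ.real B : ℂ) * (∫ x, A x ∂μ) - μ.real B * ∫ x, u x ∂μ‖ ≤ ε / 4 := by
      rw [← mul_sub, norm_mul, Complex.norm_real, Real.norm_of_nonneg measureReal_nonneg,
        norm_sub_rev, ← integral_sub hui hAi]
      exact (mul_le_of_le_one_left (norm_nonneg _) measureReal_le_one).trans
        ((norm_integral_le_integral_norm _).trans hA)
    rw [h2]
    refine (norm_sub_le_norm_sub_add_norm_sub _ (∫ x in B, A (T^[m n] x) ∂μ) _).trans_lt ?_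
    have h6 := norm_sub_le_norm_sub_add_norm_sub (∫ x in B, A (T^[m n] x) ∂μ)
      ((μ.real B : ℂ) * ∫ x, A x ∂μ) (μ.real B * ∫ x, u x ∂μ)
    linarith
  have hcomp : ∀ f : ProjTM → ℝ, AEStronglyMeasurable f μ →
      ∫ x, f (T x) ∂μ = ∫ x, f x ∂μ := by
    intro f hf
    conv_rhs => rw [← hT.map_eq]
    rw [integral_map hT.measurable.aemeasurable]
    rw [hT.map_eq]; exact hf
  by_cases hu0 : u =ᵐ[μ] 0
  · exact ⟨0, hu0⟩
  have hz1 : ‖z‖ = 1 := by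
    have h1 := hcomp (fun x => ‖u x‖) hui.norm.aestronglyMeasurable
    have h2 : ∫ x, ‖u (T x)‖ ∂μ = ‖z‖ * ∫ x, ‖u x‖ ∂μ := by
      rw [← integral_const_mul]
      refine integral_congr_ae ?_
      filter_upwards [hz] with x hx
      rw [hx, norm_mul]
    have h3 : ∫ x, ‖u x‖ ∂μ ≠ 0 := by
      intro h
      rw [integral_eq_zero_iff_of_nonneg (fun _ => norm_nonneg _) hui.norm] at h
      refine hu0 ?_
      filter_upwards [h] with x hx
      simpa using hx
    rw [h2] at h1
    exact mul_right_cancel₀ h3 (by rw [h1, one_mul])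
  have hint : ∫ x, u x ∂μ = z * ∫ x, u x ∂μ := by
    rw [← integral_const_mul]
    conv_lhs => rw [← hT.map_eq]
    rw [integral_map hT.measurable.aemeasurable (by rw [hT.map_eq]; exact hui.aestronglyMeasurable)]
    exact integral_congr_ae hz
  -- If the mean vanishes, `‖z‖ = 1` makes the norms in `key` constant in `n` and tending to zero,
  -- so all integrals over sets vanish. Otherwise invariance of the mean gives `z = 1`, and the same
  -- limits identify `u` with its mean.
  by_cases hI : ∫ x, u x ∂μ = 0
  · refine (hu0 ?_).elim
    refine hui.ae_eq_zero_of_forall_setIntegral_eq_zero fun B hB _ => ?_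
    have h1 := (key B hB).norm
    simp only [hI, mul_zero, norm_zero, norm_mul, norm_pow, hz1, one_pow, one_mul] at h1
    exact norm_eq_zero.1 (tendsto_nhds_unique tendsto_const_nhds h1)
  · have hz' : z = 1 := by
      have : (1 - z) * ∫ x, u x ∂μ = 0 := by rw [sub_mul, one_mul, ← hint, sub_self]
      exact (sub_eq_zero.1 ((mul_eq_zero.1 this).resolve_right hI)).symm
    refine ⟨∫ x, u x ∂μ, ?_⟩
    refine Integrable.ae_eq_of_forall_setIntegral_eq u (fun _ => ∫ x, u x ∂μ) hui
      (integrable_const _) fun B hB _ => ?_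
    have h1 := key B hB
    simp only [hz', one_pow, one_mul] at h1
    rw [setIntegral_const, Complex.real_smul]
    exact tendsto_nhds_unique tendsto_const_nhds h1

/-! ### Consequences of the parameter conditions -/

lemma dist_le_ptDist (x y : ProjTM) : dist x y ≤ ptDist x y := by
  rw [ptDist_eq, Prod.dist_eq, Prod.dist_eq, dist_eq_norm, dist_eq_norm, dist_eq_norm]
  refine max_le (max_le ?_ ?_) ?_ <;>
  · refine Real.le_sqrt_of_sq_le ?_
    nlinarith [sq_nonneg ‖x.1.1 - y.1.1‖, sq_nonneg ‖x.1.2 - y.1.2‖, sq_nonneg ‖x.2 - y.2‖]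

lemma ptDist_comm (x y : ProjTM) : ptDist x y = ptDist y x := by
  rw [ptDist_eq, ptDist_eq, norm_sub_rev x.1.1, norm_sub_rev x.1.2, norm_sub_rev x.2]

lemma ptDist_self (x : ProjTM) : ptDist x x = 0 := by
  rw [ptDist_eq]; simp

lemma ptDiam_pair (x y : ProjTM) : ptDiam {x, y} = ENNReal.ofReal (ptDist x y) := by
  refine le_antisymm ?_ ?_
  · refine iSup₂_le fun a ha => iSup₂_le fun b hb => ?_
    rcases ha with rfl | rfl <;> rcases hb with rfl | rfl
    · rw [ptDist_self]; simp
    · exact le_rfl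
    · rw [ptDist_comm]
    · rw [ptDist_self]; simp
  · exact le_iSup₂_of_le x (by simp) (le_iSup₂_of_le (f := fun b _ =>
      ENNReal.ofReal (ptDist x b)) y (by simp) le_rfl)

/-- The diameter condition on sets is applied to two-point sets. -/
lemma ptDist_image_le {h : ProjTM → ProjTM} {r s : ℝ} (hs : 0 ≤ s)
    (hd : ∀ S : Set ProjTM, ptDiam S < ENNReal.ofReal r → ptDiam (h '' S) ≤ ENNReal.ofReal s)
    {x y : ProjTM} (hxy : ptDist x y < r) : ptDist (h x) (h y) ≤ s := by
  have h0 : 0 ≤ ptDist x y := Real.sqrt_nonneg _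
  have h1 := hd {x, y} (by
    rw [ptDiam_pair]; exact (ENNReal.ofReal_lt_ofReal_iff (h0.trans_lt hxy)).2 hxy)
  rw [image_pair, ptDiam_pair] at h1
  exact (ENNReal.ofReal_le_ofReal_iff hs).1 h1

/-- The union of the elements of a partial decomposition. -/
def support {K : ℕ} (η : Set (Fin K → Set Torus)) : Set Torus := ⋃ I ∈ η, ⋃ l, I l

/-- Only finitely many disjoint sets of area at least `c` fit into the torus. -/
lemma finite_of_volume_le {K : ℕ} (hK : 0 < K) {η : Set (Fin K → Set Torus)}
    (hη : IsPartialDecomposition η) {c : ℝ} (hc : 0 < c)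
    (h : ∀ I ∈ η, ∀ l, c ≤ volume.real (I l)) : η.Finite := by
  have h1 := Measure.finite_const_le_meas_of_disjoint_iUnion (volume : Measure Torus)
    (ENNReal.ofReal_pos.2 hc) (As := fun I : η => ⋃ l, I.1 l)
    (fun I => MeasurableSet.iUnion (hη.measurable I.1 I.2))
    (fun I I' hne => hη.disjoint_elements I.1 I.2 I'.1 I'.2 fun h => hne (Subtype.ext h))
    (measure_ne_top _ _)
  have h2 : {i : η | ENNReal.ofReal c ≤ volume (⋃ l, i.1 l)} = univ := by
    refine eq_univ_of_forall fun I => ?_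
    have h3 : ENNReal.ofReal c ≤ volume (I.1 ⟨0, hK⟩) := by
      rw [← ofReal_measureReal]; exact ENNReal.ofReal_le_ofReal (h I.1 I.2 _)
    exact h3.trans (measure_mono (subset_iUnion I.1 _))
  rw [h2] at h1
  exact Set.finite_coe_iff.1 (Set.finite_univ_iff.1 h1)

lemma measurableSet_support {K : ℕ} {η : Set (Fin K → Set Torus)}
    (hη : IsPartialDecomposition η) (hfin : η.Finite) : MeasurableSet (support η) :=
  hfin.measurableSet_biUnion fun I hI => MeasurableSet.iUnion (hη.measurable I hI)

lemma pow_five_le {n k : ℕ} (hn : 2 ≤ n) (hk : n ^ 5 ≤ k) : 32 ≤ k ∧ n ≤ k := by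
  have h1 : 2 ^ 5 ≤ n ^ 5 := Nat.pow_le_pow_left hn 5
  have h2 : n ≤ n ^ 5 := Nat.le_self_pow (by norm_num) n
  constructor
  · norm_num at h1; omega
  · omega

section decomposition

variable {k q : ℕ → ℕ} {h : ℕ → Equiv.Perm Torus} {η : ∀ n, Set (Fin (k n) → Set Torus)}

lemma DecompositionConditions.piece_pos (hη : DecompositionConditions k q h η) {n : ℕ}
    (hn : 1 ≤ n) (hk : 32 ≤ k n) (hq : 0 < q n) :
    ∃ c > 0, ∀ I ∈ η n, ∀ l, c ≤ volume.real (I l) := by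
  have hk' : (32 : ℝ) ≤ k n := by exact_mod_cast hk
  have hq' : (0 : ℝ) < q n := by exact_mod_cast hq
  refine ⟨_, ?_, hη.measure_ge n hn⟩
  have h1 : (16 : ℝ) / (k n : ℝ) ^ 5 < 1 := by
    rw [div_lt_one (by positivity)]
    calc (16 : ℝ) < 32 ^ 5 := by norm_num
      _ ≤ (k n : ℝ) ^ 5 := by gcongr
  have h2 : (0 : ℝ) < 1 - 16 / (k n : ℝ) ^ 5 := by linarith
  positivity

lemma DecompositionConditions.finite (hη : DecompositionConditions k q h η) {n : ℕ}
    (hn : 1 ≤ n) (hk : 32 ≤ k n) (hq : 0 < q n) : (η n).Finite := by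
  obtain ⟨c, hc, h1⟩ := hη.piece_pos hn hk hq
  exact finite_of_volume_le (by omega) (hη.partialDec n hn) hc h1

lemma DecompositionConditions.volume_compl_support (hη : DecompositionConditions k q h η) {n : ℕ}
    (hn : 1 ≤ n) (hk : 32 ≤ k n) (hq : 0 < q n) :
    volume.real (support (η n))ᶜ ≤ 25 / (k n : ℝ) ^ 5 := by
  rw [probReal_compl_eq_one_sub (measurableSet_support (hη.partialDec n hn) (hη.finite hn hk hq))]
  have := hη.cover n hn
  rw [support]
  linarith

lemma div_pow_five_le {n k : ℕ} (hn : 1 ≤ n) (hk : n ≤ k) :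
    25 / (k : ℝ) ^ 5 ≤ 25 * (1 / (n : ℝ) ^ 2) := by
  have hn' : (1 : ℝ) ≤ n := by exact_mod_cast hn
  have hk' : (n : ℝ) ≤ k := by exact_mod_cast hk
  rw [mul_one_div]
  have h1 : (n : ℝ) ^ 2 ≤ (k : ℝ) ^ 5 := by
    calc (n : ℝ) ^ 2 ≤ (n : ℝ) ^ 5 := pow_le_pow_right₀ hn' (by norm_num)
      _ ≤ (k : ℝ) ^ 5 := by gcongr
  exact div_le_div_of_nonneg_left (by norm_num) (by positivity) h1

end decomposition

/-! ### Almost everywhere stabilization of the metrics -/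

/-- Borel–Cantelli for the sets of points that `(H n)⁻¹` sends outside the support of `η n`; inside
it the step from `H (n - 1)` to `H n` leaves the metric unchanged. -/
lemma eventually_stable {k q : ℕ → ℕ} {g φ : ℕ → Equiv.Perm Torus}
    {η : ∀ n, Set (Fin (k n) → Set Torus)} (hq : ∀ n ≥ 1, 0 < q n)
    (hg : ∀ n ≥ 1, IsAreaPreservingDiffeo (g n)) (hφ : ∀ n ≥ 1, IsAreaPreservingDiffeo (φ n))
    (hk : ∀ n ≥ 1, n ^ 5 ≤ k n) (hη : DecompositionConditions k q (stepConj g φ) η) :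
    ∀ᵐ x, ∃ N, x ∈ stableSet (bigConj g φ) N := by
  have hH := isAreaPreservingDiffeo_bigConj hg hφ
  have hbase : ∀ n : ℕ, 32 ≤ k (n + 2) ∧ n + 2 ≤ k (n + 2) := fun n =>
    pow_five_le (by omega) (hk _ (by omega))
  -- The indices start at two because `k n ≥ 32` is needed for positive pieces, and `n ^ 5 ≤ k n`
  -- gives it only from there on.
  set s : ℕ → Set Torus := fun n =>
    ((bigConj g φ (n + 2))⁻¹ : Equiv.Perm Torus) ⁻¹' (support (η (n + 2)))ᶜ with hs
  have hms : ∀ n, MeasurableSet (support (η (n + 2))) := fun n =>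
    measurableSet_support (hη.partialDec _ (by omega))
      (hη.finite (by omega) (hbase n).1 (hq _ (by omega)))
  have hle : ∀ n, volume (s n) ≤ ENNReal.ofReal (25 * (1 / ((n + 2 : ℕ) : ℝ) ^ 2)) := by
    intro n
    rw [← ofReal_measureReal]
    refine ENNReal.ofReal_le_ofReal ?_
    rw [hs, (hH (n + 2)).inv.real_preimage (hms n).compl]
    exact (hη.volume_compl_support (by omega) (hbase n).1 (hq _ (by omega))).trans
      (div_pow_five_le (by omega) (hbase n).2)
  have hsum : Summable fun n : ℕ => 25 * (1 / ((n + 2 : ℕ) : ℝ) ^ 2) :=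
    ((summable_nat_add_iff 2).2 (Real.summable_one_div_nat_pow.2 one_lt_two)).mul_left 25
  have hne : ∑' n, volume (s n) ≠ ⊤ :=
    ne_top_of_le_ne_top hsum.tsum_ofReal_ne_top (ENNReal.tsum_le_tsum hle)
  filter_upwards [ae_eventually_notMem hne] with x hx
  obtain ⟨N, hN⟩ := eventually_atTop.1 hx
  -- The condition with index `l` governs the step from `H (l + 1)` to `H (l + 2)`, so the metrics
  -- are constant from `N + 1` on.
  refine ⟨N + 1, fun n hn => ?_⟩
  induction n, hn using Nat.le_induction with
  | base => rfl
  | succ n hn ih =>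
    rw [← ih]
    obtain ⟨l, rfl⟩ : ∃ l, n = l + 1 := ⟨n - 1, by omega⟩
    have h1 := hN l (by omega)
    simp only [hs, mem_preimage, mem_compl_iff, not_not, support, mem_iUnion] at h1
    obtain ⟨I, hI, i, hi⟩ := h1
    have h2 := hη.isometric (l + 2) (by omega) I hI i _ hi
    exact pullbackMetric_mul_of_orthogonal (hH (l + 1)).1
      ((hg _ (by omega)).mul (hφ _ (by omega))).1
      (Matrix.mem_specialOrthogonalGroup_iff.1 h2).1

/-! ### Size of the shear and conjugation identities -/

lemma le_shearAmount {q : ℕ → ℕ} {σ : ℝ} (hσ : 1 / 4 < σ) {n K : ℕ} (hn : 1 ≤ n) (hq : 0 < q n)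
    (hK : 0 < K) (hqK : 2 * (K : ℝ) < (q n : ℝ) ^ (1 / 4 : ℝ)) : K ≤ shearAmount q σ n := by
  have hq' : (1 : ℝ) ≤ q n := by exact_mod_cast hq
  have hn' : (1 : ℝ) ≤ n := by exact_mod_cast hn
  have hK' : (0 : ℝ) < K := by exact_mod_cast hK
  refine Nat.le_floor ?_
  have h1 : (q n : ℝ) ^ (1 / 4 : ℝ) ≤ (q n : ℝ) ^ σ := Real.rpow_le_rpow_of_exponent_le hq' hσ.le
  nlinarith

lemma approxMap_pow_eq (p : ℕ → ℤ) (q : ℕ → ℕ) (g φ : ℕ → Equiv.Perm Torus) (n m : ℕ) :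
    approxMap p q g φ n ^ m
      = bigConj g φ n * rot (m • alpha p q (n + 1)) * (bigConj g φ n)⁻¹ := by
  rw [approxMap, conj_pow, rot_pow]

/-- Regrouping `H n ∘ g ∘ φ` isolates the distributing map `φ ∘ R ∘ φ⁻¹`, conjugated by `H n ∘ g`.
-/
lemma conj_rot_eq (g φ : ℕ → Equiv.Perm Torus) (n : ℕ) (t : UnitAddCircle) :
    bigConj g φ (n + 1) * rot t * (bigConj g φ (n + 1))⁻¹
      = bigConj g φ n * g (n + 1) * (φ (n + 1) * rot t * (φ (n + 1))⁻¹)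
        * (bigConj g φ n * g (n + 1))⁻¹ := by
  rw [bigConj, stepConj]; group

end AbC

end

/-! ### Assembly of the proof -/

theorem proposition5
    (p : ℕ → ℤ) (q k m : ℕ → ℕ) (σ : ℝ) (hσ : 1 / 4 < σ ∧ σ < 1 / 2)
    (g φ : ℕ → Equiv.Perm Torus) (f : Equiv.Perm Torus)
    (hscheme : IsScheme p q g φ)
    (hparam : ParameterConditions k q σ (bigConj g φ))
    (hshear : ∀ n ≥ 1,
      IsStepShear (stripCount k n) (shearAmount q σ n) (q n) (stripMargin k n) (g n))
    (hf : IsSmoothDiffeo f)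
    (hconv : Tendsto (fun n => d1 (approxMap p q g φ n) f) atTop (𝓝 0))
    (hclose : ∀ n ≥ 1, d1 (approxMap p q g φ n ^ m n) (f ^ m n) < ENNReal.ofReal (1 / 2 ^ n))
    (η : ∀ n, Set (Fin (k n) → Set Torus))
    (hη : DecompositionConditions k q (stepConj g φ) η)
    (hηhat : ConvergesToPoints (muBar (limitMetric (bigConj g φ))) (fun n => etaHat (η n)))
    (hνhat : ConvergesToPoints (muBar (limitMetric (bigConj g φ)))
      (fun n => nuHat (bigConj g φ (n - 1)) (g n) (η n)))
    (γ δ ε₁ ε₂ : ℕ → ℝ)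
    (hγ : ∀ n ≥ 1, γ n < 1 / ((k n : ℝ) ^ 3 * q n))
    (hδ : ∀ n ≥ 1, δ n < 50 / (k n : ℝ) ^ 2)
    (hε₁ : ∀ n ≥ 1, ε₁ n < 1 / n)
    (hε₂ : ∀ n ≥ 1, ε₂ n < 1 / n)
    (hdist : ∀ n ≥ 1, ∀ I ∈ η n, ∀ j : Fin (k n),
      Distributes (bigPhi p q φ m n) I j (γ n) (δ n) (ε₁ n) (ε₂ n)) :
    (∀ᵐ x : Torus, (limitMetric (bigConj g φ) x).PosDef ∧
      Tendsto (fun n => pullbackMetric (bigConj g φ n) x) atTop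
        (𝓝 (limitMetric (bigConj g φ) x))) ∧
    IsProbabilityMeasure (muBar (limitMetric (bigConj g φ))) ∧
    IsWeaklyMixing (muBar (limitMetric (bigConj g φ))) (projExt f) := by
  have hq := hscheme.q_pos
  have hH := isAreaPreservingDiffeo_bigConj hscheme.diffeo_g hscheme.diffeo_φ
  have hst := eventually_stable hq hscheme.diffeo_g hscheme.diffeo_φ hparam.k_large hη
  have hprob := isProbabilityMeasure_muBar_limitMetric hH hst
  refine ⟨?_, hprob, ?_⟩
  · filter_upwards [hst] with x ⟨N, hN⟩
    exact limitMetric_posDef_of_mem_stableSet hH hN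
  have hmp := measurePreserving_limit hH hst hf (fun n => alpha p q (n + 1)) hconv
  refine isWeaklyMixing_of_tendsto hmp m fun A hA B hB => ?_
  obtain ⟨M, hM⟩ := (isCompact_univ (X := ProjTM)).exists_bound_of_continuousOn hA.continuousOn
  replace hM : ∀ x, ‖A x‖ ≤ M := fun x => hM x (mem_univ x)
  set H := bigConj g φ with hHdef
  set ν := muBar (limitMetric H) with hν
  set t : ℕ → UnitAddCircle := fun n => m n • alpha p q (n + 1) with ht
  set F : ℕ → Equiv.Perm Torus := fun n => H n * rot (t n) * (H n)⁻¹ with hF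
  have hFs : ∀ n, IsSmoothDiffeo (F n) := fun n =>
    ((hH n).1.mul (isSmoothDiffeo_rot _)).mul (hH n).1.inv
  -- replace the powers of `f` by those of the approximating maps
  have hd1 : Tendsto (fun n => d1 (F n) (f ^ m n)) atTop (𝓝 0) := by
    have h0 : Tendsto (fun n : ℕ => ENNReal.ofReal (1 / 2 ^ n)) atTop (𝓝 0) := by
      rw [← ENNReal.ofReal_zero]
      refine ENNReal.tendsto_ofReal ?_
      simpa using tendsto_pow_atTop_nhds_zero_of_lt_one (r := (1 / 2 : ℝ)) (by norm_num)
        (by norm_num)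
    refine tendsto_of_tendsto_of_tendsto_of_le_of_le' tendsto_const_nhds h0
      (Eventually.of_forall fun _ => zero_le) ?_
    filter_upwards [eventually_ge_atTop 1] with n hn
    have := (hclose n hn).le
    rwa [approxMap_pow_eq] at this
  have hstep1 := tendsto_integral_norm_projExt_sub hH hst t (fun n => hf.pow (m n)) hd1 hA
  -- the approximating maps are mixing
  have hstep2 : Tendsto (fun n => (∫ x in B, A (projExt (F n) x) ∂ν) - ν.real B * ∫ x, A x ∂ν)
      atTop (𝓝 0) := by
    obtain ⟨B', hB', hBB'⟩ := hνhat B hB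
    have hz := tendsto_volume_stableSet_compl hH hst
    have hBr : Tendsto (fun n => ν.real (symmDiff B (B' n))) atTop (𝓝 0) :=
      (ENNReal.tendsto_toReal (by simp)).comp hBB'
    have hzp : Tendsto (fun n => volume.real (stableSet H (n - 1))ᶜ) atTop (𝓝 0) :=
      hz.comp (tendsto_sub_atTop_nat 1)
    have hinv : Tendsto (fun n : ℕ => 1 / (n : ℝ)) atTop (𝓝 0) := tendsto_one_div_atTop_nhds_zero_nat
    have hr : Tendsto (fun n : ℕ => 2 * M * ν.real (symmDiff B (B' n))
        + 2 * M * (2 * (1 / n) + 50 * (1 / n)) + 14 * M * (25 * (1 / n))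
        + 6 * M * volume.real (stableSet H (n - 1))ᶜ) atTop (𝓝 0) := by
      have := (((hBr.const_mul (2 * M)).add
        (((hinv.const_mul 2).add (hinv.const_mul 50)).const_mul (2 * M))).add
        ((hinv.const_mul 25).const_mul (14 * M))).add (hzp.const_mul (6 * M))
      simpa using this
    rw [Metric.tendsto_atTop]
    intro ε hε
    obtain ⟨κ, hκ, hAκ⟩ := Metric.uniformContinuous_iff.1
      (CompactSpace.uniformContinuous_of_continuous hA) (ε / 4) (by positivity)
    have hev : ∀ᶠ n : ℕ in atTop, 1 / (n : ℝ) < κ := hinv.eventually (gt_mem_nhds hκ)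
    have hev2 := hr.eventually (gt_mem_nhds (show (0 : ℝ) < ε / 4 by positivity))
    obtain ⟨N, hN⟩ := eventually_atTop.1 (hev.and hev2)
    -- From `n = 5` on the bound on `b n / a n` is available, and `n ^ 5 ≤ k n` makes all parameter
    -- inequalities hold.
    refine ⟨max N 5, fun n hn => ?_⟩
    obtain ⟨hκn, hrn⟩ := hN n ((le_max_left _ _).trans hn)
    have hn5 : 5 ≤ n := (le_max_right _ _).trans hn
    obtain ⟨hk32, hnk⟩ := pow_five_le (by omega) (hparam.k_large n (by omega))
    have hM0 : 0 ≤ M := (norm_nonneg _).trans (hM ((0, 0), 0))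
    have hqn := hq n (by omega)
    have hK : 0 < k n := by omega
    have hK' : (32 : ℝ) ≤ k n := by exact_mod_cast hk32
    have hnR : (5 : ℝ) ≤ n := by exact_mod_cast hn5
    have hnkR : (n : ℝ) ≤ k n := by exact_mod_cast hnk
    have hqR : (1 : ℝ) ≤ q n := by exact_mod_cast hqn
    have hτ : ∀ y y', ptDist y y' < 3 / k n →
        ‖A (projExt (H (n - 1)) y) - A (projExt (H (n - 1)) y')‖ ≤ ε / 4 := by
      intro y y' hyy
      have h1 := ptDist_image_le (by positivity) (hparam.diam_image n (by omega)) hyy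
      have h2 : (1 : ℝ) / (n : ℝ) ^ 2 ≤ 1 / n :=
        one_div_le_one_div_of_le (by positivity) (by nlinarith)
      have h3 := hAκ (((dist_le_ptDist _ _).trans (h1.trans h2)).trans_lt hκn)
      rw [dist_eq_norm] at h3
      exact h3.le
    have hbK := le_shearAmount hσ.1 (by omega : 1 ≤ n) hqn hK (hparam.q_large n (by omega))
    have hb : 0 < shearAmount q σ n := hK.trans_le hbK
    have hbKR : (k n : ℝ) ≤ shearAmount q σ n := by exact_mod_cast hbK
    have hb3 : 1 / (shearAmount q σ n : ℝ) < 3 / k n := by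
      refine (one_div_le_one_div_of_le (by positivity) hbKR).trans_lt ?_
      gcongr; norm_num
    have ha : 0 < stripCount k n := Nat.pow_pos hK
    have hba : (shearAmount q σ n : ℝ) / stripCount k n ≤ 1 / k n := by
      refine (hparam.shear_step n (by omega)).trans (one_div_le_one_div_of_le (by positivity) ?_)
      nlinarith
    have hεs0 : 0 ≤ stripMargin k n := by rw [stripMargin]; positivity
    have hεs : stripMargin k n < 1 / 4 := by
      rw [stripMargin]
      refine one_div_lt_one_div_of_lt (by norm_num) ?_
      have h1 : (5 : ℝ) ^ 5 ≤ (n : ℝ) ^ 5 := by gcongr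
      have h2 : (1 : ℝ) ≤ (k n : ℝ) ^ 10 := one_le_pow₀ (by linarith)
      nlinarith
    have hU := measurableSet_support (hη.partialDec n (by omega)) (hη.finite (by omega) hk32 hqn)
    have hUg : support (η n) ⊆ goodDomain (stripCount k n) (stripMargin k n) :=
      iUnion₂_subset fun I hI => iUnion_subset fun l => (hη.squares n (by omega) I hI l).1
    have hUrot : ∀ x ∈ support (η n), jacobian (g n * φ n : Equiv.Perm Torus) x ∈
        Matrix.specialOrthogonalGroup (Fin 2) ℝ := by
      intro x hx
      simp only [support, mem_iUnion] at hx
      obtain ⟨I, hI, l, hl⟩ := hx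
      exact hη.isometric n (by omega) I hI l x hl
    have hUc : volume.real (support (η n))ᶜ ≤ 25 * (1 / n) := by
      refine (hη.volume_compl_support (by omega) hk32 hqn).trans
        ((div_pow_five_le (by omega) hnk).trans ?_)
      have : (1 : ℝ) / (n : ℝ) ^ 2 ≤ 1 / n :=
        one_div_le_one_div_of_le (by positivity) (by nlinarith)
      linarith
    obtain ⟨c, hc, hcI⟩ := hη.piece_pos (by omega) hk32 hqn
    have hγ' : γ n ≤ 1 / k n := by
      refine (hγ n (by omega)).le.trans (one_div_le_one_div_of_le (by positivity) ?_)
      have h1 : (k n : ℝ) ≤ (k n : ℝ) ^ 3 := le_self_pow₀ (by linarith) (by norm_num)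
      nlinarith [pow_pos (show (0 : ℝ) < k n by linarith) 3]
    have hd1 : 50 / (k n : ℝ) ^ 2 < 1 := by
      rw [div_lt_one (by positivity)]; nlinarith
    have hdn : 50 / (k n : ℝ) ^ 2 ≤ 50 * (1 / n) := by
      rw [mul_one_div]
      exact div_le_div_of_nonneg_left (by norm_num) (by positivity) (by nlinarith)
    obtain ⟨hB'm, 𝒮, h𝒮, hB𝒮⟩ := hB' n
    have hΦ : bigPhi p q φ m n = φ n * rot (t n) * (φ n)⁻¹ := by rw [bigPhi, rot_pow]
    have hdist' := hdist n (by omega)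
    rw [hΦ] at hdist'
    have key := norm_setIntegral_projExt_sub_le hH hst (n - 1) hK hA.measurable hM hτ hb hb3 ha hba
      hεs hεs0 (hscheme.diffeo_g n (by omega)) (hscheme.diffeo_φ n (by omega))
      (hshear n (by omega)) (hη.partialDec n (by omega)) (hη.finite (by omega) hk32 hqn)
      (hη.same_measure n (by omega)) (fun I hI l => hc.trans_le (hcI I hI l)) hU hUg hUrot (t n)
      hγ' (hδ n (by omega)).le hd1 (e := 1 / n) (by positivity)
      ((div_le_one (by positivity)).2 (by linarith)) (hε₁ n (by omega)).le (hε₂ n (by omega)).le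
      (by positivity) hdist' hB hB'm h𝒮 hB𝒮
    have hFn : F n = H (n - 1) * g n * (φ n * rot (t n) * (φ n)⁻¹) * (H (n - 1) * g n)⁻¹ := by
      obtain ⟨l, rfl⟩ : ∃ l, n = l + 1 := ⟨n - 1, by omega⟩
      exact conj_rot_eq g φ l _
    rw [← hFn] at key
    rw [dist_zero_right]
    -- The oscillation term is `3 * (ε / 4)`, and the other errors together stay below `ε / 4`.
    refine key.trans_lt ?_
    have h1 : 2 * M * (2 * (1 / n) + 50 / (k n : ℝ) ^ 2) ≤ 2 * M * (2 * (1 / n) + 50 * (1 / n)) := by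
      gcongr
    have h2 : 14 * M * volume.real (support (η n))ᶜ ≤ 14 * M * (25 * (1 / n)) := by gcongr
    linarith
  have hcf : ∀ n, Integrable (fun x => A (projExt (f ^ m n : Equiv.Perm Torus) x)) ν := fun n =>
    integrable_of_forall_norm_le (hA.measurable.comp (measurable_projExt (hf.pow _))) fun _ => hM _
  have hcF : ∀ n, Integrable (fun x => A (projExt (F n) x)) ν := fun n =>
    integrable_of_forall_norm_le (hA.measurable.comp (measurable_projExt (hFs n))) fun _ => hM _
  have hstep3 : Tendsto (fun n => (∫ x in B, A (projExt (F n) x) ∂ν)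
      - ∫ x in B, A (projExt (f ^ m n : Equiv.Perm Torus) x) ∂ν) atTop (𝓝 0) := by
    refine squeeze_zero_norm (fun n => ?_) hstep1
    rw [← integral_sub (hcF n).integrableOn (hcf n).integrableOn]
    exact (norm_integral_le_integral_norm _).trans
      (setIntegral_le_integral ((hcF n).sub (hcf n)).norm
        (Eventually.of_forall fun x => norm_nonneg _))
  have hfinal := (hstep2.sub hstep3).add_const (ν.real B * ∫ x, A x ∂ν : ℂ)
  rw [sub_zero, zero_add] at hfinal
  refine hfinal.congr fun n => ?_
  simp only [projExt_pow hf]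
  ring
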